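/- Let $d\ge 1$ and let $A\in Sp(2d,\mathbb Z)$ be such that $1$ is not an eigenvalue of $A$ and $A$ has an eigenvalue of modulus larger than $1$; put $\lambda_{\max}=\max\{\log|\beta|:\beta\in\mathrm{spec}(A)\}>0$. *Quantum states.* Write $\sigma(\rho,\rho')=\langle\rho,J\rho'\rangle$ with $J=\begin{pmatrix}0&-\mathrm{Id}\\ \mathrm{Id}&0\end{pmatrix}$. For $N\in\mathbb N^*$ let $2\pi\hbar N=1$ and let $U_\hbar(x,\xi)$, $(U_\hbar(x,\xi)u)(y)=e^{\frac{i}{\hbar}(\langle\xi,y\rangle-\langle x,\xi\rangle/2)}u(y-x)$, be the translation operators on $\mathcal S'(\mathbb R^d)$. For $\kappa=(\kappa_1,\kappa_2)\in[0,2\pi)^{2d}$ let $\mathcal H_N(\kappa)$ be the space of $\psi\in\mathcal S'(\mathbb R^d)$ with $U_\hbar(q,p)\psi=e^{\frac{i}{2\hbar}\langle q,p\rangle}e^{-i\langle\kappa_1,q\rangle+i\langle\kappa_2,p\rangle}\psi$ for all $(q,p)\in\mathbb Z^{2d}$, with the Hilbert structure (unique up to a positive factor) for which all $U_\hbar(r/N)$,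 $r\in\mathbb Z^{2d}$, are unitary. Let $M(A)$ be the quantum propagator, i.e. the operator, unique up to a phase, that is unitary on $L^2(\mathbb R^d)$, is extended continuously to $\mathcal S'(\mathbb R^d)$, and satisfies $M(A)U_\hbar(\rho)=U_\hbar(A\rho)M(A)$ for all $\rho\in\mathbb R^{2d}$. When $M(A)\mathcal H_N(\kappa)=\mathcal H_N(\kappa)$, let $M_\kappa(A)$ be its restriction to $\mathcal H_N(\kappa)$. *Quantization.* Let $0<\lambda_1^+<\dots<\lambda_r^+=\lambda_{\max}$ be the positive Lyapunov exponents of $A$. Fix a symplectic reduction $A=Q(A_0\diamond A_1\diamond\dots\diamond A_r)Q^{-1}$, where $\diamond$ is the symplectic direct sum, $Q\in Sp(2d,\mathbb R)$, $A_0\in Sp(2d_0,\mathbb R)$ ($d_0\ge 0$) has its spectrum on the unit circle, and for $1\le i\le r$ one has $A_i=\mathrm{diag}(D_i,D_i^{*-1})$ with $D_i\in GL(d_i,\mathbb R)$ having its spectrum on $\{|z|=e^{\lambda_i^+}\}$. Fix $0<\epsilon_0\le\lambda_{\max}$, and let $D_1(\hbar)$ be the diagonal matrix with entries $\hbar^{-\epsilon_0/(2\lambda_{\max})}$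 on the $d_0$ coordinates of block $0$ and $\hbar^{-\lambda_i^+/(2\lambda_{\max})}$ on the $d_i$ coordinates of block $i$. Put $B(\hbar)=Q\,\mathrm{diag}(D_1(\hbar),D_1(\hbar))\,Q^{-1}$ and $G_\hbar(\rho)=2^{d/2}|\det B(\hbar)|^{1/2}e^{-\pi\|B(\hbar)\rho\|^2}$. For a smooth function $b(\rho)=\sum_{r\in\mathbb Z^{2d}}b_re^{-2i\pi\langle Jr,\rho\rangle}$ on $\mathbb T^{2d}$, the Weyl quantization on $\mathcal H_N(\kappa)$ is $\mathrm{Op}^w_\kappa(b)=\sum_r b_rU_\hbar(r/N)$. For $a\in\mathcal C^\infty(\mathbb T^{2d},\mathbb C)$ set $\mathrm{Op}^+_\kappa(a)=\mathrm{Op}^w_\kappa\big(a\star(G_\hbar\sharp G_\hbar)\big)$, where $\star$ is convolution on $\mathbb R^{2d}$ and $\sharp$ is the Moyal product $$(F\sharp G)(\rho)=(\pi\hbar)^{-2d}\iint e^{-\frac{2i}{\hbar}\sigma(w_1,w_2)}F(\rho+w_1)G(\rho+w_2)\,dw_1dw_2 .$$ **Proposition 4.3.** For every $\epsilon>0$ and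 every $a\in\mathcal C^\infty(\mathbb T^{2d},\mathbb C)$ there is a sequence $R_{a,\epsilon}(N)\to0$ as $N\to\infty$ such that the following holds for every $N\ge1$, every $\kappa\in[0,2\pi)^{2d}$ with $M(A)\mathcal H_N(\kappa)=\mathcal H_N(\kappa)$ and every unit eigenvector $\psi^N\in\mathcal H_N(\kappa)$ of $M_\kappa(A)$. With $\mu^N(b):=\langle\psi^N|\mathrm{Op}^+_\kappa(b)|\psi^N\rangle_{\mathcal H_N(\kappa)}$, $$\big|\mu^N(a\circ A^t)-\mu^N(a)\big|\le R_{a,\epsilon}(N)\qquad\text{for all } t\in\mathbb Z,\ |t|\le m_E(N):=\Big[\frac{1-\epsilon}{2\lambda_{\max}}\log N\Big].$$ The sequence $R_{a,\epsilon}$ depends only on $a$ and $\epsilon$ (the matrix $A$, its reduction and $\epsilon_0$ being fixed), and neither on $t$, $\kappa$ nor $\psi^N$. -/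

import Mathlib

open MeasureTheory SchwartzMap Matrix
open scoped ContDiff Convolution

noncomputable section

namespace CatMap

/-! ### Phase space -/

/-- The phase space `ℝ²ᵈ`; a point is `ρ = (x, ξ)` with `x = ρ ∘ inl`, `ξ = ρ ∘ inr`. -/
abbrev Phase (d : ℕ) : Type := Fin d ⊕ Fin d → ℝ

/-- The lattice `ℤ²ᵈ`. -/
abbrev Lattice (d : ℕ) : Type := Fin d ⊕ Fin d → ℤ

/-- The configuration space `ℝᵈ`. -/
abbrev Conf (d : ℕ) : Type := EuclideanSpace ℝ (Fin d)

variable {d : ℕ}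

/-- The position component of a phase space point. -/
def pos (ρ : Phase d) : Conf d := WithLp.toLp 2 fun j => ρ (Sum.inl j)

/-- The momentum component of a phase space point. -/
def mom (ρ : Phase d) : Conf d := WithLp.toLp 2 fun j => ρ (Sum.inr j)

/-- The inclusion `ℤ²ᵈ ⊆ ℝ²ᵈ`. -/
def ofLattice (n : Lattice d) : Phase d := fun i => (n i : ℝ)

/-- The symplectic form `σ(ρ, ρ') = ⟨ρ, J ρ'⟩`, with `J = (0, -1; 1, 0)`. -/
def sympl (ρ ρ' : Phase d) : ℝ := ρ ⬝ᵥ (Matrix.J (Fin d) ℝ *ᵥ ρ')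

/-- The semiclassical parameter, `2π ħ N = 1`. -/
def planck (N : ℕ) : ℝ := (2 * Real.pi * N)⁻¹

lemma pos_add (ρ ρ' : Phase d) : pos (ρ + ρ') = pos ρ + pos ρ' := rfl

lemma mom_add (ρ ρ' : Phase d) : mom (ρ + ρ') = mom ρ + mom ρ' := rfl

lemma sympl_eq (ρ ρ' : Phase d) :
    sympl ρ ρ' = inner ℝ (mom ρ) (pos ρ') - inner ℝ (pos ρ) (mom ρ') := by
  simp only [sympl, Matrix.J, pos, mom, dotProduct, Fintype.sum_sum_type, Matrix.mulVec,
    PiLp.inner_apply, Matrix.fromBlocks_apply₁₁, Matrix.fromBlocks_apply₁₂,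
    Matrix.fromBlocks_apply₂₁, Matrix.fromBlocks_apply₂₂, Matrix.zero_apply, Matrix.neg_apply,
    Matrix.one_apply]
  simp [mul_comm]
  ring

lemma sympl_swap (ρ ρ' : Phase d) : sympl ρ' ρ = -sympl ρ ρ' := by
  rw [sympl_eq, sympl_eq, real_inner_comm, real_inner_comm (pos ρ')]
  ring

lemma sympl_smul_right (c : ℝ) (ρ ρ' : Phase d) : sympl ρ (c • ρ') = c * sympl ρ ρ' := by
  simp [sympl, Matrix.mulVec_smul]

lemma sympl_ofLattice (m n : Lattice d) : ∃ k : ℤ, sympl (ofLattice m) (ofLattice n) = k := by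
  refine ⟨m ⬝ᵥ (Matrix.J (Fin d) ℤ *ᵥ n), ?_⟩
  rw [sympl, ← Matrix.map_J (l := Fin d) (Int.castRingHom ℝ)]
  simp [ofLattice, dotProduct, Matrix.mulVec]

/-! ### Translation operators (Heisenberg group) -/

/-- The phase `e^{(i/ħ)(⟨ξ, y⟩ - ⟨x, ξ⟩/2)}`. -/
def heisenbergPhase (ħ : ℝ) (ρ : Phase d) (y : Conf d) : ℂ :=
  Complex.exp (Complex.I *
    (((inner ℝ (mom ρ) y - inner ℝ (pos ρ) (mom ρ) / 2) / ħ : ℝ) : ℂ))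

lemma hasTemperateGrowth_expI :
    Function.HasTemperateGrowth fun t : ℝ => Complex.exp (Complex.I * (t : ℂ)) := by
  have hderiv : ∀ n : ℕ, iteratedDeriv n (fun t : ℝ => Complex.exp (Complex.I * (t : ℂ))) =
      fun t : ℝ => Complex.I ^ n * Complex.exp (Complex.I * (t : ℂ)) := by
    intro n
    induction n with
    | zero => simp
    | succ n ih =>
      rw [iteratedDeriv_succ, ih]
      funext t
      have h : HasDerivAt (fun t : ℝ => Complex.exp (Complex.I * (t : ℂ)))
          (Complex.exp (Complex.I * (t : ℂ)) * (Complex.I * 1)) t :=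
        ((Complex.ofRealCLM.hasDerivAt (x := t)).const_mul Complex.I).cexp
      rw [(h.const_mul (Complex.I ^ n)).deriv]
      ring
  refine ⟨?_, fun n => ⟨0, 1, fun t => ?_⟩⟩
  · exact Complex.contDiff_exp.comp (contDiff_const.mul Complex.ofRealCLM.contDiff)
  · rw [norm_iteratedFDeriv_eq_norm_iteratedDeriv, hderiv]
    simp [mul_comm Complex.I, Complex.norm_exp_ofReal_mul_I]

lemma hasTemperateGrowth_heisenbergPhase (ħ : ℝ) (ρ : Phase d) :
    (heisenbergPhase ħ ρ).HasTemperateGrowth := by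
  have h : Function.HasTemperateGrowth fun y : Conf d =>
      (inner ℝ (mom ρ) y - inner ℝ (pos ρ) (mom ρ) / 2) / ħ := by
    simp only [div_eq_mul_inv]
    exact ((Function.hasTemperateGrowth_inner_right (mom ρ)).sub (.const _)).mul (.const _)
  exact hasTemperateGrowth_expI.comp h

/-- `U_ħ(ρ) = e^{(i/ħ) σ(ρ, (Q, P))}` on Schwartz functions:
`(U_ħ(x, ξ) u)(y) = e^{(i/ħ)(⟨ξ, y⟩ - ⟨x, ξ⟩/2)} u(y - x)`. -/
def translS (ħ : ℝ) (ρ : Phase d) : 𝓢(Conf d, ℂ) →L[ℂ] 𝓢(Conf d, ℂ) :=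
  SchwartzMap.smulLeftCLM ℂ (heisenbergPhase ħ ρ) ∘L SchwartzMap.compSubConstCLM ℂ (pos ρ)

lemma translS_apply (ħ : ℝ) (ρ : Phase d) (u : 𝓢(Conf d, ℂ)) (y : Conf d) :
    translS ħ ρ u y = heisenbergPhase ħ ρ y * u (y - pos ρ) := by
  simp [translS, hasTemperateGrowth_heisenbergPhase]

/-- `(x, ξ) ↦ (-x, ξ)`; `U_ħ(-x, ξ)` is the transpose of `U_ħ(x, ξ)` for the bilinear pairing
`∫ u v`. -/
def flipPos (ρ : Phase d) : Phase d :=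
  Sum.elim (fun j => -ρ (Sum.inl j)) (fun j => ρ (Sum.inr j))

lemma pos_flipPos (ρ : Phase d) : pos (flipPos ρ) = -pos ρ := rfl

lemma mom_flipPos (ρ : Phase d) : mom (flipPos ρ) = mom ρ := rfl

lemma flipPos_add (ρ ρ' : Phase d) : flipPos (ρ + ρ') = flipPos ρ + flipPos ρ' := by
  funext i
  rcases i with i | i
  · simp [flipPos]; ring
  · simp [flipPos]

/-- `U_ħ(ρ)` on tempered distributions, by duality. -/
def transl (ħ : ℝ) (ρ : Phase d) : 𝓢'(Conf d, ℂ) →L[ℂ] 𝓢'(Conf d, ℂ) :=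
  PointwiseConvergenceCLM.precomp ℂ (translS ħ (flipPos ρ))

lemma transl_apply (ħ : ℝ) (ρ : Phase d) (ψ : 𝓢'(Conf d, ℂ)) (u : 𝓢(Conf d, ℂ)) :
    transl ħ ρ ψ u = ψ (translS ħ (flipPos ρ) u) := rfl

/-- The operator on distributions extends the one on Schwartz functions. -/
lemma transl_coe (ħ : ℝ) (ρ : Phase d) (u : 𝓢(Conf d, ℂ)) :
    transl ħ ρ (u : 𝓢'(Conf d, ℂ)) = (translS ħ ρ u : 𝓢'(Conf d, ℂ)) := by
  ext v
  rw [transl_apply, SchwartzMap.coe_apply, SchwartzMap.coe_apply,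
    ← integral_sub_right_eq_self _ (pos ρ)]
  refine integral_congr_ae (Filter.Eventually.of_forall fun y => ?_)
  simp only [translS_apply, pos_flipPos, sub_neg_eq_add, sub_add_cancel, smul_eq_mul,
    heisenbergPhase, mom_flipPos, inner_sub_right, inner_neg_left]
  rw [real_inner_comm (pos ρ) (mom ρ)]
  have : ((inner ℝ (mom ρ) y - inner ℝ (mom ρ) (pos ρ) - -inner ℝ (mom ρ) (pos ρ) / 2) / ħ : ℝ) =
      (inner ℝ (mom ρ) y - inner ℝ (mom ρ) (pos ρ) / 2) / ħ := by ring
  rw [real_inner_comm (mom ρ) (pos ρ)] at *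
  rw [this]
  ring

lemma translS_translS (ħ : ℝ) (ρ ρ' : Phase d) (u : 𝓢(Conf d, ℂ)) :
    translS ħ ρ (translS ħ ρ' u) =
      Complex.exp (Complex.I * ((sympl ρ ρ' / (2 * ħ) : ℝ) : ℂ)) • translS ħ (ρ + ρ') u := by
  ext y
  simp only [translS_apply, _root_.smul_apply, smul_eq_mul, heisenbergPhase, pos_add,
    mom_add, sub_sub]
  rw [← mul_assoc, ← mul_assoc, ← Complex.exp_add, ← Complex.exp_add]
  congr 2
  rw [← mul_add, ← mul_add, ← Complex.ofReal_add, ← Complex.ofReal_add]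
  congr 2
  rw [sympl_eq]
  simp only [inner_add_left, inner_add_right, inner_sub_right]
  rw [real_inner_comm (mom ρ) (pos ρ'), real_inner_comm (pos ρ) (mom ρ')]
  by_cases h : ħ = 0
  · simp [h]
  · field_simp
    ring

/-- The commutation relation `U(ρ) U(ρ') = e^{(i/2ħ) σ(ρ, ρ')} U(ρ + ρ')`. -/
lemma transl_transl (ħ : ℝ) (ρ ρ' : Phase d) (ψ : 𝓢'(Conf d, ℂ)) :
    transl ħ ρ (transl ħ ρ' ψ) =
      Complex.exp (Complex.I * ((sympl ρ ρ' / (2 * ħ) : ℝ) : ℂ)) • transl ħ (ρ + ρ') ψ := by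
  ext u
  have h : sympl (flipPos ρ') (flipPos ρ) = sympl ρ ρ' := by
    rw [sympl_eq, sympl_eq]
    simp only [pos_flipPos, mom_flipPos, inner_neg_left, inner_neg_right]
    rw [real_inner_comm (pos ρ), real_inner_comm (mom ρ)]
    ring
  rw [transl_apply, transl_apply, translS_translS, h, map_smul, ← flipPos_add, add_comm ρ' ρ]
  rfl

lemma transl_comm (ħ : ℝ) (ρ ρ' : Phase d) (ψ : 𝓢'(Conf d, ℂ)) :
    transl ħ ρ (transl ħ ρ' ψ) =
      Complex.exp (Complex.I * ((sympl ρ ρ' / ħ : ℝ) : ℂ)) • transl ħ ρ' (transl ħ ρ ψ) := by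
  rw [transl_transl, transl_transl, smul_smul, ← Complex.exp_add, add_comm ρ' ρ, sympl_swap ρ ρ',
    ← mul_add, ← Complex.ofReal_add]
  congr 4
  by_cases h : ħ = 0
  · simp [h]
  · field_simp
    ring

/-! ### Quantum states on the torus -/

/-- The factor `e^{(i/2ħ)⟨q, p⟩} e^{-i⟨κ₁, q⟩ + i⟨κ₂, p⟩}` attached to `n = (q, p) ∈ ℤ²ᵈ`. -/
def quasiFactor (N : ℕ) (κ : Phase d) (n : Lattice d) : ℂ :=
  Complex.exp (Complex.I *
    ((inner ℝ (pos (ofLattice n)) (mom (ofLattice n)) / (2 * planck N)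
      - inner ℝ (pos κ) (pos (ofLattice n)) + inner ℝ (mom κ) (mom (ofLattice n)) : ℝ) : ℂ))

/-- The space `H_N(κ)` of quantum states on the torus, inside the tempered distributions. -/
def torusStates (N : ℕ) (κ : Phase d) : Submodule ℂ 𝓢'(Conf d, ℂ) where
  carrier := {ψ | ∀ n : Lattice d, transl (planck N) (ofLattice n) ψ = quasiFactor N κ n • ψ}
  add_mem' {ψ φ} hψ hφ n := by rw [map_add, hψ n, hφ n, smul_add]
  zero_mem' n := by simp
  smul_mem' c ψ hψ n := by rw [map_smul, hψ n, smul_comm]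

lemma mem_torusStates {N : ℕ} {κ : Phase d} {ψ : 𝓢'(Conf d, ℂ)} :
    ψ ∈ torusStates N κ ↔
      ∀ n : Lattice d, transl (planck N) (ofLattice n) ψ = quasiFactor N κ n • ψ := Iff.rfl

lemma transl_mem_torusStates (N : ℕ) (κ : Phase d) (r : Lattice d) {ψ : 𝓢'(Conf d, ℂ)}
    (hψ : ψ ∈ torusStates N κ) :
    transl (planck N) ((N : ℝ)⁻¹ • ofLattice r) ψ ∈ torusStates N κ := by
  intro n
  have hphase : Complex.exp (Complex.I *
      ((sympl (ofLattice n) ((N : ℝ)⁻¹ • ofLattice r) / planck N : ℝ) : ℂ)) = 1 := by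
    obtain ⟨k, hk⟩ := sympl_ofLattice n r
    rw [sympl_smul_right, hk, planck]
    by_cases hN : (N : ℝ) = 0
    · simp [hN]
    · rw [Complex.exp_eq_one_iff]
      refine ⟨k, ?_⟩
      have : ((N : ℝ)⁻¹ * k / (2 * Real.pi * N)⁻¹ : ℝ) = k * (2 * Real.pi) := by
        field_simp
      rw [this]
      push_cast
      ring
  rw [transl_comm, hphase, one_smul, hψ n, map_smul]

/-- The restriction of `U_ħ(r/N)` to `H_N(κ)`, `r ∈ ℤ²ᵈ`. -/
def torusTransl (N : ℕ) (κ : Phase d) (r : Lattice d) :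
    torusStates N κ →ₗ[ℂ] torusStates N κ :=
  (transl (planck N) ((N : ℝ)⁻¹ • ofLattice r)).toLinearMap.restrict
    fun _ hψ => transl_mem_torusStates N κ r hψ

/-- The inner product `c` on `H_N(κ)` is a Hilbert structure for which every `U_ħ(r/N)`,
`r ∈ ℤ²ᵈ`, is unitary. Such a structure is unique up to a positive factor, so that the expectation
of an operator in a unit vector does not depend on its normalization. -/
def IsTorusHilbertStructure {N : ℕ} {κ : Phase d}
    (c : InnerProductSpace.Core ℂ (torusStates N κ)) : Prop :=
  ∀ (r : Lattice d) (ψ φ : torusStates N κ),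
    c.inner (torusTransl N κ r ψ) (torusTransl N κ r φ) = c.inner ψ φ

/-! ### The quantum propagator -/

/-- `M` is the quantum propagator `M(A)` (at the value `ħ`, well defined up to a phase) of the
symplectic matrix `A`: a unitary operator of `L²(ℝᵈ)`, extended continuously to the tempered
distributions, with `M U_ħ(ρ) = U_ħ(A ρ) M` for all `ρ`. -/
structure IsPropagator (ħ : ℝ) (A : Matrix (Fin d ⊕ Fin d) (Fin d ⊕ Fin d) ℝ)
    (M : 𝓢'(Conf d, ℂ) →L[ℂ] 𝓢'(Conf d, ℂ)) : Prop where
  unitary : ∃ V : Lp ℂ 2 (volume : Measure (Conf d)) ≃ₗᵢ[ℂ] Lp ℂ 2 (volume : Measure (Conf d)),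
    ∀ f : Lp ℂ 2 (volume : Measure (Conf d)),
      M (Lp.toTemperedDistribution f) = Lp.toTemperedDistribution (V f)
  intertwines : ∀ (ρ : Phase d) (ψ : 𝓢'(Conf d, ℂ)),
    M (transl ħ ρ ψ) = transl ħ (A *ᵥ ρ) (M ψ)

/-! ### Observables and Weyl quantization on the torus -/

/-- Smooth functions on the torus `𝕋²ᵈ`, as smooth `ℤ²ᵈ`-periodic functions on `ℝ²ᵈ`. -/
structure IsTorusObservable (a : Phase d → ℂ) : Prop where
  smooth : ContDiff ℝ ∞ a
  periodic : ∀ (n : Lattice d) (ρ : Phase d), a (ρ + ofLattice n) = a ρ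

/-- The Fourier coefficient `b_r = ∫_{𝕋²ᵈ} e^{2iπ⟨Jr, ρ⟩} b(ρ) dρ`, so that
`b(ρ) = ∑_r b_r e^{-2iπ⟨Jr, ρ⟩}`. -/
def torusCoeff (b : Phase d → ℂ) (r : Lattice d) : ℂ :=
  ∫ ρ in Set.Icc (0 : Phase d) 1,
    Complex.exp (2 * Real.pi * Complex.I *
      (((Matrix.J (Fin d) ℝ *ᵥ ofLattice r) ⬝ᵥ ρ : ℝ) : ℂ)) * b ρ

/-- The Weyl quantization `Op_κ^w(b) = ∑_r b_r U_ħ(r/N)` on `H_N(κ)` of a smooth observable `b` on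
the torus. It is the restriction to `H_N(κ)` of the operator `Op_ħ^w(b)` on tempered distributions;
on Schwartz functions the same series is the usual oscillatory integral, see
`weylIntegral_eq_tsum`. -/
def opWeyl (N : ℕ) (κ : Phase d) (b : Phase d → ℂ) (ψ : torusStates N κ) : torusStates N κ :=
  ∑' r : Lattice d, torusCoeff b r • torusTransl N κ r ψ

section WeylIntegral

/-- The phase space point `(x, ξ)`. -/
def point (x ξ : Conf d) : Phase d := Sum.elim (fun j => x j) (fun j => ξ j)

lemma dotProduct_J_eq (ρ ρ' : Phase d) :
    (Matrix.J (Fin d) ℝ *ᵥ ρ) ⬝ᵥ ρ' = -sympl ρ ρ' := by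
  rw [dotProduct_comm, ← sympl, sympl_swap]

/-- The Weyl quantization `Op_ħ^w(a)` on Schwartz functions:
`(2πħ)^{-d} ∫∫ e^{(i/ħ)⟨x - y, ξ⟩} a((x + y)/2, ξ) u(y) dy dξ`. -/
def weylIntegral (ħ : ℝ) (a : Phase d → ℂ) (u : 𝓢(Conf d, ℂ)) (x : Conf d) : ℂ :=
  (((2 * Real.pi * ħ) ^ d)⁻¹ : ℝ) * ∫ ξ : Conf d, ∫ y : Conf d,
    Complex.exp (Complex.I * ((inner ℝ (x - y) ξ / ħ : ℝ) : ℂ)) *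
      a (point ((2 : ℝ)⁻¹ • (x + y)) ξ) * u y

/-- The character `e^{-2iπ⟨Jr, ρ⟩}`. -/
def torusChar (r : Lattice d) (ρ : Phase d) : ℂ :=
  Complex.exp (-(2 * Real.pi * Complex.I) *
    (((Matrix.J (Fin d) ℝ *ᵥ ofLattice r) ⬝ᵥ ρ : ℝ) : ℂ))

lemma norm_torusChar (r : Lattice d) (ρ : Phase d) : ‖torusChar r ρ‖ = 1 := by
  have h : -(2 * Real.pi * Complex.I) *
      (((Matrix.J (Fin d) ℝ *ᵥ ofLattice r) ⬝ᵥ ρ : ℝ) : ℂ) =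
      ((-(2 * Real.pi * ((Matrix.J (Fin d) ℝ *ᵥ ofLattice r) ⬝ᵥ ρ)) : ℝ) : ℂ) * Complex.I := by
    push_cast
    ring
  rw [torusChar, h, Complex.norm_exp_ofReal_mul_I]

lemma norm_expI (s : ℝ) : ‖Complex.exp (Complex.I * (s : ℂ))‖ = 1 := by
  rw [mul_comm, Complex.norm_exp_ofReal_mul_I]

open scoped FourierTransform

lemma weyl_inner_term (N : ℕ) (hN : 1 ≤ N) (r : Lattice d) (u : 𝓢(Conf d, ℂ)) (x ξ : Conf d) :
    (∫ y : Conf d, Complex.exp (Complex.I * ((inner ℝ (x - y) ξ / planck N : ℝ) : ℂ)) *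
      torusChar r (point ((2 : ℝ)⁻¹ • (x + y)) ξ) * u y) =
    Complex.exp (Complex.I * ((2 * Real.pi *
      inner ℝ ((N : ℝ) • ξ + (2 : ℝ)⁻¹ • mom (ofLattice r)) x : ℝ) : ℂ)) *
      𝓕 (translS (planck N) ((N : ℝ)⁻¹ • ofLattice r) u)
        ((N : ℝ) • ξ + (2 : ℝ)⁻¹ • mom (ofLattice r)) := by
  have hN0 : (N : ℝ) ≠ 0 := by positivity
  have hπ : Real.pi ≠ 0 := Real.pi_ne_zero
  rw [SchwartzMap.fourier_coe, Real.fourier_eq', ← integral_const_mul]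
  conv_rhs => rw [← integral_add_right_eq_self _ (pos ((N : ℝ)⁻¹ • ofLattice r))]
  refine integral_congr_ae (Filter.Eventually.of_forall fun y => ?_)
  simp only [translS_apply, add_sub_cancel_right, smul_eq_mul, heisenbergPhase, torusChar,
    dotProduct_J_eq]
  rw [← mul_assoc, ← mul_assoc, ← Complex.exp_add, ← Complex.exp_add, ← Complex.exp_add]
  congr 2
  have hp : pos ((N : ℝ)⁻¹ • ofLattice r) = (N : ℝ)⁻¹ • pos (ofLattice r) := rfl
  have hm : mom ((N : ℝ)⁻¹ • ofLattice r) = (N : ℝ)⁻¹ • mom (ofLattice r) := rfl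
  have h1 : pos (point ((2 : ℝ)⁻¹ • (x + y)) ξ) = (2 : ℝ)⁻¹ • (x + y) := rfl
  have h2 : mom (point ((2 : ℝ)⁻¹ • (x + y)) ξ) = ξ := rfl
  rw [hp, hm, sympl_eq, h1, h2]
  generalize mom (ofLattice r) = p
  generalize pos (ofLattice r) = q
  have key : inner ℝ (x - y) ξ / planck N +
      2 * Real.pi * (inner ℝ p ((2 : ℝ)⁻¹ • (x + y)) - inner ℝ q ξ) =
      2 * Real.pi * inner ℝ ((N : ℝ) • ξ + (2 : ℝ)⁻¹ • p) x +
      -2 * Real.pi * inner ℝ (y + (N : ℝ)⁻¹ • q) ((N : ℝ) • ξ + (2 : ℝ)⁻¹ • p) +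
      (inner ℝ ((N : ℝ)⁻¹ • p) (y + (N : ℝ)⁻¹ • q) -
        inner ℝ ((N : ℝ)⁻¹ • q) ((N : ℝ)⁻¹ • p) / 2) / planck N := by
    simp only [inner_add_left, inner_add_right, inner_sub_left, real_inner_smul_left,
      real_inner_smul_right, planck]
    rw [real_inner_comm x ξ, real_inner_comm p q, real_inner_comm p y]
    field_simp
    ring
  have key' := congrArg (fun s : ℝ => Complex.I * (s : ℂ)) key
  simp only [Complex.ofReal_add] at key'
  rw [mul_add, mul_add, mul_add] at key'
  refine Eq.trans ?_ (key'.trans ?_)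
  · push_cast
    ring
  · push_cast
    ring

lemma norm_fourier_translS (ħ : ℝ) (ρ : Phase d) (u : 𝓢(Conf d, ℂ)) (η : Conf d) :
    ‖𝓕 (translS ħ ρ u) η‖ = ‖𝓕 u (η - (2 * Real.pi * ħ)⁻¹ • mom ρ)‖ := by
  have h : 𝓕 (translS ħ ρ u) η = Complex.exp (Complex.I *
      ((-2 * Real.pi * inner ℝ (pos ρ) η + inner ℝ (pos ρ) (mom ρ) / 2 / ħ : ℝ) : ℂ)) *
        𝓕 u (η - (2 * Real.pi * ħ)⁻¹ • mom ρ) := by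
    rw [SchwartzMap.fourier_coe, SchwartzMap.fourier_coe, Real.fourier_eq', Real.fourier_eq',
      ← integral_const_mul]
    conv_lhs => rw [← integral_add_right_eq_self _ (pos ρ)]
    refine integral_congr_ae (Filter.Eventually.of_forall fun y => ?_)
    simp only [translS_apply, add_sub_cancel_right, smul_eq_mul, heisenbergPhase]
    rw [← mul_assoc, ← mul_assoc, ← Complex.exp_add, ← Complex.exp_add]
    congr 2
    have key : -2 * Real.pi * inner ℝ (y + pos ρ) η +
        (inner ℝ (mom ρ) (y + pos ρ) - inner ℝ (pos ρ) (mom ρ) / 2) / ħ =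
        (-2 * Real.pi * inner ℝ (pos ρ) η + inner ℝ (pos ρ) (mom ρ) / 2 / ħ) +
        -2 * Real.pi * inner ℝ y (η - (2 * Real.pi * ħ)⁻¹ • mom ρ) := by
      simp only [inner_add_left, inner_add_right, inner_sub_right, real_inner_smul_right]
      rw [real_inner_comm (pos ρ) (mom ρ), real_inner_comm y (mom ρ)]
      have hπ : Real.pi ≠ 0 := Real.pi_ne_zero
      by_cases hħ : ħ = 0
      · simp [hħ]
        ring
      · field_simp
        ring
    have key' := congrArg (fun s : ℝ => Complex.I * (s : ℂ)) key
    simp only [Complex.ofReal_add, mul_add] at key'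
    refine Eq.trans ?_ (key'.trans ?_)
    · push_cast
      ring
    · push_cast
      ring
  rw [h, norm_mul, norm_expI, one_mul]

/-- On Schwartz functions, the Weyl quantization of an observable on the torus is the sum of
translation operators given by its Fourier series, as in `opWeyl`. -/
lemma weylIntegral_eq_tsum (N : ℕ) (hN : 1 ≤ N) (a : Phase d → ℂ) (b : Lattice d → ℂ)
    (hb : Summable fun r => ‖b r‖) (ha : ∀ ρ, a ρ = ∑' r, b r * torusChar r ρ)
    (u : 𝓢(Conf d, ℂ)) (x : Conf d) :
    weylIntegral (planck N) a u x =
      ∑' r, b r * translS (planck N) ((N : ℝ)⁻¹ • ofLattice r) u x := by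
  have hN0 : (N : ℝ) ≠ 0 := by positivity
  set f : Lattice d → Conf d → Conf d → ℂ := fun r ξ y =>
    Complex.exp (Complex.I * ((inner ℝ (x - y) ξ / planck N : ℝ) : ℂ)) *
      torusChar r (point ((2 : ℝ)⁻¹ • (x + y)) ξ) * u y with hf
  have hfn : ∀ r ξ y, ‖f r ξ y‖ = ‖u y‖ := by
    intro r ξ y
    simp only [hf, norm_mul, norm_expI, norm_torusChar, one_mul]
  have hfm : ∀ r ξ, Continuous (f r ξ) := by
    intro r ξ
    have h1 : Continuous fun y : Conf d =>
        (point ((2 : ℝ)⁻¹ • (x + y)) ξ) := by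
      refine continuous_pi fun i => ?_
      rcases i with i | i
      · simp only [point, Sum.elim_inl]; fun_prop
      · simp only [point, Sum.elim_inr]; fun_prop
    have h2 : Continuous fun y : Conf d =>
        (Matrix.J (Fin d) ℝ *ᵥ ofLattice r) ⬝ᵥ (point ((2 : ℝ)⁻¹ • (x + y)) ξ) :=
      Continuous.dotProduct continuous_const h1
    have h3 := u.continuous
    simp only [hf, torusChar]
    fun_prop
  have hfi : ∀ r ξ, Integrable (f r ξ) := fun r ξ =>
    u.integrable.norm.mono' (hfm r ξ).aestronglyMeasurable
      (Filter.Eventually.of_forall fun y => (hfn r ξ y).le)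
  have step1 : ∀ ξ, (∫ y : Conf d,
      Complex.exp (Complex.I * ((inner ℝ (x - y) ξ / planck N : ℝ) : ℂ)) *
        a (point ((2 : ℝ)⁻¹ • (x + y)) ξ) * u y) = ∑' r, b r * ∫ y, f r ξ y := by
    intro ξ
    have h := (hasSum_integral_of_summable_integral_norm (μ := volume)
      (F := fun r y => b r * f r ξ y) (fun r => (hfi r ξ).const_mul _) (by
        simp only [norm_mul, hfn, integral_const_mul]
        exact hb.mul_right _)).tsum_eq
    simp only [integral_const_mul] at h
    rw [h]
    refine integral_congr_ae (Filter.Eventually.of_forall fun y => ?_)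
    simp only [ha, hf]
    rw [← tsum_mul_left, ← tsum_mul_right]
    exact tsum_congr fun r => by ring
  set w : Lattice d → 𝓢(Conf d, ℂ) := fun r =>
    translS (planck N) ((N : ℝ)⁻¹ • ofLattice r) u with hw
  set g : Lattice d → Conf d → ℂ := fun r η =>
    Complex.exp (Complex.I * ((2 * Real.pi * inner ℝ η x : ℝ) : ℂ)) * 𝓕 (w r) η with hg
  have hgi : ∀ r, Integrable (g r) := fun r =>
    (𝓕 (w r)).integrable.norm.mono' (by
      have := (𝓕 (w r)).continuous
      exact (by fun_prop : Continuous (g r)).aestronglyMeasurable)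
      (Filter.Eventually.of_forall fun η => by simp only [hg, norm_mul, norm_expI, one_mul]; rfl)
  have hgint : ∀ r, ∫ η, g r η = w r x := by
    intro r
    have h := congrArg (fun v : 𝓢(Conf d, ℂ) => v x)
      (FourierTransform.fourierInv_fourier_eq (E := 𝓢(Conf d, ℂ)) (F := 𝓢(Conf d, ℂ)) (w r))
    rw [← h, SchwartzMap.fourierInv_coe, Real.fourierInv_eq']
    refine integral_congr_ae (Filter.Eventually.of_forall fun η => ?_)
    simp only [hg, smul_eq_mul]
    rw [mul_comm Complex.I]
  have hgnorm : ∀ r, ∫ η, ‖g r η‖ = ∫ η, ‖𝓕 u η‖ := by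
    intro r
    simp only [hg, norm_mul, norm_expI, one_mul, hw, norm_fourier_translS]
    exact integral_sub_right_eq_self (fun η => ‖𝓕 u η‖) _
  have hsub : ∀ (r : Lattice d) {F : Type} [NormedAddCommGroup F] [NormedSpace ℝ F]
      (k : Conf d → F),
      ∫ ξ : Conf d, k ((N : ℝ) • ξ + (2 : ℝ)⁻¹ • mom (ofLattice r)) =
        ((N : ℝ) ^ d)⁻¹ • ∫ η, k η := by
    intro r F _ _ k
    rw [Measure.integral_comp_smul_of_nonneg volume
      (fun η => k (η + (2 : ℝ)⁻¹ • mom (ofLattice r))) (N : ℝ) (hR := by positivity),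
      integral_add_right_eq_self]
    simp
  have hterm : ∀ r ξ, ∫ y, f r ξ y = g r ((N : ℝ) • ξ + (2 : ℝ)⁻¹ • mom (ofLattice r)) :=
    fun r ξ => weyl_inner_term N hN r u x ξ
  have step2 : (∫ ξ : Conf d, ∑' r, b r * ∫ y, f r ξ y) =
      ∑' r, b r * (((N : ℝ) ^ d)⁻¹ • w r x) := by
    have hint : ∀ r, Integrable fun ξ : Conf d =>
        b r * g r ((N : ℝ) • ξ + (2 : ℝ)⁻¹ • mom (ofLattice r)) := fun r =>
      (((hgi r).comp_add_right ((2 : ℝ)⁻¹ • mom (ofLattice r))).comp_smul hN0).const_mul _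
    have h := (hasSum_integral_of_summable_integral_norm (μ := volume) hint (by
        refine (hb.mul_right (((N : ℝ) ^ d)⁻¹ • ∫ η, ‖𝓕 u η‖)).congr fun r => ?_
        simp only [norm_mul, integral_const_mul]
        rw [hsub r (fun η => ‖g r η‖), hgnorm])).tsum_eq
    simp only [hterm]
    rw [← h]
    refine tsum_congr fun r => ?_
    rw [integral_const_mul, hsub r (g r), hgint]
  have hpl : (2 * Real.pi * planck N : ℝ) = (N : ℝ)⁻¹ := by
    have hπ : Real.pi ≠ 0 := Real.pi_ne_zero
    rw [planck]
    field_simp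
  rw [weylIntegral]
  simp only [step1]
  rw [step2, ← tsum_mul_left, hpl]
  refine tsum_congr fun r => ?_
  have hc : (N : ℂ) ≠ 0 := by exact_mod_cast hN0
  simp only [hw, Complex.real_smul, inv_pow, inv_inv]
  push_cast
  rw [mul_left_comm (b r), ← mul_assoc, mul_inv_cancel₀ (pow_ne_zero d hc), one_mul]

end WeylIntegral

/-- The Moyal product (the symbol of the composition of two Weyl operators):
`(F ♯ G)(ρ) = (πħ)^{-2d} ∫∫ e^{-(2i/ħ) σ(w₁, w₂)} F(ρ + w₁) G(ρ + w₂) dw₁ dw₂`. -/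
def moyal (ħ : ℝ) (F G : Phase d → ℂ) (ρ : Phase d) : ℂ :=
  (((Real.pi * ħ) ^ (2 * d))⁻¹ : ℝ) *
    ∫ w : Phase d × Phase d,
      Complex.exp (-(2 * Complex.I / ħ) * (sympl w.1 w.2 : ℂ)) * F (ρ + w.1) * G (ρ + w.2)

/-! ### Lyapunov exponents and the symplectic reduction -/

/-- The complex spectrum of a real matrix. -/
def cspec {n : Type*} [Fintype n] [DecidableEq n] (A : Matrix n n ℝ) : Set ℂ :=
  spectrum ℂ (A.map ((↑) : ℝ → ℂ))

/-- `λ_max = sup {log |β| : β in the spectrum of A}`. -/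
def lyapMax {n : Type*} [Fintype n] [DecidableEq n] (A : Matrix n n ℝ) : ℝ :=
  sSup ((fun β : ℂ => Real.log ‖β‖) '' cspec A)

/-- The `⋄`-product `M₀ ⋄ M₁ ⋄ ⋯` of a finite family of `2nᵢ × 2nᵢ` matrices in block form. -/
def diamond {k : ℕ} {n : Fin k → ℕ}
    (M : ∀ i, Matrix (Fin (n i) ⊕ Fin (n i)) (Fin (n i) ⊕ Fin (n i)) ℝ) :
    Matrix ((Σ i, Fin (n i)) ⊕ (Σ i, Fin (n i))) ((Σ i, Fin (n i)) ⊕ (Σ i, Fin (n i))) ℝ :=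
  Matrix.fromBlocks
    (Matrix.blockDiagonal' fun i => (M i).toBlocks₁₁)
    (Matrix.blockDiagonal' fun i => (M i).toBlocks₁₂)
    (Matrix.blockDiagonal' fun i => (M i).toBlocks₂₁)
    (Matrix.blockDiagonal' fun i => (M i).toBlocks₂₂)

/-- A symplectic reduction `A = Q (A₀ ⋄ A₁ ⋄ ⋯ ⋄ A_r) Q⁻¹` of a real symplectic matrix adapted to
its Oseledets decomposition: `A₀` (of size `2 d₀`, possibly `d₀ = 0`) is symplectic with spectrum
on the unit circle, and `Aᵢ = diag(Dᵢ, Dᵢ*⁻¹)`, where the spectrum of `Dᵢ` lies on the circle of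
radius `e^{λᵢ}` and `0 < λ₁ < ⋯ < λ_r` are the positive Lyapunov exponents.  The block with index
`0` is the neutral one; the exponent with index `i : Fin r` belongs to the block `i.succ`. -/
structure SymplecticReduction (A : Matrix (Fin d ⊕ Fin d) (Fin d ⊕ Fin d) ℝ) where
  /-- The number of positive Lyapunov exponents. -/
  r : ℕ
  /-- The half-dimensions `d₀, d₁, …, d_r`. -/
  dim : Fin (r + 1) → ℕ
  /-- The positive Lyapunov exponents. -/
  lyap : Fin r → ℝ
  /-- The blocks `A₀, A₁, …, A_r`. -/
  block : ∀ i, Matrix (Fin (dim i) ⊕ Fin (dim i)) (Fin (dim i) ⊕ Fin (dim i)) ℝ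
  /-- The splitting of the `d` coordinates into blocks. -/
  index : Fin d ≃ Σ i, Fin (dim i)
  /-- The change of symplectic basis. -/
  Q : Matrix.symplecticGroup (Fin d) ℝ
  dim_pos : ∀ i : Fin r, 0 < dim i.succ
  lyap_pos : ∀ i, 0 < lyap i
  lyap_strictMono : StrictMono lyap
  neutral_symplectic : block 0 ∈ Matrix.symplecticGroup (Fin (dim 0)) ℝ
  neutral_spectrum : ∀ z ∈ cspec (block 0), ‖z‖ = 1
  hyperbolic : ∀ i : Fin r, ∃ D : Matrix (Fin (dim i.succ)) (Fin (dim i.succ)) ℝ,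
    IsUnit D.det ∧ block i.succ = Matrix.fromBlocks D 0 0 (Dᵀ)⁻¹ ∧
      ∀ z ∈ cspec D, ‖z‖ = Real.exp (lyap i)
  conj_eq : A = (Q : Matrix (Fin d ⊕ Fin d) (Fin d ⊕ Fin d) ℝ) *
    (diamond block).submatrix (Sum.map index index) (Sum.map index index) *
    ((Q⁻¹ : Matrix.symplecticGroup (Fin d) ℝ) : Matrix (Fin d ⊕ Fin d) (Fin d ⊕ Fin d) ℝ)

/-! ### The positive quantization adapted to the dynamics -/

section Positive

variable {A : Matrix (Fin d ⊕ Fin d) (Fin d ⊕ Fin d) ℝ} (S : SymplecticReduction A) (ε₀ : ℝ)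

/-- The exponents `γ₀ = ε₀ / (2 λ_max)` and `γᵢ = λᵢ / (2 λ_max)`. -/
def scaleExp (i : Fin (S.r + 1)) : ℝ :=
  (Fin.cons ε₀ S.lyap : Fin (S.r + 1) → ℝ) i / (2 * lyapMax A)

/-- `B(ħ) = Q diag(D₁(ħ), D₁(ħ)) Q⁻¹`, where the diagonal matrix `D₁(ħ)` has the entry `ħ^{-γᵢ}`
on the coordinates of the `i`-th block. -/
def scaleMatrix (ħ : ℝ) : Matrix (Fin d ⊕ Fin d) (Fin d ⊕ Fin d) ℝ :=
  (S.Q : Matrix (Fin d ⊕ Fin d) (Fin d ⊕ Fin d) ℝ) *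
    Matrix.diagonal (Sum.elim (fun j => ħ ^ (-scaleExp S ε₀ (S.index j).1))
      (fun j => ħ ^ (-scaleExp S ε₀ (S.index j).1))) *
    ((S.Q⁻¹ : Matrix.symplecticGroup (Fin d) ℝ) : Matrix (Fin d ⊕ Fin d) (Fin d ⊕ Fin d) ℝ)

/-- The adapted Gaussian `G_ħ = 2^{d/2} |det B(ħ)|^{1/2} G ∘ B(ħ)`, `G(ρ) = e^{-π‖ρ‖²}` with the
Euclidean norm of `ℝ²ᵈ`. -/
def adaptedGaussian (ħ : ℝ) (ρ : Phase d) : ℂ :=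
  (((2 : ℝ) ^ ((d : ℝ) / 2) * |(scaleMatrix S ε₀ ħ).det| ^ (1 / 2 : ℝ) *
    Real.exp (-Real.pi * ∑ i, ((scaleMatrix S ε₀ ħ *ᵥ ρ) i) ^ 2) : ℝ) : ℂ)

/-- The positive quantization `Op_κ^+(a) = Op_κ^w(a ⋆ (G_ħ ♯ G_ħ))` on `H_N(κ)`, `2πħN = 1`. -/
def opPlus (N : ℕ) (κ : Phase d) (a : Phase d → ℂ) (ψ : torusStates N κ) : torusStates N κ :=
  opWeyl N κ
    (a ⋆[ContinuousLinearMap.mul ℂ ℂ, volume]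
      moyal (planck N) (adaptedGaussian S ε₀ (planck N)) (adaptedGaussian S ε₀ (planck N))) ψ

/-- `μ^N(a) = ⟨ψ, Op_κ^+(a) ψ⟩`, for the inner product `c` of `H_N(κ)`. -/
def stateMeasure {N : ℕ} {κ : Phase d} (c : InnerProductSpace.Core ℂ (torusStates N κ))
    (ψ : torusStates N κ) (a : Phase d → ℂ) : ℂ :=
  c.inner ψ (opPlus S ε₀ N κ a ψ)

end Positive

/-- An integer matrix as a real matrix. -/
def toReal (A : Matrix.symplecticGroup (Fin d) ℤ) : Matrix (Fin d ⊕ Fin d) (Fin d ⊕ Fin d) ℝ :=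
  (A : Matrix (Fin d ⊕ Fin d) (Fin d ⊕ Fin d) ℤ).map ((↑) : ℤ → ℝ)

/-- The Ehrenfest time `m_E(N) = [(1 - ε) log N / (2 λ_max)]`. -/
def ehrenfestTime (A : Matrix (Fin d ⊕ Fin d) (Fin d ⊕ Fin d) ℝ) (ε : ℝ) (N : ℕ) : ℤ :=
  ⌊(1 - ε) / (2 * lyapMax A) * Real.log N⌋

end CatMap

end

open CatMap

noncomputable section

namespace CatMap

open scoped FourierTransform

/-! ### Summable families of Schwartz functions -/

section SchwartzSum

variable {E α : Type*} [NormedAddCommGroup E] [NormedSpace ℝ E]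

/-! Everything is explicit in Fourier variables, and the only error comes from the smoothing kernel,
since the Egorov relation for translations is exact. Let `α s` be the Fourier coefficients of `a`
and put `e s = ⟨ψ, U_ħ(s/N) ψ⟩`. The symplectic Fourier transform of the Moyal square of the adapted
Gaussian is again a Gaussian `exp (-k s)`, where `k s = π/2 (‖(B⁻¹)ᵀ J s‖² + (πħ)² ‖B s‖²)`
(`integrable_moyal_gaussian_and_integral`). Hence the phase space measure of `a` is `∑ α s exp (-k
s) e s` (`hasSum_stateMeasure`).

For an eigenstate, `e (A s) = e s` (`inner_torusTransl_mulVec`). The restriction `L` of the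
propagator carries translations to translations, so `(x, y) ↦ ⟨L x, L y⟩` is a translation-invariant
sesquilinear form. Such forms are proportional because the space of torus states is irreducible
(`IsInvariantForm.mul_comm`), and the factor is read off at the eigenstate. Irreducibility rests on
the description of the distributions invariant under lattice shifts and lattice modulations as
multiples of the Dirac comb (`apply_mul_periodize_comm`), a consequence of Poisson summation: it
makes the joint eigenspaces of the momentum translations at most one-dimensional, and the position
translations permute them.

Composing `a` with `A ^ t` permutes its Fourier coefficients. After reindexing and using the
invariance of `e`, the difference of the two measures is `∑ α s (exp (-k (A^{-t} s)) - exp (-k s)) e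
s`. Here `|e s| ≤ 1`, and the bracket is at most `k (A^{-t} s) + k s`. In the block coordinates
`Q⁻¹`, the form `k` is bounded by the squares of `ħ^{γᵢ}` times the coordinates, while `A^t` expands
block `i` by at most `exp ((λᵢ + δ)|t|)`, with exponent `0` for the neutral block. With `γᵢ = λᵢ /
(2 λ_max)`, and `ε₀` in place of `λᵢ` on the neutral block, the contraction beats the expansion up
to the Ehrenfest time, so `k (A^{±t} s) ≤ C N^{-η} ‖s‖²` (`exists_sqNorm_zpow_le`). Smoothness of
`a` makes `∑ |α s| ‖s‖²` finite. -/

lemma decay_tsum_schwartz (f : α → 𝓢(E, ℂ))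
    (h : ∀ k l, Summable fun i => SchwartzMap.seminorm ℂ k l (f i)) (k l : ℕ) (x : E) :
    ‖x‖ ^ k * ‖iteratedFDeriv ℝ l (fun x => ∑' i, f i x) x‖ ≤
      ∑' i, SchwartzMap.seminorm ℂ k l (f i) := by
  rw [iteratedFDeriv_tsum (N := ⊤) (v := fun l i => SchwartzMap.seminorm ℂ 0 l (f i))
    (fun i => (f i).smooth _) (fun l _ => h 0 l)
    (fun l i x _ => (f i).norm_iteratedFDeriv_le_seminorm ℂ l x) (by exact_mod_cast le_top)]
  have hs : Summable fun i => ‖iteratedFDeriv ℝ l (f i) x‖ :=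
    (h 0 l).of_nonneg_of_le (fun _ => norm_nonneg _)
      fun i => (f i).norm_iteratedFDeriv_le_seminorm ℂ l x
  calc ‖x‖ ^ k * ‖∑' i, iteratedFDeriv ℝ l (f i) x‖
      ≤ ‖x‖ ^ k * ∑' i, ‖iteratedFDeriv ℝ l (f i) x‖ := by
        gcongr; exact norm_tsum_le_tsum_norm hs
    _ = ∑' i, ‖x‖ ^ k * ‖iteratedFDeriv ℝ l (f i) x‖ := tsum_mul_left.symm
    _ ≤ _ := Summable.tsum_le_tsum (fun i => (f i).le_seminorm ℂ k l x) (hs.mul_left _) (h k l)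

/-- The pointwise sum of a family of Schwartz functions whose seminorms are summable. -/
def schwartzSum (f : α → 𝓢(E, ℂ)) (h : ∀ k l, Summable fun i => SchwartzMap.seminorm ℂ k l (f i)) :
    𝓢(E, ℂ) where
  toFun x := ∑' i, f i x
  smooth' := by
    refine contDiff_tsum (v := fun l i => SchwartzMap.seminorm ℂ 0 l (f i))
      (fun i => (f i).smooth _) (fun l _ => h 0 l) fun l i x _ => ?_
    exact (f i).norm_iteratedFDeriv_le_seminorm ℂ l x
  decay' k l := ⟨∑' i, SchwartzMap.seminorm ℂ k l (f i), decay_tsum_schwartz f h k l⟩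

lemma schwartzSum_apply (f : α → 𝓢(E, ℂ))
    (h : ∀ k l, Summable fun i => SchwartzMap.seminorm ℂ k l (f i)) (x : E) :
    schwartzSum f h x = ∑' i, f i x := rfl

lemma seminorm_schwartzSum_le (f : α → 𝓢(E, ℂ))
    (h : ∀ k l, Summable fun i => SchwartzMap.seminorm ℂ k l (f i)) (k l : ℕ) :
    SchwartzMap.seminorm ℂ k l (schwartzSum f h) ≤ ∑' i, SchwartzMap.seminorm ℂ k l (f i) :=
  SchwartzMap.seminorm_le_bound ℂ k l _ (tsum_nonneg fun _ => apply_nonneg _ _)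
    (decay_tsum_schwartz f h k l)

lemma summable_schwartz_apply (f : α → 𝓢(E, ℂ))
    (h : ∀ k l, Summable fun i => SchwartzMap.seminorm ℂ k l (f i)) (x : E) :
    Summable fun i => f i x :=
  ((h 0 0).of_nonneg_of_le (fun _ => norm_nonneg _)
    fun i => (f i).norm_le_seminorm ℂ x).of_norm

/-- A family of Schwartz functions with summable seminorms is summable in the Schwartz space. -/
lemma hasSum_schwartzSum (f : α → 𝓢(E, ℂ))
    (h : ∀ k l, Summable fun i => SchwartzMap.seminorm ℂ k l (f i)) :
    HasSum f (schwartzSum f h) := by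
  refine ((schwartz_withSeminorms ℂ E ℂ).tendsto_nhds _ _).2 fun ⟨k, l⟩ ε hε => ?_
  have ht := tendsto_tsum_compl_atTop_zero fun i => SchwartzMap.seminorm ℂ k l (f i)
  filter_upwards [ht.eventually (gt_mem_nhds hε)] with s hs
  have hcompl : ∀ k l, Summable fun i : {i // i ∉ s} => SchwartzMap.seminorm ℂ k l (f i) :=
    fun k l => (h k l).subtype _
  -- The remainder is itself a Schwartz sum over the complement of `s`, so its seminorms are bounded
  -- by tails of convergent series.
  have heq : ∑ i ∈ s, f i - schwartzSum f h = -schwartzSum (fun i : {i // i ∉ s} => f i) hcompl := by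
    ext x
    have := (summable_schwartz_apply f h x).sum_add_tsum_subtype_compl s
    simp only [_root_.sub_apply, _root_.neg_apply, _root_.sum_apply,
      schwartzSum_apply]
    rw [← this]
    ring
  rw [schwartzSeminormFamily_apply, heq, map_neg_eq_map]
  exact (seminorm_schwartzSum_le _ _ k l).trans_lt hs

end SchwartzSum

/-! ### Translates of Schwartz functions by lattice vectors -/

section SchwartzTranslate

/-- Peetre's inequality: decay in `x` and in `x - a` can be traded for decay in `a`. -/
lemma one_add_norm_pow_le {E : Type*} [NormedAddCommGroup E] (x a : E) (m : ℕ) :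
    (1 + ‖a‖) ^ m ≤ (1 + ‖x‖) ^ m * (1 + ‖x - a‖) ^ m := by
  rw [← mul_pow]
  refine pow_le_pow_left₀ (by positivity) ?_ m
  have : ‖a‖ ≤ ‖x‖ + ‖x - a‖ := by
    have := norm_sub_le x (x - a)
    rwa [sub_sub_cancel] at this
  nlinarith [norm_nonneg x, norm_nonneg (x - a)]

variable {E : Type*} [NormedAddCommGroup E] [NormedSpace ℝ E]

lemma exists_one_add_norm_pow_mul_le (f : 𝓢(E, ℂ)) (k l : ℕ) :
    ∃ C, 0 ≤ C ∧ ∀ i ≤ l, ∀ x, (1 + ‖x‖) ^ k * ‖iteratedFDeriv ℝ i f x‖ ≤ C := by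
  refine ⟨2 ^ k * ((Finset.Iic (k, l)).sup fun m => SchwartzMap.seminorm ℂ m.1 m.2) f,
    by positivity, fun i hi x => ?_⟩
  exact SchwartzMap.one_add_le_sup_seminorm_apply (𝕜 := ℂ) (m := (k, l)) le_rfl hi f x

/-- A translation costs only polynomial growth in `a`, so rapidly decreasing coefficients make a
series of translates converge in the Schwartz space. -/
lemma exists_seminorm_compSubConst_le (f : 𝓢(E, ℂ)) (k l : ℕ) :
    ∃ C, ∀ a : E, SchwartzMap.seminorm ℂ k l (compSubConstCLM ℂ a f) ≤ C * (1 + ‖a‖) ^ k := by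
  obtain ⟨C, hC, h⟩ := exists_one_add_norm_pow_mul_le f k l
  refine ⟨C, fun a => SchwartzMap.seminorm_le_bound ℂ k l _ (by positivity) fun x => ?_⟩
  have hD : iteratedFDeriv ℝ l (compSubConstCLM ℂ a f) x = iteratedFDeriv ℝ l f (x - a) := by
    rw [← iteratedFDeriv_comp_sub]
    rfl
  have h1 : ‖x‖ ^ k ≤ (1 + ‖a‖) ^ k * (1 + ‖x - a‖) ^ k := by
    have := one_add_norm_pow_le a x k
    rw [norm_sub_rev] at this
    exact (pow_le_pow_left₀ (norm_nonneg _) (by linarith) k).trans this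
  rw [hD]
  calc ‖x‖ ^ k * ‖iteratedFDeriv ℝ l f (x - a)‖
      ≤ (1 + ‖a‖) ^ k * (1 + ‖x - a‖) ^ k * ‖iteratedFDeriv ℝ l f (x - a)‖ := by gcongr
    _ = ((1 + ‖x - a‖) ^ k * ‖iteratedFDeriv ℝ l f (x - a)‖) * (1 + ‖a‖) ^ k := by ring
    _ ≤ C * (1 + ‖a‖) ^ k := by gcongr; exact h l le_rfl _

/-- The two factors are concentrated near `0` and near `a`. By the Leibniz rule and Peetre's
inequality their joint decay yields any power of `1 + ‖a‖`, which makes the products with lattice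
translates summable. -/
lemma exists_seminorm_smul_compSubConst_le (f g : 𝓢(E, ℂ)) (k l m : ℕ) :
    ∃ C, ∀ a : E, SchwartzMap.seminorm ℂ k l
      (smulLeftCLM ℂ (⇑(compSubConstCLM ℂ a g)) f) ≤ C * ((1 + ‖a‖) ^ m)⁻¹ := by
  obtain ⟨Cf, hCf, hf⟩ := exists_one_add_norm_pow_mul_le f (k + m) l
  obtain ⟨Cg, hCg, hg⟩ := exists_one_add_norm_pow_mul_le g m l
  refine ⟨2 ^ l * (Cg * Cf), fun a => SchwartzMap.seminorm_le_bound ℂ k l _ (by positivity)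
    fun x => ?_⟩
  set τ := compSubConstCLM ℂ a g with hτ
  have hD : ∀ i, iteratedFDeriv ℝ i τ x = iteratedFDeriv ℝ i g (x - a) := fun i => by
    rw [← iteratedFDeriv_comp_sub]
    rfl
  have hfun : ⇑(smulLeftCLM ℂ (⇑τ) f) = fun y => τ y • f y :=
    SchwartzMap.smulLeftCLM_apply τ.hasTemperateGrowth f
  rw [hfun]
  have hle := norm_iteratedFDeriv_smul_le (𝕜 := ℝ) (N := ∞) (τ.smooth ⊤)
    (f.smooth ⊤) (n := l) (x := x) (by exact_mod_cast le_top)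
  have hpos : 0 < (1 + ‖a‖) ^ m := by positivity
  rw [← div_eq_mul_inv, le_div_iff₀ hpos]
  calc ‖x‖ ^ k * ‖iteratedFDeriv ℝ l (fun y => τ y • f y) x‖ * (1 + ‖a‖) ^ m
      ≤ ‖x‖ ^ k * (∑ i ∈ Finset.range (l + 1), (l.choose i : ℝ) * ‖iteratedFDeriv ℝ i τ x‖ *
          ‖iteratedFDeriv ℝ (l - i) f x‖) * (1 + ‖a‖) ^ m := by gcongr
    _ = ∑ i ∈ Finset.range (l + 1), (l.choose i : ℝ) * (‖x‖ ^ k * (1 + ‖a‖) ^ m *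
          ‖iteratedFDeriv ℝ i g (x - a)‖ * ‖iteratedFDeriv ℝ (l - i) f x‖) := by
        rw [Finset.mul_sum, Finset.sum_mul]
        refine Finset.sum_congr rfl fun i _ => ?_
        rw [hD]
        ring
    _ ≤ ∑ i ∈ Finset.range (l + 1), (l.choose i : ℝ) * (Cg * Cf) := by
        refine Finset.sum_le_sum fun i hi => ?_
        refine mul_le_mul_of_nonneg_left ?_ (by positivity)
        have h1 := hg i (by simpa [Nat.lt_succ_iff] using hi) (x - a)
        have h2 := hf (l - i) (Nat.sub_le _ _) x
        calc ‖x‖ ^ k * (1 + ‖a‖) ^ m * ‖iteratedFDeriv ℝ i g (x - a)‖ *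
              ‖iteratedFDeriv ℝ (l - i) f x‖
            ≤ (1 + ‖x‖) ^ k * ((1 + ‖x‖) ^ m * (1 + ‖x - a‖) ^ m) *
              ‖iteratedFDeriv ℝ i g (x - a)‖ * ‖iteratedFDeriv ℝ (l - i) f x‖ := by
              gcongr
              · linarith
              · exact one_add_norm_pow_le x a m
          _ = ((1 + ‖x - a‖) ^ m * ‖iteratedFDeriv ℝ i g (x - a)‖) *
              ((1 + ‖x‖) ^ (k + m) * ‖iteratedFDeriv ℝ (l - i) f x‖) := by ring
          _ ≤ Cg * Cf := by gcongr
    _ = 2 ^ l * (Cg * Cf) := by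
        rw [← Finset.sum_mul]
        congr 1
        exact_mod_cast Nat.sum_range_choose l

end SchwartzTranslate

/-! ### Integer points in Euclidean space and summability over them -/

section LatticePoint

variable {ι : Type*}

/-- The inclusion `ℤ^ι ⊆ ℝ^ι`, with the Euclidean norm. -/
def latticePoint (n : ι → ℤ) : EuclideanSpace ℝ ι := WithLp.toLp 2 fun i => (n i : ℝ)

@[simp] lemma latticePoint_apply (n : ι → ℤ) (i : ι) : latticePoint n i = n i := rfl

lemma latticePoint_add (m n : ι → ℤ) : latticePoint (m + n) = latticePoint m + latticePoint n := by
  ext i; simp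

lemma latticePoint_neg (n : ι → ℤ) : latticePoint (-n) = -latticePoint n := by
  ext i; simp

lemma latticePoint_injective : Function.Injective (latticePoint : (ι → ℤ) → _) := by
  intro m n h
  funext i
  simpa using congrArg (fun x : EuclideanSpace ℝ ι => x i) h

variable (ι) in
lemma exists_summable_one_add_norm_latticePoint [Fintype ι] :
    ∃ m : ℕ, Summable fun n : ι → ℤ => ((1 + ‖latticePoint n‖) ^ m)⁻¹ := by
  classical
  set b := (EuclideanSpace.basisFun ι ℝ).toBasis with hb
  set L := Submodule.span ℤ (Set.range b) with hL
  have hmem : ∀ n : ι → ℤ, latticePoint n ∈ L := by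
    intro n
    have : latticePoint n = ∑ i, n i • b i := by
      ext j
      simp [hb, Pi.single_apply]
    rw [this]
    exact Submodule.sum_mem _ fun i _ => Submodule.smul_mem _ _
      (Submodule.subset_span ⟨i, rfl⟩)
  set m := Module.finrank ℤ L + 1 with hm
  have h1 := ZLattice.summable_norm_pow_inv L m (Nat.lt_succ_self _)
  have h2 := h1.comp_injective (i := fun n : ι → ℤ => (⟨latticePoint n, hmem n⟩ : L))
    fun n n' h => latticePoint_injective (congrArg Subtype.val h)
  refine ⟨m, h2.of_norm_bounded_eventually ?_⟩
  -- At the origin `‖0‖⁻¹` has the default value `0` and the comparison fails, so it is only claimed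
  -- off this one point.
  refine Set.Finite.subset (Set.finite_singleton 0) fun n hn => ?_
  by_contra h0
  apply hn
  have hpos : 0 < ‖latticePoint n‖ := by
    rw [norm_pos_iff]
    intro h
    exact h0 (latticePoint_injective (by rw [h]; ext; simp))
  simp only [Function.comp, inv_pow]
  change ‖((1 + ‖latticePoint n‖) ^ m)⁻¹‖ ≤ _
  rw [Real.norm_of_nonneg (by positivity)]
  gcongr
  change ‖latticePoint n‖ ≤ _
  linarith

end LatticePoint

/-! ### Poisson summation -/

section Poisson

variable {ι : Type*}

/-- The periodization `∑ₙ g(x + n)` of a function on `ℝ^ι`. -/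
def periodize (g : EuclideanSpace ℝ ι → ℂ) (x : EuclideanSpace ℝ ι) : ℂ :=
  ∑' n : ι → ℤ, g (x + latticePoint n)

lemma periodize_add_latticePoint (g : EuclideanSpace ℝ ι → ℂ) (x : EuclideanSpace ℝ ι)
    (n : ι → ℤ) : periodize g (x + latticePoint n) = periodize g x := by
  rw [periodize, periodize, ← (Equiv.addLeft n).tsum_eq fun k => g (x + latticePoint k)]
  exact tsum_congr fun k => by simp [latticePoint_add, add_assoc]

variable [Fintype ι]

/-- Decomposition of an integral over `ℝ^ι` into the integrals over the unit cells of `ℤ^ι`. -/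
lemma hasSum_integral_unitCell {F : Type*} [NormedAddCommGroup F] [NormedSpace ℝ F]
    {H : (ι → ℝ) → F} (hH : Integrable H) :
    HasSum (fun n : ι → ℤ => ∫ x in {x : ι → ℝ | ∀ i, x i ∈ Set.Ioc ((0 : ι → ℝ) i)
      ((0 : ι → ℝ) i + 1)}, H (x + fun i => (n i : ℝ))) (∫ x, H x) := by
  set cell : (ι → ℤ) → Set (ι → ℝ) :=
    fun n => {x | ∀ i, x i ∈ Set.Ioc (n i : ℝ) (n i + 1)} with hcell
  have hmeas : ∀ n, MeasurableSet (cell n) := by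
    intro n
    have : cell n = Set.univ.pi fun i => Set.Ioc (n i : ℝ) (n i + 1) := by
      ext x; simp [hcell]
    rw [this]
    exact MeasurableSet.univ_pi fun i => measurableSet_Ioc
  -- The cells are open on the left and closed on the right, so the cell of `x` has index `⌈x i⌉ -
  -- 1` rather than the floor.
  have hmem : ∀ n x, x ∈ cell n ↔ ∀ i, n i = ⌈x i⌉ - 1 := by
    intro n x
    refine forall_congr' fun i => ?_
    rw [eq_sub_iff_add_eq, eq_comm, Int.ceil_eq_iff, Set.mem_Ioc]
    push_cast
    rw [add_sub_cancel_right]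
  have hdisj : Pairwise (Function.onFun Disjoint cell) := by
    intro m n hmn
    refine Set.disjoint_left.2 fun x hm hn => hmn ?_
    rw [hmem] at hm hn
    funext i
    rw [hm, hn]
  have hunion : ⋃ n, cell n = Set.univ := by
    refine Set.eq_univ_of_forall fun x => Set.mem_iUnion.2 ⟨fun i => ⌈x i⌉ - 1, ?_⟩
    rw [hmem]
    exact fun i => rfl
  have h := hasSum_integral_iUnion hmeas hdisj (f := H) (μ := volume) hH.integrableOn
  rw [hunion, setIntegral_univ] at h
  refine h.congr_fun fun n => ?_
  have hp := (measurePreserving_add_right (volume : Measure (ι → ℝ))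
    (fun i => (n i : ℝ))).setIntegral_preimage_emb
      (MeasurableEquiv.addRight (fun i => (n i : ℝ))).measurableEmbedding H (cell n)
  rw [← hp]
  congr 2
  ext x
  simp only [hcell, Set.mem_preimage, Set.mem_ofPred_eq, Pi.add_apply, Set.mem_Ioc, Pi.zero_apply,
    zero_add]
  refine forall_congr' fun i => ?_
  constructor <;> rintro ⟨h1, h2⟩ <;> constructor <;> linarith

/-- Peetre's inequality again: the decay in `a` is locally uniform in `x`, which gives both the
convergence and the continuity of periodizations. -/
lemma exists_norm_schwartz_add_le (g : 𝓢(EuclideanSpace ℝ ι, ℂ)) (m : ℕ) :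
    ∃ C, ∀ x a, ‖g (x + a)‖ ≤ C * (1 + ‖x‖) ^ m * ((1 + ‖a‖) ^ m)⁻¹ := by
  obtain ⟨C, hC, h⟩ := exists_one_add_norm_pow_mul_le g m 0
  refine ⟨C, fun x a => ?_⟩
  have h1 := h 0 le_rfl (x + a)
  rw [norm_iteratedFDeriv_zero] at h1
  have h2 := one_add_norm_pow_le x (-a) m
  rw [norm_neg, sub_neg_eq_add] at h2
  rw [← div_eq_mul_inv, le_div_iff₀ (by positivity)]
  calc ‖g (x + a)‖ * (1 + ‖a‖) ^ m
      ≤ ‖g (x + a)‖ * ((1 + ‖x‖) ^ m * (1 + ‖x + a‖) ^ m) := by gcongr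
    _ = (1 + ‖x + a‖) ^ m * ‖g (x + a)‖ * (1 + ‖x‖) ^ m := by ring
    _ ≤ C * (1 + ‖x‖) ^ m := by gcongr

lemma summable_norm_schwartz_add (g : 𝓢(EuclideanSpace ℝ ι, ℂ)) (x : EuclideanSpace ℝ ι) :
    Summable fun n : ι → ℤ => ‖g (x + latticePoint n)‖ := by
  obtain ⟨m, hm⟩ := exists_summable_one_add_norm_latticePoint ι
  obtain ⟨C, hC⟩ := exists_norm_schwartz_add_le g m
  exact (hm.mul_left (C * (1 + ‖x‖) ^ m)).of_nonneg_of_le (fun _ => norm_nonneg _)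
    fun n => hC x _

lemma summable_norm_schwartz_latticePoint (g : 𝓢(EuclideanSpace ℝ ι, ℂ)) :
    Summable fun n : ι → ℤ => ‖g (latticePoint n)‖ := by
  simpa using summable_norm_schwartz_add g 0

lemma hasSum_periodize (g : 𝓢(EuclideanSpace ℝ ι, ℂ)) (x : EuclideanSpace ℝ ι) :
    HasSum (fun n : ι → ℤ => g (x + latticePoint n)) (periodize g x) :=
  (summable_norm_schwartz_add g x).of_norm.hasSum

lemma continuous_periodize (g : 𝓢(EuclideanSpace ℝ ι, ℂ)) : Continuous (periodize g) := by
  obtain ⟨m, hm⟩ := exists_summable_one_add_norm_latticePoint ι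
  obtain ⟨C, hC⟩ := exists_norm_schwartz_add_le g m
  have hC0 : 0 ≤ C := by
    have := (norm_nonneg _).trans (hC 0 0)
    simpa using this
  refine continuous_iff_continuousAt.2 fun x => ?_
  refine ContinuousOn.continuousAt (s := Metric.ball 0 (‖x‖ + 1)) ?_
    (Metric.isOpen_ball.mem_nhds (by simp))
  refine continuousOn_tsum (u := fun n => C * (1 + (‖x‖ + 1)) ^ m * ((1 + ‖latticePoint n‖) ^ m)⁻¹)
    (fun n => by fun_prop) (hm.mul_left _) fun n y hy => (hC y _).trans ?_
  have : ‖y‖ ≤ ‖x‖ + 1 := by simpa using (Metric.mem_ball.1 hy).le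
  gcongr

/-- The character `e^{2iπ⟨η, x⟩}`. -/
def euclChar (η x : EuclideanSpace ℝ ι) : ℂ :=
  Complex.exp (((2 * Real.pi * inner ℝ η x : ℝ) : ℂ) * Complex.I)

@[simp] lemma norm_euclChar (η x : EuclideanSpace ℝ ι) : ‖euclChar η x‖ = 1 :=
  Complex.norm_exp_ofReal_mul_I _

lemma euclChar_eq_mFourier (p : ι → ℤ) (x : EuclideanSpace ℝ ι) :
    UnitAddTorus.mFourier p (fun i => (x i : UnitAddCircle)) = euclChar (latticePoint p) x := by
  simp only [UnitAddTorus.mFourier, ContinuousMap.coe_mk, fourier_coe_apply, euclChar]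
  rw [← Complex.exp_sum, PiLp.inner_apply]
  congr 1
  simp only [latticePoint_apply, RCLike.inner_apply, conj_trivial]
  push_cast
  rw [Finset.mul_sum, Finset.sum_mul]
  exact Finset.sum_congr rfl fun i _ => by ring

/-- The periodization of a Schwartz function as a function on the torus. -/
lemma exists_torus_periodize (g : 𝓢(EuclideanSpace ℝ ι, ℂ)) :
    ∃ F : C(UnitAddTorus ι, ℂ), ∀ x : EuclideanSpace ℝ ι,
      F (fun i => (x i : UnitAddCircle)) = periodize g x := by
  set π : (ι → ℝ) → UnitAddTorus ι := Pi.map fun _ => ((↑) : ℝ → UnitAddCircle) with hπ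
  have hq : IsOpenQuotientMap π :=
    IsOpenQuotientMap.piMap fun _ => QuotientAddGroup.isOpenQuotientMap_mk
  -- An arbitrary lift of each torus point is used; lattice periodicity makes the value independent
  -- of it, and continuity descends through the quotient map.
  set F : UnitAddTorus ι → ℂ :=
    fun t => periodize g (WithLp.toLp 2 (Function.surjInv hq.surjective t)) with hF
  have hFπ : ∀ x : ι → ℝ, F (π x) = periodize g (WithLp.toLp 2 x) := by
    intro x
    set y := Function.surjInv hq.surjective (π x) with hy
    have hxy : π y = π x := Function.surjInv_eq hq.surjective (π x)
    have : ∀ i, ∃ n : ℤ, y i = x i + n := by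
      intro i
      have h := congrFun hxy i
      have h' : ((y i - x i : ℝ) : UnitAddCircle) = 0 := by
        rw [AddCircle.coe_sub]
        exact sub_eq_zero.2 h
      obtain ⟨n, hn⟩ := (AddCircle.coe_eq_zero_iff (1 : ℝ)).1 h'
      refine ⟨n, ?_⟩
      rw [zsmul_one] at hn
      linarith
    choose n hn using this
    have : WithLp.toLp 2 y = WithLp.toLp 2 x + latticePoint n := by
      ext i; simp [hn]
    rw [hF]
    simp only [← hy]
    rw [this, periodize_add_latticePoint]
  have hc : Continuous F := by
    rw [hq.isQuotientMap.continuous_iff]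
    have : F ∘ π = periodize g ∘ WithLp.toLp 2 := funext hFπ
    rw [this]
    exact (continuous_periodize g).comp (PiLp.continuous_toLp 2 _)
  exact ⟨⟨F, hc⟩, fun x => hFπ (WithLp.ofLp x)⟩

/-- Unfolding: the character is lattice-periodic, so the integral over one cell of the sum of
translates is the integral over the whole space of a single function. -/
lemma mFourierCoeff_of_periodize (g : 𝓢(EuclideanSpace ℝ ι, ℂ)) (F : C(UnitAddTorus ι, ℂ))
    (hF : ∀ x : EuclideanSpace ℝ ι, F (fun i => (x i : UnitAddCircle)) = periodize g x)
    (p : ι → ℤ) : UnitAddTorus.mFourierCoeff F p = 𝓕 g (latticePoint p) := by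
  rw [UnitAddTorus.mFourierCoeff_eq_integral _ _ (0 : ι → ℝ)]
  set H : (ι → ℝ) → ℂ := fun x =>
    euclChar (latticePoint (-p)) (WithLp.toLp 2 x) * g (WithLp.toLp 2 x) with hH
  have hgi : Integrable fun x : ι → ℝ => g (WithLp.toLp 2 x) :=
    ((PiLp.volume_preserving_toLp ι).integrable_comp_emb
      (MeasurableEquiv.toLp 2 (ι → ℝ)).measurableEmbedding).2 g.integrable
  have hHi : Integrable H := by
    refine hgi.norm.mono' ?_ (.of_forall fun x => by simp [hH])
    have : Continuous H := by
      simp only [hH, euclChar]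
      have := g.continuous
      fun_prop
    exact this.aestronglyMeasurable
  have hchar : ∀ (x : ι → ℝ) (n : ι → ℤ), euclChar (latticePoint (-p))
      (WithLp.toLp 2 (x + fun i => (n i : ℝ))) = euclChar (latticePoint (-p)) (WithLp.toLp 2 x) := by
    intro x n
    rw [← euclChar_eq_mFourier, ← euclChar_eq_mFourier]
    congr 1
    funext i
    simp
  have hsum := hasSum_integral_unitCell hHi
  have hsumn := (hasSum_integral_unitCell hHi.norm).summable
  set cell := {x : ι → ℝ | ∀ i, x i ∈ Set.Ioc ((0 : ι → ℝ) i) ((0 : ι → ℝ) i + 1)}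
  have hint : ∫ x in cell, (∑' n : ι → ℤ, H (x + fun i => (n i : ℝ))) = ∫ x, H x := by
    rw [← hsum.tsum_eq]
    exact (integral_tsum_of_summable_integral_norm
      (fun n => (hHi.comp_add_right _).integrableOn) hsumn).symm
  have hfour : ∫ x, H x = 𝓕 g (latticePoint p) := by
    rw [SchwartzMap.fourier_coe, Real.fourier_eq',
      ← (PiLp.volume_preserving_toLp ι).integral_comp
        (MeasurableEquiv.toLp 2 (ι → ℝ)).measurableEmbedding]
    refine integral_congr_ae (.of_forall fun x => ?_)
    simp only [hH, euclChar, latticePoint_neg, inner_neg_left, smul_eq_mul]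
    rw [real_inner_comm]
    congr 3
    push_cast
    ring
  rw [← hfour, ← hint]
  refine integral_congr_ae (.of_forall fun x => ?_)
  have h1 := hF (WithLp.toLp 2 x)
  have h2 := euclChar_eq_mFourier (-p) (WithLp.toLp 2 x)
  simp only at h1 h2 ⊢
  rw [h1, h2, periodize, smul_eq_mul, ← tsum_mul_left]
  refine tsum_congr fun n => ?_
  simp only [hH, hchar]
  rfl

/-- The Poisson summation formula for Schwartz functions on `ℝ^ι`. -/
theorem hasSum_fourier_periodize (g : 𝓢(EuclideanSpace ℝ ι, ℂ)) (x : EuclideanSpace ℝ ι) :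
    HasSum (fun p : ι → ℤ => 𝓕 g (latticePoint p) * euclChar (latticePoint p) x)
      (periodize g x) := by
  obtain ⟨F, hF⟩ := exists_torus_periodize g
  have hc : UnitAddTorus.mFourierCoeff F = fun p => 𝓕 g (latticePoint p) :=
    funext fun p => mFourierCoeff_of_periodize g F hF p
  have h := UnitAddTorus.hasSum_mFourier_series_apply_of_summable (f := F)
    (by rw [hc]; exact (summable_norm_schwartz_latticePoint (𝓕 g)).of_norm)
    (fun i => (x i : UnitAddCircle))
  rw [hF, hc] at h
  simpa only [euclChar_eq_mFourier, smul_eq_mul] using h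

end Poisson

/-! ### Distributions invariant under lattice translations and characters -/

section Comb

variable {ι : Type*} [Fintype ι]

/-- Multiplication of a Schwartz function by the character `e^{2iπ⟨η, x⟩}`. -/
def modulate (η : EuclideanSpace ℝ ι) (f : 𝓢(EuclideanSpace ℝ ι, ℂ)) :
    𝓢(EuclideanSpace ℝ ι, ℂ) :=
  𝓕⁻ (compSubConstCLM ℂ η (𝓕 f))

/-- Modulation is defined as a translation conjugated by the Fourier transform, so that seminorm
bounds for translates suffice to sum modulated functions; Fourier inversion recovers the pointwise
formula. -/
lemma modulate_apply (η : EuclideanSpace ℝ ι) (f : 𝓢(EuclideanSpace ℝ ι, ℂ))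
    (x : EuclideanSpace ℝ ι) : modulate η f x = euclChar η x * f x := by
  have hf : f x = 𝓕⁻ (𝓕 f) x := by rw [FourierTransform.fourierInv_fourier_eq]
  rw [hf, modulate, SchwartzMap.fourierInv_coe, SchwartzMap.fourierInv_coe, Real.fourierInv_eq',
    Real.fourierInv_eq', ← integral_const_mul]
  conv_lhs => rw [← integral_add_right_eq_self _ η]
  refine integral_congr_ae (.of_forall fun ξ => ?_)
  simp only [compSubConstCLM_apply, add_sub_cancel_right, smul_eq_mul, euclChar, inner_add_left]
  rw [← mul_assoc, ← Complex.exp_add]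
  congr 2
  push_cast
  ring

/-- The product of two Schwartz functions. -/
def schwartzMul (g f : 𝓢(EuclideanSpace ℝ ι, ℂ)) : 𝓢(EuclideanSpace ℝ ι, ℂ) :=
  smulLeftCLM ℂ (⇑g) f

lemma schwartzMul_apply (g f : 𝓢(EuclideanSpace ℝ ι, ℂ)) (x : EuclideanSpace ℝ ι) :
    schwartzMul g f x = g x * f x :=
  SchwartzMap.smulLeftCLM_apply_apply g.hasTemperateGrowth f x

/-- The translate `g(x + n)`. -/
def latticeShift (n : ι → ℤ) (g : 𝓢(EuclideanSpace ℝ ι, ℂ)) : 𝓢(EuclideanSpace ℝ ι, ℂ) :=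
  compSubConstCLM ℂ (-latticePoint n) g

lemma latticeShift_apply (n : ι → ℤ) (g : 𝓢(EuclideanSpace ℝ ι, ℂ)) (x : EuclideanSpace ℝ ι) :
    latticeShift n g x = g (x + latticePoint n) := by
  rw [latticeShift, compSubConstCLM_apply, sub_neg_eq_add]

/-- The product of a Schwartz function and a periodization is a sum in the Schwartz space, in
position space as well as in momentum space. -/
lemma exists_schwartz_mul_periodize (f g : 𝓢(EuclideanSpace ℝ ι, ℂ)) :
    ∃ h : 𝓢(EuclideanSpace ℝ ι, ℂ),
      HasSum (fun n : ι → ℤ => schwartzMul (latticeShift n g) f) h ∧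
      HasSum (fun p : ι → ℤ => 𝓕 g (latticePoint p) • modulate (latticePoint p) f) h := by
  obtain ⟨m, hm⟩ := exists_summable_one_add_norm_latticePoint ι
  have h1 : ∀ k l, Summable fun n : ι → ℤ =>
      SchwartzMap.seminorm ℂ k l (schwartzMul (latticeShift n g) f) := by
    intro k l
    obtain ⟨C, hC⟩ := exists_seminorm_smul_compSubConst_le f g k l m
    refine (hm.mul_left C).of_nonneg_of_le (fun _ => apply_nonneg _ _) fun n => ?_
    have := hC (-latticePoint n)
    rwa [norm_neg] at this
  -- The second series is summed on the Fourier side, where the modulations are translations of `𝓕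
  -- f` and the rapidly decreasing `𝓕 g` absorbs their polynomial cost.
  have h2 : ∀ k l, Summable fun p : ι → ℤ => SchwartzMap.seminorm ℂ k l
      (𝓕 g (latticePoint p) • compSubConstCLM ℂ (latticePoint p) (𝓕 f)) := by
    intro k l
    obtain ⟨C, hC⟩ := exists_seminorm_compSubConst_le (𝓕 f) k l
    obtain ⟨D, hD, hg⟩ := exists_one_add_norm_pow_mul_le (𝓕 g) (k + m) 0
    refine (hm.mul_left (D * C)).of_nonneg_of_le (fun _ => apply_nonneg _ _) fun p => ?_
    have hg' := hg 0 le_rfl (latticePoint p)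
    rw [norm_iteratedFDeriv_zero] at hg'
    rw [map_smul_eq_mul, ← div_eq_mul_inv, le_div_iff₀ (by positivity)]
    have hC0 : 0 ≤ C := by
      have := (apply_nonneg _ _).trans (hC 0)
      simpa using this
    calc ‖𝓕 g (latticePoint p)‖ * SchwartzMap.seminorm ℂ k l
          (compSubConstCLM ℂ (latticePoint p) (𝓕 f)) * (1 + ‖latticePoint p‖) ^ m
        ≤ ‖𝓕 g (latticePoint p)‖ * (C * (1 + ‖latticePoint p‖) ^ k) *
          (1 + ‖latticePoint p‖) ^ m := by gcongr; exact hC _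
      _ = ((1 + ‖latticePoint p‖) ^ (k + m) * ‖𝓕 g (latticePoint p)‖) * C := by ring
      _ ≤ D * C := by gcongr
  have s1 := hasSum_schwartzSum _ h1
  have s2 := (hasSum_schwartzSum _ h2).mapL
    ((FourierTransform.fourierCLE ℂ 𝓢(EuclideanSpace ℝ ι, ℂ)).symm :
      𝓢(EuclideanSpace ℝ ι, ℂ) →L[ℂ] 𝓢(EuclideanSpace ℝ ι, ℂ))
  simp only [map_smul] at s2
  change HasSum (fun p : ι → ℤ => 𝓕 g (latticePoint p) • modulate (latticePoint p) f) _ at s2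
  refine ⟨_, s1, ?_⟩
  convert s2 using 1
  -- Both sums equal `f · periodize g` pointwise, the second by Poisson summation; evaluations are
  -- continuous and separate Schwartz functions.
  have hev : ∀ x, Continuous fun u : 𝓢(EuclideanSpace ℝ ι, ℂ) => u x := fun x =>
    (TemperedDistribution.delta x).continuous
  ext x
  have e1 := s1.map (AddMonoidHom.mk' (fun u : 𝓢(EuclideanSpace ℝ ι, ℂ) => u x)
    fun _ _ => rfl) (hev x)
  have e2 := s2.map (AddMonoidHom.mk' (fun u : 𝓢(EuclideanSpace ℝ ι, ℂ) => u x)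
    fun _ _ => rfl) (hev x)
  have f1 := (hasSum_periodize g x).mul_right (f x)
  have f2 := (hasSum_fourier_periodize g x).mul_right (f x)
  have g1 : _ = periodize g x * f x := e1.unique (f1.congr_fun fun n => by
    simp [schwartzMul_apply, latticeShift_apply])
  have g2 : _ = periodize g x * f x := e2.unique (f2.congr_fun fun n => by
    simp [modulate_apply, mul_assoc])
  exact g1.trans g2.symm

/-- A tempered distribution which is invariant under lattice translations and under multiplication
by lattice characters is a multiple of the Dirac comb. -/
theorem apply_mul_periodize_comm (ψ : 𝓢'(EuclideanSpace ℝ ι, ℂ))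
    (hshift : ∀ n u, ψ (latticeShift n u) = ψ u)
    (hmod : ∀ p u, ψ (modulate (latticePoint p) u) = ψ u) (f g : 𝓢(EuclideanSpace ℝ ι, ℂ)) :
    ψ f * periodize g 0 = ψ g * periodize f 0 := by
  -- The distribution is applied to `f · periodize g`. Expanding the periodization in characters,
  -- modulation invariance replaces each term by `𝓕 g(p) ψ f`, and Poisson summation at `0` adds
  -- these up.
  have key : ∀ f g, HasSum (fun n : ι → ℤ => ψ (schwartzMul (latticeShift n g) f))
      (ψ f * periodize g 0) := by
    intro f g
    obtain ⟨h, h1, h2⟩ := exists_schwartz_mul_periodize f g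
    have e1 := h1.map (ψ : 𝓢(EuclideanSpace ℝ ι, ℂ) →+ ℂ) ψ.continuous
    have e2 := h2.map (ψ : 𝓢(EuclideanSpace ℝ ι, ℂ) →+ ℂ) ψ.continuous
    have e3 := (hasSum_fourier_periodize g 0).mul_left (ψ f)
    have : ψ h = ψ f * periodize g 0 := e2.unique (e3.congr_fun fun p => by
      simp [hmod, euclChar, mul_comm])
    rw [← this]
    exact e1
  have h1 := key f g
  -- With the roles of `f` and `g` exchanged and `n` replaced by `-n`, shift invariance turns `f(x -
  -- n) g(x)` into `f(x) g(x + n)`, so the two series agree term by term.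
  have h2 := (Equiv.neg (ι → ℤ)).hasSum_iff.2 (key g f)
  refine h1.unique (h2.congr_fun fun n => ?_)
  simp only [Function.comp, Equiv.neg_apply]
  rw [← hshift n (schwartzMul (latticeShift (-n) f) g)]
  congr 1
  ext x
  simp [latticeShift_apply, schwartzMul_apply, latticePoint_neg, mul_comm]

lemma one_le_norm_latticePoint {n : ι → ℤ} (hn : n ≠ 0) : 1 ≤ ‖latticePoint n‖ := by
  obtain ⟨i, hi⟩ := Function.ne_iff.1 hn
  refine le_trans ?_ (PiLp.norm_apply_le (latticePoint n) i)
  rw [latticePoint_apply, Real.norm_eq_abs]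
  exact_mod_cast Int.one_le_abs hi

variable (ι) in
/-- There is a Schwartz partition of unity for the lattice translations. -/
lemma exists_periodize_eq_one :
    ∃ φ : 𝓢(EuclideanSpace ℝ ι, ℂ), ∀ x, periodize φ x = 1 := by
  classical
  -- The partition of unity is an inverse Fourier transform: its transform is a bump equal to `1` at
  -- the origin and supported within distance `1/2`, so only `p = 0` survives in Poisson summation.
  let b : ContDiffBump (0 : EuclideanSpace ℝ ι) := ⟨1 / 4, 1 / 2, by norm_num, by norm_num⟩
  have hc : HasCompactSupport fun x => ((b x : ℝ) : ℂ) :=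
    b.hasCompactSupport.comp_left Complex.ofReal_zero
  have hs : ContDiff ℝ ∞ fun x => ((b x : ℝ) : ℂ) := Complex.ofRealCLM.contDiff.comp b.contDiff
  set B : 𝓢(EuclideanSpace ℝ ι, ℂ) := hc.toSchwartzMap hs with hB
  have hBx : ∀ x, B x = (b x : ℂ) := fun x => rfl
  refine ⟨𝓕⁻ B, fun x => ?_⟩
  have h := hasSum_fourier_periodize (𝓕⁻ B) x
  rw [FourierTransform.fourier_fourierInv_eq] at h
  refine h.unique ?_
  convert hasSum_ite_eq (0 : ι → ℤ) (1 : ℂ) using 2 with p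
  have h0 : latticePoint (0 : ι → ℤ) = 0 := by ext; simp
  split_ifs with hp
  · have : b 0 = 1 := b.one_of_mem_closedBall (by simp [b.rIn_pos.le])
    rw [hp, h0, hBx, this]
    simp [euclChar]
  · have : b (latticePoint p) = 0 := b.zero_of_le_dist (by
      rw [dist_zero_right]
      exact le_trans (by norm_num) (one_le_norm_latticePoint hp))
    rw [hBx, this]
    simp

end Comb

/-! ### Fourier series of observables on the torus -/

section

/-! ### Smooth periodic functions on Euclidean space -/

section PeriodicGrowth

variable {ι : Type*} [Fintype ι]

/-- Every derivative is periodic too, hence bounded by its maximum on the compact unit cube. -/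
lemma hasTemperateGrowth_of_periodic {f : EuclideanSpace ℝ ι → ℂ} (hf : ContDiff ℝ ∞ f)
    (hp : ∀ x (n : ι → ℤ), f (x + latticePoint n) = f x) : f.HasTemperateGrowth := by
  refine ⟨hf, fun l => ?_⟩
  have hcont : Continuous (iteratedFDeriv ℝ l f) :=
    hf.continuous_iteratedFDeriv (by exact_mod_cast le_top)
  have hK : IsCompact (WithLp.toLp 2 '' Set.Icc (0 : ι → ℝ) 1) :=
    isCompact_Icc.image (PiLp.continuous_toLp 2 _)
  obtain ⟨C, hC⟩ := hK.exists_bound_of_continuousOn hcont.continuousOn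
  refine ⟨0, C, fun x => ?_⟩
  set n : ι → ℤ := fun i => -⌊x i⌋
  have hx : iteratedFDeriv ℝ l f x = iteratedFDeriv ℝ l f (x + latticePoint n) := by
    rw [← iteratedFDeriv_comp_add_right]
    congr 1
    funext y
    exact (hp y n).symm
  rw [hx, pow_zero, mul_one]
  refine hC _ ⟨fun i => Int.fract (x i), ⟨fun i => Int.fract_nonneg _, fun i =>
    (Int.fract_lt_one _).le⟩, ?_⟩
  ext i
  simp [n, Int.fract, sub_eq_add_neg]

/-- A smooth periodic function on `ℝ^ι` is the sum of its Fourier series, with rapidly decreasing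
coefficients. -/
lemma exists_fourier_series {f : EuclideanSpace ℝ ι → ℂ} (hf : ContDiff ℝ ∞ f)
    (hp : ∀ x (n : ι → ℤ), f (x + latticePoint n) = f x) :
    ∃ c : (ι → ℤ) → ℂ, (∀ k : ℕ, Summable fun p => (1 + ‖latticePoint p‖) ^ k * ‖c p‖) ∧
      ∀ x, HasSum (fun p => c p * euclChar (latticePoint p) x) (f x) := by
  obtain ⟨φ, hφ⟩ := exists_periodize_eq_one ι
  have hg := hasTemperateGrowth_of_periodic hf hp
  -- Multiplying by the partition of unity gives a Schwartz function whose periodization is `f`,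
  -- which reduces the Fourier series to Poisson summation.
  set g : 𝓢(EuclideanSpace ℝ ι, ℂ) := smulLeftCLM ℂ f φ
  have hgx : ∀ x, g x = f x * φ x := fun x => SchwartzMap.smulLeftCLM_apply_apply hg φ x
  refine ⟨fun p => 𝓕 g (latticePoint p), fun k => ?_, fun x => ?_⟩
  · obtain ⟨m, hm⟩ := exists_summable_one_add_norm_latticePoint ι
    obtain ⟨D, hD, hb⟩ := exists_one_add_norm_pow_mul_le (𝓕 g) (k + m) 0
    refine (hm.mul_left D).of_nonneg_of_le (fun _ => by positivity) fun p => ?_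
    have := hb 0 le_rfl (latticePoint p)
    rw [norm_iteratedFDeriv_zero] at this
    rw [← div_eq_mul_inv, le_div_iff₀ (by positivity)]
    calc _ = (1 + ‖latticePoint p‖) ^ (k + m) * ‖𝓕 g (latticePoint p)‖ := by ring
      _ ≤ D := this
  · have hper : periodize g x = f x := by
      have h1 := hφ x
      rw [periodize] at h1 ⊢
      calc ∑' n : ι → ℤ, g (x + latticePoint n) = ∑' n : ι → ℤ, f x * φ (x + latticePoint n) :=
            tsum_congr fun n => by rw [hgx, hp]
        _ = f x := by rw [tsum_mul_left, h1, mul_one]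
    rw [← hper]
    exact hasSum_fourier_periodize g x

end PeriodicGrowth

variable {d : ℕ}

/-- The bijection `r ↦ -J r` of the lattice. -/
def latticeRot : Lattice d ≃ Lattice d where
  toFun r := Sum.elim (fun j => r (Sum.inr j)) (fun j => -r (Sum.inl j))
  invFun r := Sum.elim (fun j => -r (Sum.inr j)) (fun j => r (Sum.inl j))
  left_inv r := by funext i; rcases i with i | i <;> simp
  right_inv r := by funext i; rcases i with i | i <;> simp

lemma torusChar_eq (r : Lattice d) (ρ : Phase d) :
    torusChar r ρ = Complex.exp (((2 * Real.pi * sympl (ofLattice r) ρ : ℝ) : ℂ) * Complex.I) := by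
  rw [torusChar, dotProduct_J_eq]
  congr 1
  push_cast
  ring

lemma torusChar_add (r : Lattice d) (ρ ρ' : Phase d) :
    torusChar r (ρ + ρ') = torusChar r ρ * torusChar r ρ' := by
  rw [torusChar, torusChar, torusChar, ← Complex.exp_add, dotProduct_add]
  push_cast
  ring_nf

lemma continuous_torusChar (r : Lattice d) : Continuous (torusChar r) := by
  have : Continuous fun ρ : Phase d => (Matrix.J (Fin d) ℝ *ᵥ ofLattice r) ⬝ᵥ ρ :=
    Continuous.dotProduct continuous_const continuous_id
  unfold torusChar
  fun_prop

lemma torusChar_eq_euclChar (r : Lattice d) (ρ : Phase d) :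
    torusChar r ρ = euclChar (latticePoint (latticeRot r)) (WithLp.toLp 2 ρ) := by
  rw [torusChar_eq, euclChar, sympl_eq]
  congr 4
  simp only [PiLp.inner_apply, Fintype.sum_sum_type, pos, mom, ofLattice, latticePoint, latticeRot]
  simp [mul_comm, Finset.sum_neg_distrib, sub_eq_add_neg]

lemma norm_ofLattice_le (r : Lattice d) : ‖ofLattice r‖ ≤ ‖latticePoint (latticeRot r)‖ := by
  refine (pi_norm_le_iff_of_nonneg (norm_nonneg _)).2 fun i => ?_
  rcases i with i | i
  · have := PiLp.norm_apply_le (latticePoint (latticeRot r)) (Sum.inr i)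
    simpa [latticeRot, ofLattice] using this
  · have := PiLp.norm_apply_le (latticePoint (latticeRot r)) (Sum.inl i)
    simpa [latticeRot, ofLattice] using this

/-- The Fourier series of a smooth observable on the torus. -/
lemma IsTorusObservable.exists_fourier_series {a : Phase d → ℂ} (ha : IsTorusObservable a) :
    ∃ c : Lattice d → ℂ, (∀ k : ℕ, Summable fun r => (1 + ‖ofLattice r‖) ^ k * ‖c r‖) ∧
      ∀ ρ, HasSum (fun r => c r * torusChar r ρ) (a ρ) := by
  obtain ⟨c, hc, hs⟩ := CatMap.exists_fourier_series
    (f := fun x : EuclideanSpace ℝ (Fin d ⊕ Fin d) => a (WithLp.ofLp x))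
    (ha.smooth.comp (PiLp.contDiff_ofLp (𝕜 := ℝ))) fun x n => ha.periodic n _
  refine ⟨c ∘ latticeRot, fun k => ?_, fun ρ => ?_⟩
  · refine ((latticeRot (d := d)).summable_iff.2 (hc k)).of_nonneg_of_le
      (fun _ => by positivity) fun r => ?_
    simp only [Function.comp]
    have := norm_ofLattice_le r
    gcongr
  · have := (latticeRot (d := d)).hasSum_iff.2 (hs (WithLp.toLp 2 ρ))
    refine this.congr_fun fun r => ?_
    simp only [Function.comp, torusChar_eq_euclChar]

lemma integral_Icc_exp (k : ℤ) :
    ∫ x in Set.Icc (0 : ℝ) 1, Complex.exp (2 * Real.pi * Complex.I * k * x) =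
      if k = 0 then 1 else 0 := by
  rw [integral_Icc_eq_integral_Ioc, ← intervalIntegral.integral_of_le zero_le_one]
  split_ifs with hk
  · simp [hk]
  · have hne : 2 * Real.pi * Complex.I * k ≠ 0 := by
      have := Complex.two_pi_I_ne_zero
      exact mul_ne_zero this (by exact_mod_cast hk)
    rw [integral_exp_mul_complex hne]
    have : Complex.exp (2 * Real.pi * Complex.I * k * (1 : ℝ)) = 1 := by
      rw [Complex.ofReal_one, mul_one, mul_comm]
      exact Complex.exp_int_mul_two_pi_mul_I k
    rw [this]
    simp

/-- After the relabelling `latticeRot` the symplectic characters are products of one-dimensional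
ones, and Fubini reduces orthonormality to dimension one. -/
lemma integral_cube_torusChar (r s : Lattice d) :
    ∫ ρ in Set.Icc (0 : Phase d) 1, Complex.exp (2 * Real.pi * Complex.I *
      (((Matrix.J (Fin d) ℝ *ᵥ ofLattice r) ⬝ᵥ ρ : ℝ) : ℂ)) * torusChar s ρ =
      if r = s then 1 else 0 := by
  have hvol : (volume : Measure (Phase d)).restrict (Set.Icc 0 1) =
      Measure.pi fun _ => (volume : Measure ℝ).restrict (Set.Icc 0 1) := by
    rw [← Measure.restrict_pi_pi, Set.pi_univ_Icc]
    rfl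
  have hfun : ∀ ρ : Phase d, Complex.exp (2 * Real.pi * Complex.I *
      (((Matrix.J (Fin d) ℝ *ᵥ ofLattice r) ⬝ᵥ ρ : ℝ) : ℂ)) * torusChar s ρ =
      ∏ i, Complex.exp (2 * Real.pi * Complex.I *
        ((latticeRot s i - latticeRot r i : ℤ) : ℂ) * ρ i) := by
    intro ρ
    have h1 : Complex.exp (2 * Real.pi * Complex.I *
        (((Matrix.J (Fin d) ℝ *ᵥ ofLattice r) ⬝ᵥ ρ : ℝ) : ℂ)) = (torusChar r ρ)⁻¹ := by
      rw [torusChar, ← Complex.exp_neg]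
      congr 1
      ring
    rw [h1, torusChar_eq_euclChar, torusChar_eq_euclChar, euclChar, euclChar, ← Complex.exp_neg,
      ← Complex.exp_add, ← Complex.exp_sum]
    congr 1
    simp only [PiLp.inner_apply, latticePoint_apply, RCLike.inner_apply, conj_trivial]
    push_cast
    rw [Finset.mul_sum, Finset.mul_sum, Finset.sum_mul, Finset.sum_mul, ← Finset.sum_neg_distrib,
      ← Finset.sum_add_distrib]
    exact Finset.sum_congr rfl fun i _ => by ring
  simp only [hfun]
  rw [hvol, integral_fintype_prod_eq_prod (𝕜 := ℂ) (fun i (x : ℝ) => Complex.exp (2 * Real.pi *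
    Complex.I * ((latticeRot s i - latticeRot r i : ℤ) : ℂ) * x))]
  simp only [integral_Icc_exp, sub_eq_zero]
  split_ifs with h
  · simp [h]
  · have h' : latticeRot s ≠ latticeRot r := fun e => h (latticeRot.injective e).symm
    obtain ⟨i, hi⟩ := Function.ne_iff.1 h'
    exact Finset.prod_eq_zero (Finset.mem_univ i) (by rw [if_neg hi])

/-- The Fourier coefficients of an absolutely convergent Fourier series. -/
lemma torusCoeff_of_hasSum {b : Phase d → ℂ} {c : Lattice d → ℂ} (hc : Summable fun s => ‖c s‖)
    (hb : ∀ ρ, HasSum (fun s => c s * torusChar s ρ) (b ρ)) (r : Lattice d) :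
    torusCoeff b r = c r := by
  have hch : ∀ ρ : Phase d, ‖Complex.exp (2 * Real.pi * Complex.I *
      (((Matrix.J (Fin d) ℝ *ᵥ ofLattice r) ⬝ᵥ ρ : ℝ) : ℂ))‖ = 1 := by
    intro ρ
    have : Complex.exp (2 * Real.pi * Complex.I *
        (((Matrix.J (Fin d) ℝ *ᵥ ofLattice r) ⬝ᵥ ρ : ℝ) : ℂ)) = (torusChar r ρ)⁻¹ := by
      rw [torusChar, ← Complex.exp_neg]
      congr 1
      ring
    rw [this, norm_inv, norm_torusChar, inv_one]
  have hcont : Continuous fun ρ : Phase d => Complex.exp (2 * Real.pi * Complex.I *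
      (((Matrix.J (Fin d) ℝ *ᵥ ofLattice r) ⬝ᵥ ρ : ℝ) : ℂ)) := by
    have : Continuous fun ρ : Phase d => (Matrix.J (Fin d) ℝ *ᵥ ofLattice r) ⬝ᵥ ρ :=
      Continuous.dotProduct continuous_const continuous_id
    fun_prop
  have hcube : (volume : Measure (Phase d)).real (Set.Icc 0 1) = 1 := by
    simp [measureReal_def, Real.volume_Icc_pi]
  set F : Lattice d → Phase d → ℂ := fun s ρ => c s * (Complex.exp (2 * Real.pi * Complex.I *
      (((Matrix.J (Fin d) ℝ *ᵥ ofLattice r) ⬝ᵥ ρ : ℝ) : ℂ)) * torusChar s ρ) with hF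
  have hFi : ∀ s, Integrable (F s) (volume.restrict (Set.Icc 0 1)) := fun s =>
    (((hcont.mul (continuous_torusChar s)).const_mul _).continuousOn).integrableOn_compact
      isCompact_Icc
  have hFn : ∀ s ρ, ‖F s ρ‖ = ‖c s‖ := fun s ρ => by
    simp [hF, hch, norm_torusChar]
  have h := hasSum_integral_of_summable_integral_norm hFi (by
    simpa only [hFn, integral_const, measureReal_restrict_apply_univ, hcube, one_smul] using hc)
  have h2 : torusCoeff b r = ∫ ρ in Set.Icc (0 : Phase d) 1, ∑' s, F s ρ := by
    refine integral_congr_ae (.of_forall fun ρ => ?_)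
    simp only [hF]
    rw [← (hb ρ).tsum_eq, ← tsum_mul_left]
    exact tsum_congr fun s => by ring
  rw [h2]
  refine h.unique ?_
  have : (fun s => ∫ ρ in Set.Icc (0 : Phase d) 1, F s ρ) = fun s => if s = r then c r else 0 := by
    funext s
    simp only [hF, integral_const_mul, integral_cube_torusChar]
    by_cases h : s = r
    · simp [h]
    · simp [h, Ne.symm h]
  rw [this]
  exact hasSum_ite_eq r (c r)

/-- The Fourier series of the convolution of an observable with an integrable kernel. -/
lemma hasSum_convolution {b : Phase d → ℂ} {c : Lattice d → ℂ} (hc : Summable fun s => ‖c s‖)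
    (hb : ∀ ρ, HasSum (fun s => c s * torusChar s ρ) (b ρ)) {K : Phase d → ℂ} (hK : Integrable K)
    (ρ : Phase d) :
    HasSum (fun s => c s * (∫ v, torusChar s (-v) * K v) * torusChar s ρ)
      ((b ⋆[ContinuousLinearMap.mul ℂ ℂ, volume] K) ρ) := by
  set F : Lattice d → Phase d → ℂ := fun s v => c s * torusChar s ρ * (torusChar s (-v) * K v)
    with hF
  have hchi : ∀ s, Integrable fun v => torusChar s (-v) * K v := fun s =>
    hK.norm.mono' (((continuous_torusChar s).comp continuous_neg).aestronglyMeasurable.mul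
      hK.aestronglyMeasurable) (.of_forall fun v => by simp [norm_torusChar])
  have h := hasSum_integral_of_summable_integral_norm (μ := volume) (F := F)
    (fun s => (hchi s).const_mul _) (by
      simp only [hF, norm_mul, norm_torusChar, one_mul, mul_one, integral_const_mul]
      exact hc.mul_right _)
  have h2 : (b ⋆[ContinuousLinearMap.mul ℂ ℂ, volume] K) ρ = ∫ v, ∑' s, F s v := by
    rw [convolution_def, ← integral_sub_left_eq_self _ volume ρ]
    refine integral_congr_ae (.of_forall fun v => ?_)
    simp only [hF, ContinuousLinearMap.mul_apply', sub_sub_cancel]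
    rw [← (hb (ρ - v)).tsum_eq, ← tsum_mul_right]
    refine tsum_congr fun s => ?_
    rw [sub_eq_add_neg, torusChar_add]
    ring
  rw [h2]
  refine h.congr_fun fun s => ?_
  simp only [hF, integral_const_mul]
  ring

/-- This turns the smoothing in the positive quantization into a Fourier multiplier, the symplectic
Fourier transform of the kernel. -/
lemma torusCoeff_convolution {b : Phase d → ℂ} {c : Lattice d → ℂ} (hc : Summable fun s => ‖c s‖)
    (hb : ∀ ρ, HasSum (fun s => c s * torusChar s ρ) (b ρ)) {K : Phase d → ℂ} (hK : Integrable K)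
    (r : Lattice d) :
    torusCoeff (b ⋆[ContinuousLinearMap.mul ℂ ℂ, volume] K) r =
      c r * ∫ v, torusChar r (-v) * K v := by
  refine torusCoeff_of_hasSum (c := fun s => c s * ∫ v, torusChar s (-v) * K v) ?_
    (hasSum_convolution hc hb hK) r
  refine (hc.mul_right (∫ v, ‖K v‖)).of_nonneg_of_le (fun _ => norm_nonneg _) fun s => ?_
  rw [norm_mul]
  gcongr
  refine (norm_integral_le_integral_norm _).trans_eq ?_
  simp only [norm_mul, norm_torusChar, one_mul]

end

/-! ### Translations on the space of torus states -/

section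

variable {d : ℕ}

/-- The lattice vector `(q, 0)`. -/
def posVec (q : Fin d → ℤ) : Lattice d := Sum.elim q 0

/-- The lattice vector `(0, p)`. -/
def momVec (p : Fin d → ℤ) : Lattice d := Sum.elim 0 p

lemma momVec_add (p p' : Fin d → ℤ) : momVec (p + p') = momVec p + momVec p' := by
  funext i; rcases i with i | i <;> simp [momVec]

lemma pos_posVec (q : Fin d → ℤ) : pos (ofLattice (posVec q)) = latticePoint q := rfl

lemma mom_posVec (q : Fin d → ℤ) : mom (ofLattice (posVec q)) = 0 := by
  ext i; simp [mom, ofLattice, posVec]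

lemma pos_momVec (p : Fin d → ℤ) : pos (ofLattice (momVec p)) = 0 := by
  ext i; simp [pos, ofLattice, momVec]

lemma mom_momVec (p : Fin d → ℤ) : mom (ofLattice (momVec p)) = latticePoint p := rfl

lemma pos_smul (c : ℝ) (ρ : Phase d) : pos (c • ρ) = c • pos ρ := rfl

lemma mom_smul (c : ℝ) (ρ : Phase d) : mom (c • ρ) = c • mom ρ := rfl

lemma ofLattice_add (r s : Lattice d) : ofLattice (r + s) = ofLattice r + ofLattice s := by
  funext i; simp [ofLattice]

lemma pos_zero : pos (0 : Phase d) = 0 := rfl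

lemma mom_zero : mom (0 : Phase d) = 0 := rfl

lemma translS_zero (ħ : ℝ) (u : 𝓢(Conf d, ℂ)) : translS ħ 0 u = u := by
  ext y
  simp [translS_apply, heisenbergPhase, pos_zero, mom_zero]

lemma transl_zero (ħ : ℝ) (ψ : 𝓢'(Conf d, ℂ)) : transl ħ 0 ψ = ψ := by
  ext u
  have : flipPos (0 : Phase d) = 0 := by
    funext i; rcases i with i | i <;> simp [flipPos]
  rw [transl_apply, this, translS_zero]

lemma sympl_neg_self (ρ : Phase d) : sympl (-ρ) ρ = 0 := by
  have h := sympl_smul_right (-1) ρ ρ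
  have h0 : sympl ρ ρ = 0 := by
    have := sympl_swap ρ ρ
    linarith
  rw [neg_one_smul, h0, mul_zero] at h
  have := sympl_swap ρ (-ρ)
  rw [this, h, neg_zero]

lemma transl_injective (ħ : ℝ) (ρ : Phase d) : Function.Injective (transl ħ ρ) := by
  refine Function.LeftInverse.injective (g := transl ħ (-ρ)) fun ψ => ?_
  rw [transl_transl, sympl_neg_self, neg_add_cancel, transl_zero]
  simp

lemma planck_pos {N : ℕ} (hN : 1 ≤ N) : 0 < planck N := by
  rw [planck]
  positivity

/-- Joint quasi-eigenvectors of the lattice translations in position and in momentum are determined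
by a single number, as they are translates of multiples of the Dirac comb. -/
lemma exists_schwartz_determining {N : ℕ} (hN : 1 ≤ N) (a b : Conf d) :
    ∃ g : 𝓢(Conf d, ℂ), ∀ ψ : 𝓢'(Conf d, ℂ),
      (∀ q : Fin d → ℤ, transl (planck N) (ofLattice (posVec q)) ψ =
        Complex.exp (Complex.I * ((inner ℝ a (latticePoint q) : ℝ) : ℂ)) • ψ) →
      (∀ p : Fin d → ℤ, transl (planck N) ((N : ℝ)⁻¹ • ofLattice (momVec p)) ψ =
        Complex.exp (Complex.I * ((inner ℝ b (latticePoint p) : ℝ) : ℂ)) • ψ) →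
      ψ g = 0 → ψ = 0 := by
  have hN0 : (N : ℝ) ≠ 0 := by positivity
  have hπ : Real.pi ≠ 0 := Real.pi_ne_zero
  obtain ⟨φ, hφ⟩ := exists_periodize_eq_one (Fin d)
  -- The point `ρ₀` is chosen so that commuting `U_ħ(ρ₀)` past the lattice translations cancels the
  -- phases given by `a` and `b`. The translate `χ` of `ψ` is then exactly invariant, hence a
  -- multiple of the Dirac comb, and `χ φ` is the value of `ψ` on the chosen Schwartz function.
  set ρ₀ : Phase d := Sum.elim (fun j => -(b j) / (2 * Real.pi)) (fun j => a j / (2 * Real.pi * N))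
    with hρ₀
  have hpos : pos ρ₀ = (-(2 * Real.pi)⁻¹) • b := by
    ext j; simp [hρ₀, pos, div_eq_inv_mul]
  have hmom : mom ρ₀ = (2 * Real.pi * N)⁻¹ • a := by
    ext j; simp [hρ₀, mom, div_eq_inv_mul]
  refine ⟨translS (planck N) (flipPos ρ₀) φ, fun ψ hq hp hg => ?_⟩
  set χ := transl (planck N) ρ₀ ψ with hχ
  have hχφ : χ φ = 0 := hg
  have hshift : ∀ (n : Fin d → ℤ) u, χ (latticeShift n u) = χ u := by
    intro n u
    have h1 : latticeShift n u = translS (planck N) (flipPos (ofLattice (posVec n))) u := by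
      ext y
      rw [latticeShift_apply, translS_apply, heisenbergPhase, mom_flipPos, pos_flipPos, mom_posVec,
        pos_posVec]
      simp
    rw [h1, ← transl_apply, hχ, transl_comm, hq, map_smul, smul_smul, ← Complex.exp_add, sympl_eq,
      mom_posVec, pos_posVec, hmom, ← mul_add, ← Complex.ofReal_add]
    have : (inner ℝ 0 (pos ρ₀) - inner ℝ (latticePoint n) ((2 * Real.pi * N)⁻¹ • a)) / planck N +
        inner ℝ a (latticePoint n) = 0 := by
      rw [inner_zero_left, real_inner_smul_right, real_inner_comm a, planck]
      field_simp
      ring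
    rw [this]
    simp
  have hmod : ∀ (p : Fin d → ℤ) u, χ (modulate (latticePoint p) u) = χ u := by
    intro p u
    have h1 : modulate (latticePoint p) u =
        translS (planck N) (flipPos ((N : ℝ)⁻¹ • ofLattice (momVec p))) u := by
      ext y
      rw [modulate_apply, translS_apply, heisenbergPhase, mom_flipPos, pos_flipPos, mom_smul,
        pos_smul, mom_momVec, pos_momVec, euclChar]
      simp only [smul_zero, neg_zero, inner_zero_left, zero_div, sub_zero]
      congr 2
      rw [mul_comm, real_inner_smul_left, planck]
      congr 2
      field_simp
    rw [h1, ← transl_apply, hχ, transl_comm, hp, map_smul, smul_smul, ← Complex.exp_add, sympl_eq,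
      mom_smul, pos_smul, mom_momVec, pos_momVec, hpos, ← mul_add, ← Complex.ofReal_add]
    have : (inner ℝ ((N : ℝ)⁻¹ • latticePoint p) (-(2 * Real.pi)⁻¹ • b) -
        inner ℝ ((N : ℝ)⁻¹ • 0) (mom ρ₀)) / planck N + inner ℝ b (latticePoint p) = 0 := by
      rw [smul_zero, inner_zero_left, real_inner_smul_right, real_inner_smul_left,
        real_inner_comm b, planck]
      field_simp
      ring
    rw [this]
    simp
  have h0 : χ = 0 := by
    ext f
    have := apply_mul_periodize_comm χ hshift hmod f φ
    rw [hφ, hχφ, mul_one, zero_mul] at this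
    rw [this]
    rfl
  refine transl_injective (planck N) ρ₀ ?_
  rw [map_zero]
  exact h0

/-! ### The algebra of the translations on the space of torus states -/

variable {N : ℕ} {κ : Phase d}

lemma coe_torusTransl (r : Lattice d) (x : torusStates N κ) :
    (torusTransl N κ r x : 𝓢'(Conf d, ℂ)) = transl (planck N) ((N : ℝ)⁻¹ • ofLattice r) x := rfl

lemma torusTransl_comm (hN : 1 ≤ N) (r s : Lattice d) (x : torusStates N κ) :
    torusTransl N κ r (torusTransl N κ s x) = Complex.exp (2 * Real.pi * Complex.I *
      ((sympl (ofLattice r) (ofLattice s) / N : ℝ) : ℂ)) •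
        torusTransl N κ s (torusTransl N κ r x) := by
  have hN0 : (N : ℝ) ≠ 0 := by positivity
  have hπ : Real.pi ≠ 0 := Real.pi_ne_zero
  apply Subtype.ext
  rw [coe_torusTransl, coe_torusTransl, transl_comm, Submodule.coe_smul, coe_torusTransl,
    coe_torusTransl]
  congr 2
  have : sympl ((N : ℝ)⁻¹ • ofLattice r) ((N : ℝ)⁻¹ • ofLattice s) / planck N =
      2 * Real.pi * (sympl (ofLattice r) (ofLattice s) / N) := by
    rw [sympl_smul_right, sympl_swap, sympl_smul_right, sympl_swap (ofLattice r), planck]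
    field_simp
  rw [this]
  push_cast
  ring

lemma torusTransl_momVec_add (p p' : Fin d → ℤ) (x : torusStates N κ) :
    torusTransl N κ (momVec p) (torusTransl N κ (momVec p') x) =
      torusTransl N κ (momVec (p + p')) x := by
  apply Subtype.ext
  rw [coe_torusTransl, coe_torusTransl, coe_torusTransl, transl_transl, momVec_add, ofLattice_add,
    smul_add, sympl_eq, pos_smul, pos_smul, pos_momVec, pos_momVec]
  simp

lemma torusTransl_zero (x : torusStates N κ) : torusTransl N κ 0 x = x := by
  apply Subtype.ext
  have : ofLattice (0 : Lattice d) = 0 := by funext i; simp [ofLattice]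
  rw [coe_torusTransl, this, smul_zero, transl_zero]

/-- `N` steps of size `1/N` form a genuine lattice translation, which acts by the prescribed scalar.
Hence momentum translations matter only modulo `N`, up to a phase. -/
lemma torusTransl_momVec_period (hN : 1 ≤ N) (p : Fin d → ℤ) (x : torusStates N κ) :
    torusTransl N κ (momVec ((N : ℤ) • p)) x =
      Complex.exp (Complex.I * ((inner ℝ (mom κ) (latticePoint p) : ℝ) : ℂ)) • x := by
  have hN0 : (N : ℝ) ≠ 0 := by positivity
  apply Subtype.ext
  have h1 : (N : ℝ)⁻¹ • ofLattice (momVec ((N : ℤ) • p)) = ofLattice (momVec p) := by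
    funext i
    rcases i with i | i <;> simp [ofLattice, momVec, hN0]
  rw [coe_torusTransl, h1, x.2, Submodule.coe_smul, quasiFactor, pos_momVec, mom_momVec]
  simp

/-- The joint eigenspaces of the momentum translations. -/
def weightSpace (N : ℕ) (κ : Phase d) (j : Fin d → ℤ) : Submodule ℂ (torusStates N κ) where
  carrier := {x | ∀ p : Fin d → ℤ, torusTransl N κ (momVec p) x = Complex.exp (Complex.I *
    ((inner ℝ ((N : ℝ)⁻¹ • (mom κ + (2 * Real.pi) • latticePoint j)) (latticePoint p) : ℝ) : ℂ)) • x}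
  add_mem' {x y} hx hy p := by rw [map_add, hx p, hy p, ← smul_add _ x y]
  zero_mem' p := by simp
  smul_mem' c x hx p := by rw [map_smul, hx p, smul_comm]

/-- The weight spaces are at most one-dimensional. -/
lemma exists_eq_smul_of_mem_weightSpace (hN : 1 ≤ N) {j : Fin d → ℤ} {v x : torusStates N κ}
    (hv : v ∈ weightSpace N κ j) (hv0 : v ≠ 0) (hx : x ∈ weightSpace N κ j) :
    ∃ c : ℂ, x = c • v := by
  obtain ⟨g, hg⟩ := exists_schwartz_determining hN (-pos κ)
    ((N : ℝ)⁻¹ • (mom κ + (2 * Real.pi) • latticePoint j))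
  have hdet : ∀ w ∈ weightSpace N κ j, (w : 𝓢'(Conf d, ℂ)) g = 0 → w = 0 := by
    intro w hw h0
    refine Subtype.ext (hg w (fun q => ?_) (fun p => ?_) h0)
    · rw [w.2, quasiFactor, pos_posVec, mom_posVec]
      simp
    · have := congrArg (Subtype.val) (hw p)
      rwa [coe_torusTransl, Submodule.coe_smul] at this
  have hvg : (v : 𝓢'(Conf d, ℂ)) g ≠ 0 := fun h => hv0 (hdet v hv h)
  refine ⟨(x : 𝓢'(Conf d, ℂ)) g / (v : 𝓢'(Conf d, ℂ)) g, sub_eq_zero.1 (hdet _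
    (Submodule.sub_mem _ hx (Submodule.smul_mem _ _ hv)) ?_)⟩
  rw [Submodule.coe_sub, Submodule.coe_smul]
  change (x : 𝓢'(Conf d, ℂ)) g -
    ((x : 𝓢'(Conf d, ℂ)) g / (v : 𝓢'(Conf d, ℂ)) g) • (v : 𝓢'(Conf d, ℂ)) g = 0
  rw [smul_eq_mul, div_mul_cancel₀ _ hvg, sub_self]

/-- The commutation phase `2π⟨q, p⟩/N` is exactly the change of weight from `j` to `j + q`. -/
lemma torusTransl_posVec_mem_weightSpace (hN : 1 ≤ N) {j : Fin d → ℤ} {x : torusStates N κ}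
    (hx : x ∈ weightSpace N κ j) (q : Fin d → ℤ) :
    torusTransl N κ (posVec q) x ∈ weightSpace N κ (j + q) := by
  intro p
  rw [torusTransl_comm hN, hx p, map_smul, smul_smul, ← Complex.exp_add]
  congr 2
  rw [sympl_eq, pos_posVec, mom_posVec, pos_momVec, mom_momVec, latticePoint_add]
  simp only [inner_zero_left, sub_zero, real_inner_smul_left, inner_add_left, smul_add]
  rw [real_inner_comm (latticePoint q)]
  push_cast
  ring

end

/-! ### Irreducibility of the space of torus states -/

section

/-! ### Characters of the finite group `(ℤ/N)^d` -/

section Characters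

variable {d N : ℕ}

/-- The integer representatives of an element of `(ℤ/N)^d`. -/
def zlift (j : Fin d → ZMod N) : Fin d → ℤ := fun i => (j i).cast

lemma zlift_zero : zlift (0 : Fin d → ZMod N) = 0 := by
  funext i; simp [zlift]

lemma exists_zlift_add (j : Fin d → ZMod N) (s : Fin d → ℤ) :
    ∃ n : Fin d → ℤ, zlift j + s = zlift (j + fun i => (s i : ZMod N)) + (N : ℤ) • n := by
  have : ∀ i, ∃ n : ℤ, zlift j i + s i = zlift (j + fun i => (s i : ZMod N)) i + N * n := by
    intro i
    have h : ((zlift j i + s i : ℤ) : ZMod N) =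
        ((zlift (j + fun i => (s i : ZMod N)) i : ℤ) : ZMod N) := by
      simp [zlift]
    have h' := (ZMod.intCast_eq_intCast_iff_dvd_sub _ _ _).1 h.symm
    obtain ⟨n, hn⟩ := h'
    exact ⟨n, by linarith⟩
  choose n hn using this
  exact ⟨n, funext fun i => by simpa using hn i⟩

/-- A sum over `(ℤ/N)^d` of a periodic function is invariant under translation. -/
lemma sum_zlift_add [NeZero N] {V : Type*} [AddCommGroup V] (f : (Fin d → ℤ) → V)
    (hf : ∀ p n, f (p + (N : ℤ) • n) = f p) (s : Fin d → ℤ) :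
    ∑ j : Fin d → ZMod N, f (zlift j + s) = ∑ j : Fin d → ZMod N, f (zlift j) := by
  rw [← Equiv.sum_comp (Equiv.addRight fun i => (s i : ZMod N)) fun j : Fin d → ZMod N => f (zlift j)]
  refine Finset.sum_congr rfl fun j _ => ?_
  obtain ⟨n, hn⟩ := exists_zlift_add j s
  rw [hn, hf]
  rfl

/-- The phase depends on the integer representatives only through their residues modulo `N`, which
brings in the orthogonality of characters of `ZMod N`. -/
lemma exp_zlift_eq_prod [NeZero N] (j p : Fin d → ZMod N) :
    Complex.exp (Complex.I * ((inner ℝ ((N : ℝ)⁻¹ • (2 * Real.pi) • latticePoint (zlift j))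
      (latticePoint (zlift p)) : ℝ) : ℂ)) = ∏ i, ZMod.stdAddChar (j i * p i) := by
  have h : ∀ i, ZMod.stdAddChar (j i * p i) =
      Complex.exp (2 * Real.pi * Complex.I * (zlift j i * zlift p i : ℤ) / N) := by
    intro i
    rw [← ZMod.stdAddChar_coe]
    simp [zlift]
  simp only [h]
  rw [← Complex.exp_sum]
  congr 1
  simp only [PiLp.inner_apply, PiLp.smul_apply, latticePoint_apply, smul_eq_mul,
    RCLike.inner_apply, conj_trivial]
  push_cast
  rw [Finset.mul_sum]
  exact Finset.sum_congr rfl fun i _ => by ring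

lemma sum_exp_zlift [NeZero N] (p : Fin d → ZMod N) :
    ∑ j : Fin d → ZMod N,
      Complex.exp (Complex.I * ((inner ℝ ((N : ℝ)⁻¹ • (2 * Real.pi) • latticePoint (zlift j))
        (latticePoint (zlift p)) : ℝ) : ℂ)) = if p = 0 then (N : ℂ) ^ d else 0 := by
  simp only [exp_zlift_eq_prod]
  have h := Finset.prod_univ_sum (fun _ : Fin d => (Finset.univ : Finset (ZMod N)))
    fun i x => (ZMod.stdAddChar (x * p i) : ℂ)
  rw [Fintype.piFinset_univ] at h
  rw [← h]
  simp only [AddChar.sum_mulShift _ (ZMod.isPrimitive_stdAddChar N), ZMod.card]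
  split_ifs with hp
  · simp [hp]
  · obtain ⟨i, hi⟩ := Function.ne_iff.1 hp
    exact Finset.prod_eq_zero (Finset.mem_univ i) (by rw [if_neg (by simpa using hi), Nat.cast_zero])

end Characters

variable {d N : ℕ} {κ : Phase d}

lemma exp_I_add (s t : ℝ) : Complex.exp (Complex.I * ((s + t : ℝ) : ℂ)) =
    Complex.exp (Complex.I * (s : ℂ)) * Complex.exp (Complex.I * (t : ℂ)) := by
  rw [← Complex.exp_add]
  push_cast
  ring_nf

/-- The weight spaces span the space of torus states. -/
lemma exists_weight_decomposition [NeZero N] (x : torusStates N κ) :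
    ∃ y : (Fin d → ZMod N) → torusStates N κ,
      (∀ j, y j ∈ weightSpace N κ (zlift j)) ∧ x = ∑ j, y j := by
  have hN : 1 ≤ N := NeZero.one_le
  have hN0 : (N : ℝ) ≠ 0 := by positivity
  set θ : (Fin d → ZMod N) → Conf d :=
    fun j => (N : ℝ)⁻¹ • (mom κ + (2 * Real.pi) • latticePoint (zlift j)) with hθ
  -- The components are discrete Fourier projections: averages of the momentum translates of `x`
  -- against the conjugate character of weight `j`.
  set f : (Fin d → ZMod N) → (Fin d → ℤ) → torusStates N κ := fun j p =>
    Complex.exp (Complex.I * ((-inner ℝ (θ j) (latticePoint p) : ℝ) : ℂ)) •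
      torusTransl N κ (momVec p) x with hf
  -- The Floquet phase produced by a full period cancels the one in `θ j`, and what remains is an
  -- integer multiple of `2π`.
  have hper : ∀ j p n, f j (p + (N : ℤ) • n) = f j p := by
    intro j p n
    simp only [hf]
    rw [← torusTransl_momVec_add, torusTransl_momVec_period hN, map_smul, smul_smul]
    congr 1
    rw [← Complex.exp_add, ← mul_add, ← Complex.ofReal_add, Complex.exp_eq_exp_iff_exists_int]
    obtain ⟨k, hk⟩ : ∃ k : ℤ, inner ℝ (latticePoint (zlift j)) (latticePoint n) = (k : ℝ) := by
      refine ⟨∑ i, zlift j i * n i, ?_⟩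
      simp [PiLp.inner_apply, mul_comm]
    have hn : latticePoint ((N : ℤ) • n) = (N : ℝ) • latticePoint n := by
      ext i; simp
    refine ⟨-k, ?_⟩
    rw [latticePoint_add, hn, inner_add_right, real_inner_smul_right]
    have : (N : ℝ) * inner ℝ (θ j) (latticePoint n) =
        inner ℝ (mom κ) (latticePoint n) + 2 * Real.pi * k := by
      rw [hθ, real_inner_smul_left, inner_add_left, real_inner_smul_left, hk]
      field_simp
    rw [this]
    push_cast
    ring
  refine ⟨fun j => ((N : ℂ) ^ d)⁻¹ • ∑ p : Fin d → ZMod N, f j (zlift p), fun j s => ?_, ?_⟩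
  · rw [map_smul, smul_comm, map_sum]
    congr 1
    -- Translating the summation index by `s` over a full period leaves the average unchanged and
    -- produces the eigenvalue.
    rw [← sum_zlift_add (f j) (hper j) s, Finset.smul_sum]
    refine Finset.sum_congr rfl fun p _ => ?_
    simp only [hf]
    rw [map_smul, torusTransl_momVec_add, add_comm s, smul_smul, ← exp_I_add, latticePoint_add,
      inner_add_right]
    congr 4
    ring
  · rw [← Finset.smul_sum, Finset.sum_comm]
    -- Summing over all weights keeps only `p = 0`, by orthogonality of characters.
    have hsum : ∀ p : Fin d → ZMod N, ∑ j, f j (zlift p) =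
        if p = 0 then (N : ℂ) ^ d • x else 0 := by
      intro p
      have h1 : ∀ j, f j (zlift p) = (Complex.exp (Complex.I *
          ((inner ℝ ((N : ℝ)⁻¹ • (2 * Real.pi) • latticePoint (zlift j))
            (latticePoint (zlift (-p))) : ℝ) : ℂ)) *
          Complex.exp (Complex.I * ((-inner ℝ ((N : ℝ)⁻¹ • mom κ) (latticePoint (zlift p)) : ℝ) : ℂ)))
            • torusTransl N κ (momVec (zlift p)) x := by
        intro j
        have h2 : Complex.exp (Complex.I * ((-inner ℝ ((N : ℝ)⁻¹ • (2 * Real.pi) •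
            latticePoint (zlift j)) (latticePoint (zlift p)) : ℝ) : ℂ)) =
            Complex.exp (Complex.I * ((inner ℝ ((N : ℝ)⁻¹ • (2 * Real.pi) •
            latticePoint (zlift j)) (latticePoint (zlift (-p))) : ℝ) : ℂ)) := by
          rw [exp_zlift_eq_prod, Complex.ofReal_neg, mul_neg, Complex.exp_neg, exp_zlift_eq_prod,
            ← Finset.prod_inv_distrib]
          refine Finset.prod_congr rfl fun i _ => ?_
          rw [Pi.neg_apply, mul_neg, AddChar.map_neg_eq_inv]
        rw [← h2, ← exp_I_add]
        simp only [hf, hθ]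
        rw [smul_add, inner_add_left]
        congr 4
        ring
      simp only [h1]
      rw [← Finset.sum_smul, ← Finset.sum_mul, sum_exp_zlift]
      by_cases hp : p = 0
      · simp only [hp, neg_zero, if_true, zlift_zero]
        have h0 : latticePoint (0 : Fin d → ℤ) = 0 := by ext; simp
        have h0' : momVec (0 : Fin d → ℤ) = 0 := by
          funext i; rcases i with i | i <;> simp [momVec]
        rw [h0, h0', torusTransl_zero]
        simp
      · simp [hp]
    simp only [hsum, Finset.sum_ite_eq', Finset.mem_univ, if_true]
    rw [smul_smul, inv_mul_cancel₀ (pow_ne_zero d (by exact_mod_cast hN0)), one_smul]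

/-- A basis of weight vectors which is an orbit of the position translations. -/
lemma exists_weight_vectors [NeZero N] {x : torusStates N κ} (hx : x ≠ 0) :
    ∃ (v : (Fin d → ZMod N) → torusStates N κ) (v₀ : torusStates N κ),
      v₀ ≠ 0 ∧ (∀ j, v j ∈ weightSpace N κ (zlift j)) ∧ (∀ j, ∃ r, v j = torusTransl N κ r v₀) ∧
      ∀ y, ∃ c : (Fin d → ZMod N) → ℂ, y = ∑ j, c j • v j := by
  have hN : 1 ≤ N := NeZero.one_le
  obtain ⟨y, hy, hxy⟩ := exists_weight_decomposition x
  obtain ⟨k, hk⟩ : ∃ k, y k ≠ 0 := by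
    by_contra! h
    exact hx (by rw [hxy]; simp [h])
  -- One nonzero weight vector is moved by position translations into every weight space; as these
  -- are at most one-dimensional, its translates span.
  have hmem : ∀ j : Fin d → ZMod N, torusTransl N κ (posVec (zlift j - zlift k)) (y k) ∈
      weightSpace N κ (zlift j) := by
    intro j
    have := torusTransl_posVec_mem_weightSpace hN (hy k) (zlift j - zlift k)
    rwa [add_sub_cancel] at this
  refine ⟨fun j : Fin d → ZMod N => torusTransl N κ (posVec (zlift j - zlift k)) (y k), y k, hk, hmem,
    fun j => ⟨_, rfl⟩, fun z => ?_⟩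
  obtain ⟨w, hw, hzw⟩ := exists_weight_decomposition z
  have hne : ∀ j : Fin d → ZMod N, torusTransl N κ (posVec (zlift j - zlift k)) (y k) ≠ 0 := by
    intro j h0
    have h1 := congrArg Subtype.val h0
    rw [coe_torusTransl] at h1
    refine hk (Subtype.ext (transl_injective _ _ (h1.trans ?_)))
    simp
  choose c hc using fun j => exists_eq_smul_of_mem_weightSpace hN (hmem j) (hne j) (hw j)
  exact ⟨c, by rw [hzw]; exact Finset.sum_congr rfl fun j _ => hc j⟩

/-- A sesquilinear form which is invariant under the translations. -/
def IsInvariantForm (B : torusStates N κ →ₗ⋆[ℂ] torusStates N κ →ₗ[ℂ] ℂ) : Prop :=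
  ∀ r x y, B (torusTransl N κ r x) (torusTransl N κ r y) = B x y

/-- A momentum translation along a coordinate where `j` and `k` differ multiplies the form by a
ratio of distinct values of the injective standard character, while invariance forces the factor
`1`. -/
lemma IsInvariantForm.eq_zero [NeZero N] {B : torusStates N κ →ₗ⋆[ℂ] torusStates N κ →ₗ[ℂ] ℂ}
    (hB : IsInvariantForm B) {j k : Fin d → ZMod N} (hjk : j ≠ k) {x y : torusStates N κ}
    (hx : x ∈ weightSpace N κ (zlift j)) (hy : y ∈ weightSpace N κ (zlift k)) : B x y = 0 := by
  obtain ⟨i, hi⟩ := Function.ne_iff.1 hjk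
  set p : Fin d → ZMod N := Pi.single i 1 with hp
  have h := hB (momVec (zlift p)) x y
  rw [hx, hy, map_smul, LinearMap.map_smulₛₗ₂, smul_eq_mul, smul_eq_mul,
    ← Complex.exp_conj, map_mul, Complex.conj_I, Complex.conj_ofReal, ← mul_assoc,
    smul_add, smul_add, inner_add_left, inner_add_left, exp_I_add, exp_zlift_eq_prod,
    Complex.ofReal_add, mul_add, Complex.exp_add, neg_mul, neg_mul, Complex.exp_neg,
    Complex.exp_neg, exp_zlift_eq_prod] at h
  have h1 : ∀ m : Fin d → ZMod N, ∏ l, (ZMod.stdAddChar (m l * p l) : ℂ) =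
      ZMod.stdAddChar (m i) := by
    intro m
    rw [Finset.prod_eq_single i]
    · simp [hp]
    · intro l _ hl
      simp [hp, Pi.single_eq_of_ne hl]
    · simp
  rw [h1, h1] at h
  set E := Complex.exp (Complex.I * ((inner ℝ ((N : ℝ)⁻¹ • mom κ) (latticePoint (zlift p)) : ℝ) : ℂ))
    with hE
  have hE0 : E ≠ 0 := Complex.exp_ne_zero _
  by_contra hne
  have hj0 : (ZMod.stdAddChar (j i) : ℂ) ≠ 0 := by
    intro h0
    have := (ZMod.stdAddChar (N := N)).norm_apply (j i)
    rw [h0, norm_zero] at this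
    exact zero_ne_one this
  have h3 : (ZMod.stdAddChar (k i) : ℂ) = ZMod.stdAddChar (j i) := by
    field_simp at h
    exact h
  exact hi (ZMod.injective_stdAddChar h3).symm

/-- Invariant sesquilinear forms on the space of torus states are proportional. -/
theorem IsInvariantForm.mul_comm [NeZero N]
    {B B' : torusStates N κ →ₗ⋆[ℂ] torusStates N κ →ₗ[ℂ] ℂ}
    (hB : IsInvariantForm B) (hB' : IsInvariantForm B') :
    ∃ v : torusStates N κ, (∀ x : torusStates N κ, x ≠ 0 → v ≠ 0) ∧
      ∀ x y, B x y * B' v v = B v v * B' x y := by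
  by_cases htriv : ∀ x : torusStates N κ, x = 0
  -- The zero space contains no nonzero `v`, which is why `v ≠ 0` is asserted only in the presence
  -- of a nonzero vector.
  · exact ⟨0, fun x hx => (hx (htriv x)).elim, fun x y => by rw [htriv x]; simp⟩
  push Not at htriv
  obtain ⟨x₀, hx₀⟩ := htriv
  obtain ⟨v, v₀, hv₀, hv, hr, hspan⟩ := exists_weight_vectors hx₀
  -- In the weight basis every invariant form has a scalar Gram matrix: distinct weights are
  -- orthogonal, and the diagonal entries agree because the basis is a translation orbit.
  have hdiag : ∀ {B : torusStates N κ →ₗ⋆[ℂ] torusStates N κ →ₗ[ℂ] ℂ}, IsInvariantForm B →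
      ∀ j k, B (v j) (v k) = if j = k then B v₀ v₀ else 0 := by
    intro B hB j k
    split_ifs with h
    · obtain ⟨r, hr⟩ := hr j
      rw [← h, hr, hB]
    · exact hB.eq_zero h (hv j) (hv k)
  refine ⟨v₀, fun _ _ => hv₀, fun x y => ?_⟩
  obtain ⟨a, ha⟩ := hspan x
  obtain ⟨b, hb⟩ := hspan y
  have hexp : ∀ {B : torusStates N κ →ₗ⋆[ℂ] torusStates N κ →ₗ[ℂ] ℂ}, IsInvariantForm B →
      B x y = (∑ j, starRingEnd ℂ (a j) * b j) * B v₀ v₀ := by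
    intro B hB
    rw [ha, hb]
    simp only [map_sum, LinearMap.sum_apply, LinearMap.map_smulₛₗ₂, map_smul, hdiag hB,
      smul_eq_mul, mul_ite, mul_zero, Finset.sum_ite_eq', Finset.mem_univ,
      if_true]
    rw [Finset.sum_mul]
    exact Finset.sum_congr rfl fun j _ => by ring
  rw [hexp hB, hexp hB']
  ring

end

/-! ### Expectations of translations and of Weyl operators -/

section

/-! ### Sesquilinear forms attached to an inner product -/

section Core

variable {V : Type*} [AddCommGroup V] [Module ℂ V]

/-- The sesquilinear form `(x, y) ↦ ⟨L x, L y⟩`. -/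
def coreForm (c : InnerProductSpace.Core ℂ V) (L : V →ₗ[ℂ] V) : V →ₗ⋆[ℂ] V →ₗ[ℂ] ℂ :=
  LinearMap.mk₂'ₛₗ (starRingEnd ℂ) (RingHom.id ℂ) (fun x y => c.inner (L x) (L y))
    (fun x x' y => by rw [map_add]; exact c.add_left _ _ _)
    (fun a x y => by rw [map_smul]; exact c.smul_left _ _ _)
    (fun x y y' => by
      rw [map_add, ← c.conj_inner_symm, ← c.conj_inner_symm (L x) (L y),
        ← c.conj_inner_symm (L x) (L y'), c.add_left, map_add])
    (fun a x y => by
      rw [map_smul, ← c.conj_inner_symm, ← c.conj_inner_symm (L x) (L y), c.smul_left, map_mul]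
      simp)

@[simp] lemma coreForm_apply (c : InnerProductSpace.Core ℂ V) (L : V →ₗ[ℂ] V) (x y : V) :
    coreForm c L x y = c.inner (L x) (L y) := rfl

lemma core_inner_ne_zero (c : InnerProductSpace.Core ℂ V) {x : V} (hx : x ≠ 0) :
    c.inner x x ≠ 0 := fun h => hx (c.definite x h)

lemma core_inner_smul_smul (c : InnerProductSpace.Core ℂ V) (z : ℂ) (x y : V) :
    c.inner (z • x) (z • y) = starRingEnd ℂ z * z * c.inner x y := by
  have h : coreForm c LinearMap.id (z • x) (z • y) =
      starRingEnd ℂ z * z * coreForm c LinearMap.id x y := by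
    rw [map_smul, LinearMap.map_smulₛₗ₂, smul_eq_mul, smul_eq_mul]
    ring
  exact h

lemma core_norm_inner_le (c : InnerProductSpace.Core ℂ V) (x y : V) :
    ‖c.inner x y‖ ^ 2 ≤ ‖c.inner x x‖ * ‖c.inner y y‖ := by
  have h := InnerProductSpace.Core.inner_mul_inner_self_le (c := c.toCore) x y
  have h1 : ‖c.inner y x‖ = ‖c.inner x y‖ := by
    rw [← c.conj_inner_symm, RCLike.norm_conj]
  change ‖c.inner x y‖ * ‖c.inner y x‖ ≤ (c.inner x x).re * (c.inner y y).re at h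
  rw [h1, ← sq] at h
  refine h.trans ?_
  have hx := c.re_inner_nonneg x
  have hy := c.re_inner_nonneg y
  exact mul_le_mul (Complex.re_le_norm _) (Complex.re_le_norm _) hy (norm_nonneg _)

end Core

variable {d N : ℕ} {κ : Phase d}

lemma toReal_mulVec_ofLattice (A : Matrix.symplecticGroup (Fin d) ℤ) (r : Lattice d) :
    toReal A *ᵥ ofLattice r =
      ofLattice ((A : Matrix (Fin d ⊕ Fin d) (Fin d ⊕ Fin d) ℤ) *ᵥ r) := by
  funext i
  simp [toReal, ofLattice, Matrix.mulVec, dotProduct]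

/-- The expectations of the lattice translations in an eigenstate of the propagator are invariant
under the dynamics (exact Egorov theorem). -/
theorem inner_torusTransl_mulVec [NeZero N] (A : Matrix.symplecticGroup (Fin d) ℤ)
    {M : 𝓢'(Conf d, ℂ) →L[ℂ] 𝓢'(Conf d, ℂ)}
    (hM : ∀ (ρ : Phase d) (ψ : 𝓢'(Conf d, ℂ)),
      M (transl (planck N) ρ ψ) = transl (planck N) (toReal A *ᵥ ρ) (M ψ))
    (hmap : (torusStates N κ).map M.toLinearMap = torusStates N κ)
    {c : InnerProductSpace.Core ℂ (torusStates N κ)} (hc : IsTorusHilbertStructure c)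
    {ψ : torusStates N κ} (hψ : c.inner ψ ψ = 1) {z : ℂ}
    (hz : M (ψ : 𝓢'(Conf d, ℂ)) = z • (ψ : 𝓢'(Conf d, ℂ))) (r : Lattice d) :
    c.inner ψ (torusTransl N κ ((A : Matrix (Fin d ⊕ Fin d) (Fin d ⊕ Fin d) ℤ) *ᵥ r) ψ) =
      c.inner ψ (torusTransl N κ r ψ) := by
  set L : torusStates N κ →ₗ[ℂ] torusStates N κ := M.toLinearMap.restrict fun x hx => by
    rw [← hmap]; exact Submodule.mem_map_of_mem hx with hL
  have hLT : ∀ (r : Lattice d) x, L (torusTransl N κ r x) = torusTransl N κ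
      ((A : Matrix (Fin d ⊕ Fin d) (Fin d ⊕ Fin d) ℤ) *ᵥ r) (L x) := by
    intro r x
    apply Subtype.ext
    rw [coe_torusTransl, ← toReal_mulVec_ofLattice, ← Matrix.mulVec_smul]
    exact hM _ _
  have hLψ : L ψ = z • ψ := Subtype.ext hz
  have hB : IsInvariantForm (coreForm c LinearMap.id) := fun r x y => hc r x y
  -- `L` turns the translation by `r` into the translation by `A r`, which preserves the inner
  -- product as well.
  have hB' : IsInvariantForm (coreForm c L) := fun r x y => by
    rw [coreForm_apply, coreForm_apply, hLT, hLT, hc]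
  obtain ⟨v, hv, hprop⟩ := hB.mul_comm hB'
  have hψ0 : ψ ≠ 0 := by
    rintro rfl
    have h0 : coreForm c LinearMap.id 0 0 = 1 := hψ
    simp only [map_zero] at h0
    exact zero_ne_one h0
  have hvv : coreForm c LinearMap.id v v ≠ 0 := core_inner_ne_zero c (hv ψ hψ0)
  have hψL : coreForm c L ψ ψ = starRingEnd ℂ z * z := by
    rw [coreForm_apply, hLψ, core_inner_smul_smul, hψ, mul_one]
  have hψI : coreForm c LinearMap.id ψ ψ = 1 := hψ
  have h1 := hprop ψ ψ
  rw [hψL, hψI, one_mul] at h1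
  -- Evaluation at the eigenstate identifies the proportionality constant as `|z|²`.
  have h2 : ∀ x y, coreForm c L x y = starRingEnd ℂ z * z * coreForm c LinearMap.id x y := by
    intro x y
    have h := hprop x y
    rw [h1] at h
    refine mul_left_cancel₀ hvv ?_
    rw [← h]
    ring
  -- If `z = 0` the form of `L` vanishes identically, although `ψ` lies in the range of `L` and has
  -- norm one.
  have hz0 : z ≠ 0 := by
    rintro rfl
    have hmem : (ψ : 𝓢'(Conf d, ℂ)) ∈ (torusStates N κ).map M.toLinearMap := by
      rw [hmap]; exact ψ.2
    obtain ⟨φ, hφ, hφψ⟩ := hmem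
    have hLφ : L ⟨φ, hφ⟩ = ψ := Subtype.ext hφψ
    have h3 := h2 ⟨φ, hφ⟩ ⟨φ, hφ⟩
    rw [coreForm_apply, hLφ, hψ, mul_zero, zero_mul] at h3
    exact one_ne_zero h3
  have hzz : starRingEnd ℂ z * z ≠ 0 := mul_ne_zero (by simpa using hz0) hz0
  refine mul_left_cancel₀ hzz ?_
  have h4 := h2 ψ (torusTransl N κ r ψ)
  rw [coreForm_apply, hLT, hLψ, map_smul, core_inner_smul_smul] at h4
  exact h4

/-- In the topology of pointwise convergence the relevant sets are finite, hence bounded. Continuity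
of scalar multiplication lets convergent scalar coordinates be reassembled into the series defining
`opWeyl`. -/
lemma continuousSMul_temperedDistribution : ContinuousSMul ℂ 𝓢'(Conf d, ℂ) :=
  UniformConvergenceCLM.continuousSMul _ _ _ fun _ (hS : Set.Finite _) => hS.isVonNBounded

/-- The expectation of a Weyl operator is the sum of the expectations of the translations. -/
theorem hasSum_inner_opWeyl [NeZero N] {c : InnerProductSpace.Core ℂ (torusStates N κ)}
    (hc : IsTorusHilbertStructure c) (ψ : torusStates N κ) {b : Phase d → ℂ}
    (hb : Summable fun r => ‖torusCoeff b r‖) :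
    HasSum (fun r => torusCoeff b r * c.inner ψ (torusTransl N κ r ψ))
      (c.inner ψ (opWeyl N κ b ψ)) := by
  have := continuousSMul_temperedDistribution (d := d)
  by_cases hψ0 : ψ = 0
  · have h1 : opWeyl N κ b ψ = 0 := by simp [opWeyl, hψ0]
    have h2 : ∀ y, c.inner 0 y = 0 := fun y => by
      have : coreForm c LinearMap.id 0 y = 0 := by simp
      exact this
    rw [h1, hψ0]
    simp only [h2, mul_zero]
    exact hasSum_zero
  obtain ⟨v, v₀, hv₀, hv, hr, hspan⟩ := exists_weight_vectors hψ0
  set B := coreForm c LinearMap.id with hBdef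
  have hB : IsInvariantForm B := fun r x y => hc r x y
  have hvv : ∀ j, B (v j) (v j) ≠ 0 := by
    intro j
    obtain ⟨r, hr⟩ := hr j
    rw [hr, hB]
    exact core_inner_ne_zero c hv₀
  -- The Weyl series converges in the topology of tempered distributions, while `c` is an abstract
  -- inner product. Coordinates in the finite orthogonal weight basis connect the two without a
  -- continuity assumption on `c`.
  have hcoord : ∀ y, y = ∑ j, (B (v j) y / B (v j) (v j)) • v j := by
    intro y
    obtain ⟨a, ha⟩ := hspan y
    have : ∀ j, B (v j) y = a j * B (v j) (v j) := by
      intro j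
      conv_lhs => rw [ha]
      rw [map_sum, Finset.sum_eq_single j]
      · rw [map_smul, smul_eq_mul]
      · intro k _ hk
        rw [map_smul, hB.eq_zero (Ne.symm hk) (hv j) (hv k), smul_zero]
      · simp
    conv_lhs => rw [ha]
    refine Finset.sum_congr rfl fun j _ => ?_
    rw [this, mul_div_cancel_right₀ _ (hvv j)]
  have hbound : ∀ (x : torusStates N κ) r,
      ‖B x (torusTransl N κ r ψ)‖ ≤ √(‖c.inner x x‖ * ‖c.inner ψ ψ‖) := by
    intro x r
    refine Real.le_sqrt_of_sq_le ?_
    have := core_norm_inner_le c x (torusTransl N κ r ψ)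
    rwa [hc r ψ ψ] at this
  have hsum : ∀ x, Summable fun r => torusCoeff b r * B x (torusTransl N κ r ψ) := by
    intro x
    refine Summable.of_norm ((hb.mul_right (√(‖c.inner x x‖ * ‖c.inner ψ ψ‖))).of_nonneg_of_le
      (fun _ => norm_nonneg _) fun r => ?_)
    rw [norm_mul]
    gcongr
    exact hbound x r
  have hvec : HasSum (fun r => torusCoeff b r • torusTransl N κ r ψ)
      (∑ j, ((∑' r, torusCoeff b r * B (v j) (torusTransl N κ r ψ)) / B (v j) (v j)) • v j) := by
    have := hasSum_sum (s := Finset.univ) (f := fun j r =>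
      ((torusCoeff b r * B (v j) (torusTransl N κ r ψ)) / B (v j) (v j)) • v j)
      fun j _ => (((hsum (v j)).hasSum).div_const (B (v j) (v j))).smul_const (v j)
    refine this.congr_fun fun r => ?_
    conv_lhs => rw [hcoord (torusTransl N κ r ψ)]
    rw [Finset.smul_sum]
    refine Finset.sum_congr rfl fun j _ => ?_
    rw [smul_smul, mul_div_assoc]
  have hop : opWeyl N κ b ψ =
      ∑ j, ((∑' r, torusCoeff b r * B (v j) (torusTransl N κ r ψ)) / B (v j) (v j)) • v j :=
    hvec.tsum_eq
  have hfin := hasSum_sum (s := Finset.univ) (f := fun j r =>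
      ((torusCoeff b r * B (v j) (torusTransl N κ r ψ)) / B (v j) (v j)) * B ψ (v j))
      fun j _ => (((hsum (v j)).hasSum).div_const (B (v j) (v j))).mul_right (B ψ (v j))
  change HasSum (fun r => torusCoeff b r * B ψ (torusTransl N κ r ψ)) (B ψ (opWeyl N κ b ψ))
  rw [hop, map_sum]
  simp only [map_smul, smul_eq_mul]
  refine hfin.congr_fun fun r => ?_
  conv_lhs => rw [hcoord (torusTransl N κ r ψ)]
  rw [map_sum, Finset.mul_sum]
  refine Finset.sum_congr rfl fun j _ => ?_
  rw [map_smul, smul_eq_mul]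
  ring

lemma norm_inner_torusTransl_le {c : InnerProductSpace.Core ℂ (torusStates N κ)}
    (hc : IsTorusHilbertStructure c) {ψ : torusStates N κ} (hψ : c.inner ψ ψ = 1) (r : Lattice d) :
    ‖c.inner ψ (torusTransl N κ r ψ)‖ ≤ 1 := by
  have := core_norm_inner_le c ψ (torusTransl N κ r ψ)
  rw [hc r ψ ψ, hψ, norm_one, mul_one] at this
  exact (sq_le_one_iff₀ (norm_nonneg _)).1 this

end

/-! ### Gaussian integrals on the phase space -/

section

variable {d : ℕ}

/-- The phase `e^{2iπt}`. -/
def unitPhase (t : ℝ) : ℂ := Complex.exp (((2 * Real.pi * t : ℝ) : ℂ) * Complex.I)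

@[simp] lemma norm_unitPhase (t : ℝ) : ‖unitPhase t‖ = 1 := Complex.norm_exp_ofReal_mul_I _

lemma unitPhase_add (s t : ℝ) : unitPhase (s + t) = unitPhase s * unitPhase t := by
  rw [unitPhase, unitPhase, unitPhase, ← Complex.exp_add]
  push_cast
  ring_nf

@[fun_prop] lemma continuous_unitPhase : Continuous unitPhase := by
  unfold unitPhase
  fun_prop

lemma torusChar_eq_unitPhase (r : Lattice d) (ρ : Phase d) :
    torusChar r ρ = unitPhase (sympl (ofLattice r) ρ) := torusChar_eq r ρ

/-- The quadratic form `‖B ρ‖²`. -/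
def sqNorm (B : Matrix (Fin d ⊕ Fin d) (Fin d ⊕ Fin d) ℝ) (ρ : Phase d) : ℝ :=
  ∑ i, ((B *ᵥ ρ) i) ^ 2

lemma sqNorm_nonneg (B : Matrix (Fin d ⊕ Fin d) (Fin d ⊕ Fin d) ℝ) (ρ : Phase d) :
    0 ≤ sqNorm B ρ := Finset.sum_nonneg fun _ _ => sq_nonneg _

lemma sqNorm_mulVec (B C : Matrix (Fin d ⊕ Fin d) (Fin d ⊕ Fin d) ℝ) (ρ : Phase d) :
    sqNorm B (C *ᵥ ρ) = sqNorm (B * C) ρ := by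
  simp only [sqNorm, Matrix.mulVec_mulVec]

lemma sqNorm_neg (B : Matrix (Fin d ⊕ Fin d) (Fin d ⊕ Fin d) ℝ) (ρ : Phase d) :
    sqNorm B (-ρ) = sqNorm B ρ := by
  simp [sqNorm, Matrix.mulVec_neg]

lemma sqNorm_neg_matrix (B : Matrix (Fin d ⊕ Fin d) (Fin d ⊕ Fin d) ℝ) (ρ : Phase d) :
    sqNorm (-B) ρ = sqNorm B ρ := by
  simp [sqNorm, Matrix.neg_mulVec]

lemma sqNorm_smul (B : Matrix (Fin d ⊕ Fin d) (Fin d ⊕ Fin d) ℝ) (c : ℝ) (ρ : Phase d) :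
    sqNorm B (c • ρ) = c ^ 2 * sqNorm B ρ := by
  simp only [sqNorm, Matrix.mulVec_smul, Pi.smul_apply, smul_eq_mul, mul_pow, Finset.mul_sum]

/-- Recentring at the midpoint separates the product of two translated Gaussians into a Gaussian in
`ρ` and one in the displacement `τ`. -/
lemma sqNorm_parallelogram (B : Matrix (Fin d ⊕ Fin d) (Fin d ⊕ Fin d) ℝ) (ρ τ : Phase d) :
    sqNorm B (ρ - (1 / 2 : ℝ) • τ) + sqNorm B (τ + (ρ - (1 / 2 : ℝ) • τ)) =
      2 * sqNorm B ρ + sqNorm B τ / 2 := by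
  simp only [sqNorm, Matrix.mulVec_add, Matrix.mulVec_sub, Matrix.mulVec_smul, Pi.add_apply,
    Pi.sub_apply, Pi.smul_apply, smul_eq_mul]
  rw [← Finset.sum_add_distrib, Finset.mul_sum, Finset.sum_div, ← Finset.sum_add_distrib]
  exact Finset.sum_congr rfl fun i _ => by ring

@[fun_prop] lemma continuous_sqNorm (B : Matrix (Fin d ⊕ Fin d) (Fin d ⊕ Fin d) ℝ) :
    Continuous (sqNorm B) := by
  unfold sqNorm
  refine continuous_finsetSum _ fun i _ => Continuous.pow ?_ 2
  exact (continuous_apply i).comp (Continuous.matrix_mulVec continuous_const continuous_id)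

@[fun_prop] lemma continuous_sympl {X : Type*} [TopologicalSpace X] {f g : X → Phase d}
    (hf : Continuous f) (hg : Continuous g) : Continuous fun x => sympl (f x) (g x) := by
  unfold sympl
  exact hf.dotProduct (Continuous.matrix_mulVec continuous_const hg)

lemma sympl_add_right (ρ τ υ : Phase d) : sympl ρ (τ + υ) = sympl ρ τ + sympl ρ υ := by
  simp [sympl, Matrix.mulVec_add]

lemma sympl_add_left (ρ τ υ : Phase d) : sympl (ρ + τ) υ = sympl ρ υ + sympl τ υ := by
  simp [sympl]

lemma sympl_neg_right (ρ τ : Phase d) : sympl ρ (-τ) = -sympl ρ τ := by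
  simp [sympl, Matrix.mulVec_neg]

lemma sympl_self (ρ : Phase d) : sympl ρ ρ = 0 := by
  have := sympl_swap ρ ρ
  linarith

lemma sympl_sub_right (ρ τ υ : Phase d) : sympl ρ (τ - υ) = sympl ρ τ - sympl ρ υ := by
  rw [sub_eq_add_neg, sympl_add_right, sympl_neg_right, sub_eq_add_neg]

variable {B : Matrix (Fin d ⊕ Fin d) (Fin d ⊕ Fin d) ℝ}

lemma gaussian_eq (c : ℝ) (ζ u : Phase d) :
    ((Real.exp (-(Real.pi * c * ∑ i, u i ^ 2)) : ℝ) : ℂ) * unitPhase (ζ ⬝ᵥ u) =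
      Complex.exp (-((Real.pi * c : ℝ) : ℂ) * ∑ i, (u i : ℂ) ^ 2 +
        ∑ i, (2 * Real.pi * Complex.I * ζ i) * u i) := by
  rw [unitPhase, Complex.ofReal_exp, ← Complex.exp_add, dotProduct]
  congr 1
  push_cast
  rw [Finset.mul_sum Finset.univ (fun i => (ζ i : ℂ) * u i), Finset.sum_mul]
  congr 1
  · ring
  · exact Finset.sum_congr rfl fun i _ => by ring

lemma integrable_comp_mulVec (hB : B.det ≠ 0) {F : Type*} [NormedAddCommGroup F]
    {f : Phase d → F} (hf : Integrable f) : Integrable fun ρ => f (B *ᵥ ρ) := by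
  have hmap := Real.map_matrix_volume_pi_eq_smul_volume_pi hB
  have hm : Measurable (Matrix.toLin' B) := (LinearMap.continuous_of_finiteDimensional _).measurable
  have h : Integrable f (Measure.map (Matrix.toLin' B) volume) := by
    rw [hmap]
    exact hf.smul_measure ENNReal.ofReal_ne_top
  exact h.comp_measurable hm

lemma integral_comp_mulVec (hB : B.det ≠ 0) {f : Phase d → ℂ} (hf : Continuous f) :
    ∫ ρ, f (B *ᵥ ρ) = ((|B.det|⁻¹ : ℝ) : ℂ) * ∫ u, f u := by
  have hmap := Real.map_matrix_volume_pi_eq_smul_volume_pi hB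
  have hm : Measurable (Matrix.toLin' B) := (LinearMap.continuous_of_finiteDimensional _).measurable
  have h := integral_map (μ := (volume : Measure (Phase d))) hm.aemeasurable
    (f := f) hf.aestronglyMeasurable
  rw [hmap, integral_smul_measure, ENNReal.toReal_ofReal (abs_nonneg _), abs_inv] at h
  exact h.symm

/-- The Fourier transform of a Gaussian. -/
lemma integral_gaussian_unitPhase (hB : B.det ≠ 0) {c : ℝ} (hc : 0 < c) (η : Phase d) :
    ∫ ρ, ((Real.exp (-(Real.pi * c * sqNorm B ρ)) : ℝ) : ℂ) * unitPhase (η ⬝ᵥ ρ) =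
      (((c ^ d)⁻¹ * |B.det|⁻¹ * Real.exp (-(Real.pi / c * sqNorm (B⁻¹)ᵀ η)) : ℝ) : ℂ) := by
  have hu : IsUnit B.det := isUnit_iff_ne_zero.2 hB
  set ζ : Phase d := (B⁻¹)ᵀ *ᵥ η with hζ
  have hζB : ∀ ρ, η ⬝ᵥ ρ = ζ ⬝ᵥ (B *ᵥ ρ) := by
    intro ρ
    rw [hζ, Matrix.mulVec_transpose, ← Matrix.dotProduct_mulVec, Matrix.mulVec_mulVec,
      Matrix.nonsing_inv_mul _ hu, Matrix.one_mulVec]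
  have hcont : Continuous fun u : Phase d => ((Real.exp (-(Real.pi * c * ∑ i, u i ^ 2)) : ℝ) : ℂ) *
      unitPhase (ζ ⬝ᵥ u) := by
    have : Continuous fun u : Phase d => ζ ⬝ᵥ u := Continuous.dotProduct continuous_const continuous_id
    fun_prop
  have h1 : ∫ ρ, ((Real.exp (-(Real.pi * c * sqNorm B ρ)) : ℝ) : ℂ) * unitPhase (η ⬝ᵥ ρ) =
      ((|B.det|⁻¹ : ℝ) : ℂ) * ∫ u : Phase d,
        ((Real.exp (-(Real.pi * c * ∑ i, u i ^ 2)) : ℝ) : ℂ) * unitPhase (ζ ⬝ᵥ u) := by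
    rw [← integral_comp_mulVec hB hcont]
    simp only [hζB, sqNorm]
  rw [h1]
  simp only [gaussian_eq]
  have hre : 0 < (((Real.pi * c : ℝ) : ℂ)).re := by
    rw [Complex.ofReal_re]
    positivity
  rw [GaussianFourier.integral_cexp_neg_mul_sum_add hre]
  have hπ : (Real.pi : ℂ) ≠ 0 := by exact_mod_cast Real.pi_ne_zero
  have hc' : (c : ℂ) ≠ 0 := by exact_mod_cast hc.ne'
  have hcard : ((Fintype.card (Fin d ⊕ Fin d) : ℕ) : ℂ) / 2 = (d : ℂ) := by
    simp only [Fintype.card_sum, Fintype.card_fin]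
    push_cast
    ring
  have hexp : (∑ i, (2 * Real.pi * Complex.I * (ζ i : ℂ)) ^ 2) / (4 * ((Real.pi * c : ℝ) : ℂ)) =
      ((-(Real.pi / c * sqNorm (B⁻¹)ᵀ η) : ℝ) : ℂ) := by
    rw [sqNorm]
    push_cast
    rw [← hζ]
    have : ∀ i, (2 * Real.pi * Complex.I * (ζ i : ℂ)) ^ 2 = -(4 * Real.pi ^ 2) * (ζ i : ℂ) ^ 2 := by
      intro i
      rw [mul_pow, mul_pow, Complex.I_sq]
      ring
    simp only [this]
    rw [← Finset.mul_sum]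
    field_simp
  rw [hexp, hcard, Complex.cpow_natCast]
  push_cast
  have : (Real.pi : ℂ) / (Real.pi * c) = (c : ℂ)⁻¹ := by field_simp
  rw [this, inv_pow]
  ring

lemma integrable_gaussian (hB : B.det ≠ 0) :
    Integrable fun ρ => ((Real.exp (-(Real.pi * sqNorm B ρ)) : ℝ) : ℂ) := by
  have h := GaussianFourier.integrable_cexp_neg_mul_sum_add (ι := Fin d ⊕ Fin d)
    (b := ((Real.pi : ℝ) : ℂ)) (by rw [Complex.ofReal_re]; exact Real.pi_pos) 0
  refine (integrable_comp_mulVec hB h).congr (.of_forall fun ρ => ?_)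
  simp [sqNorm]

end

/-! ### The Moyal square of a Gaussian -/

section

variable {d : ℕ} {B : Matrix (Fin d ⊕ Fin d) (Fin d ⊕ Fin d) ℝ}

/-- The matrix of the symplectic dual of the quadratic form `‖B ρ‖²`. -/
def dualMatrix (B : Matrix (Fin d ⊕ Fin d) (Fin d ⊕ Fin d) ℝ) :
    Matrix (Fin d ⊕ Fin d) (Fin d ⊕ Fin d) ℝ := (B⁻¹)ᵀ * Matrix.J (Fin d) ℝ

lemma abs_det_J : |(Matrix.J (Fin d) ℝ).det| = 1 := by
  have h := Matrix.J_det_mul_J_det (Fin d) ℝ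
  rcases mul_self_eq_one_iff.1 h with h | h <;> simp [h]

lemma abs_det_dualMatrix (B : Matrix (Fin d ⊕ Fin d) (Fin d ⊕ Fin d) ℝ) :
    |(dualMatrix B).det| = |B.det|⁻¹ := by
  rw [dualMatrix, Matrix.det_mul, abs_mul, abs_det_J, mul_one, Matrix.det_transpose,
    Matrix.det_nonsing_inv, Ring.inverse_eq_inv', abs_inv]

lemma det_dualMatrix_ne_zero (hB : B.det ≠ 0) : (dualMatrix B).det ≠ 0 := by
  rw [← abs_ne_zero, abs_det_dualMatrix]
  exact inv_ne_zero (abs_ne_zero.2 hB)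

/-- Because `J² = -1`, the symplectic dual is an involution up to sign, which the quadratic form
does not see. This brings `B` itself back after two Gaussian integrations. -/
lemma dualMatrix_dualMatrix (hB : B.det ≠ 0) : dualMatrix (dualMatrix B) = -B := by
  have hu : IsUnit B.det := isUnit_iff_ne_zero.2 hB
  have h : (dualMatrix B)⁻¹ = -Matrix.J (Fin d) ℝ * Bᵀ := by
    refine Matrix.inv_eq_right_inv ?_
    rw [dualMatrix, Matrix.mul_assoc, ← Matrix.mul_assoc (Matrix.J (Fin d) ℝ), Matrix.mul_neg,
      Matrix.J_squared, neg_neg, Matrix.one_mul, ← Matrix.transpose_mul, Matrix.mul_nonsing_inv _ hu,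
      Matrix.transpose_one]
  rw [dualMatrix, h, Matrix.transpose_mul, Matrix.transpose_transpose, Matrix.transpose_neg,
    Matrix.J_transpose, neg_neg, Matrix.mul_assoc, Matrix.J_squared, Matrix.mul_neg, Matrix.mul_one]

/-- The Fourier transform of a Gaussian, in terms of the symplectic form. -/
lemma integral_gaussian_sympl (hB : B.det ≠ 0) {c : ℝ} (hc : 0 < c) (τ : Phase d) :
    ∫ ρ, ((Real.exp (-(Real.pi * c * sqNorm B ρ)) : ℝ) : ℂ) * unitPhase (sympl ρ τ) =
      (((c ^ d)⁻¹ * |B.det|⁻¹ * Real.exp (-(Real.pi / c * sqNorm (dualMatrix B) τ)) : ℝ) : ℂ) := by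
  have h := integral_gaussian_unitPhase hB hc (Matrix.J (Fin d) ℝ *ᵥ τ)
  rw [sqNorm_mulVec] at h
  rw [dualMatrix, ← h]
  refine integral_congr_ae (.of_forall fun ρ => ?_)
  simp only [sympl, dotProduct_comm]

lemma integral_gaussian_sympl_one (hB : B.det ≠ 0) (τ : Phase d) :
    ∫ ρ, ((Real.exp (-(Real.pi * sqNorm B ρ)) : ℝ) : ℂ) * unitPhase (sympl ρ τ) =
      ((|B.det|⁻¹ * Real.exp (-(Real.pi * sqNorm (dualMatrix B) τ)) : ℝ) : ℂ) := by
  have h := integral_gaussian_sympl hB one_pos τ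
  simpa only [mul_one, one_pow, inv_one, one_mul, div_one] using h

/-- The Moyal square of a Gaussian as a single integral. -/
lemma moyal_gaussian_eq (hB : B.det ≠ 0) {ħ : ℝ} (hħ : 0 < ħ) {C : ℝ} {G : Phase d → ℂ}
    (hG : ∀ ρ, G ρ = ((C * Real.exp (-(Real.pi * sqNorm B ρ)) : ℝ) : ℂ)) (ρ : Phase d) :
    moyal ħ G G ρ = ((((Real.pi * ħ) ^ (2 * d))⁻¹ * C ^ 2 * |B.det|⁻¹ : ℝ) : ℂ) *
      ∫ w : Phase d, unitPhase (sympl ρ w / (Real.pi * ħ)) *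
        ((Real.exp (-(Real.pi * sqNorm (dualMatrix B) ((Real.pi * ħ)⁻¹ • w))) *
          Real.exp (-(Real.pi * sqNorm B (ρ + w))) : ℝ) : ℂ) := by
  have hπ : Real.pi ≠ 0 := Real.pi_ne_zero
  set g : Phase d → ℂ := fun ρ => ((Real.exp (-(Real.pi * sqNorm B ρ)) : ℝ) : ℂ) with hg
  have hgi : Integrable g := integrable_gaussian hB
  have hGg : ∀ ρ, G ρ = (C : ℂ) * g ρ := fun ρ => by rw [hG, hg]; push_cast; rfl
  have hph : ∀ w : Phase d × Phase d, Complex.exp (-(2 * Complex.I / ħ) * (sympl w.1 w.2 : ℂ)) =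
      unitPhase (-sympl w.1 w.2 / (Real.pi * ħ)) := by
    intro w
    rw [unitPhase]
    congr 1
    have : 2 * Real.pi * (-sympl w.1 w.2 / (Real.pi * ħ)) = -(2 * sympl w.1 w.2 / ħ) := by
      field_simp
    rw [this]
    push_cast
    ring
  have hint : Integrable (fun w : Phase d × Phase d =>
      unitPhase (-sympl w.1 w.2 / (Real.pi * ħ)) * (g (ρ + w.1) * g (ρ + w.2)))
      (volume.prod volume) := by
    refine (((hgi.comp_add_left ρ).mul_prod (hgi.comp_add_left ρ)).norm).mono' ?_
      (.of_forall fun w => by simp)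
    have : Continuous fun w : Phase d × Phase d =>
        unitPhase (-sympl w.1 w.2 / (Real.pi * ħ)) * (g (ρ + w.1) * g (ρ + w.2)) := by
      simp only [hg]
      have h1 : Continuous fun w : Phase d × Phase d => sympl w.1 w.2 :=
        continuous_sympl continuous_fst continuous_snd
      have h2 := continuous_sqNorm B
      fun_prop
    exact this.aestronglyMeasurable
  -- For fixed `w` the integral over `w₁` is the symplectic Fourier transform of a translated
  -- Gaussian at `-(πħ)⁻¹ w`.
  have hinner : ∀ w : Phase d, ∫ w₁ : Phase d,
      unitPhase (-sympl w₁ w / (Real.pi * ħ)) * (g (ρ + w₁) * g (ρ + w)) =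
      ((|B.det|⁻¹ : ℝ) : ℂ) * (unitPhase (sympl ρ w / (Real.pi * ħ)) *
        ((Real.exp (-(Real.pi * sqNorm (dualMatrix B) ((Real.pi * ħ)⁻¹ • w))) *
          Real.exp (-(Real.pi * sqNorm B (ρ + w))) : ℝ) : ℂ)) := by
    intro w
    have h1 := integral_gaussian_sympl_one hB (-((Real.pi * ħ)⁻¹ • w))
    rw [sqNorm_neg] at h1
    have h2 : ∫ w₁ : Phase d, unitPhase (-sympl w₁ w / (Real.pi * ħ)) * (g (ρ + w₁) * g (ρ + w)) =
        ∫ u : Phase d, (unitPhase (sympl ρ w / (Real.pi * ħ)) * g (ρ + w)) *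
          (g u * unitPhase (sympl u (-((Real.pi * ħ)⁻¹ • w)))) := by
      conv_rhs => rw [← integral_add_left_eq_self _ ρ]
      refine integral_congr_ae (.of_forall fun w₁ => ?_)
      simp only
      have : unitPhase (-sympl w₁ w / (Real.pi * ħ)) = unitPhase (sympl ρ w / (Real.pi * ħ)) *
          unitPhase (sympl (ρ + w₁) (-((Real.pi * ħ)⁻¹ • w))) := by
        rw [← unitPhase_add, sympl_neg_right, sympl_smul_right, sympl_add_left]
        congr 1
        field_simp
        ring
      rw [this]
      ring
    rw [h2, integral_const_mul, h1]
    simp only [hg]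
    push_cast
    ring
  rw [moyal]
  simp only [hph, hGg]
  have hre : ∀ w : Phase d × Phase d, unitPhase (-sympl w.1 w.2 / (Real.pi * ħ)) *
      ((C : ℂ) * g (ρ + w.1)) * ((C : ℂ) * g (ρ + w.2)) = (C : ℂ) ^ 2 *
      (unitPhase (-sympl w.1 w.2 / (Real.pi * ħ)) * (g (ρ + w.1) * g (ρ + w.2))) :=
    fun w => by ring
  simp only [hre]
  rw [integral_const_mul, Measure.volume_eq_prod, integral_prod_symm _ hint]
  simp only [hinner]
  rw [integral_const_mul]
  push_cast
  ring

/-- The Moyal square of a Gaussian is integrable, and its symplectic Fourier transform is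
a Gaussian. -/
theorem integrable_moyal_gaussian_and_integral (hB : B.det ≠ 0) {ħ : ℝ} (hħ : 0 < ħ) {C : ℝ}
    (hC : C ^ 2 = 2 ^ d * |B.det|) {G : Phase d → ℂ}
    (hG : ∀ ρ, G ρ = ((C * Real.exp (-(Real.pi * sqNorm B ρ)) : ℝ) : ℂ)) :
    Integrable (moyal ħ G G) ∧ ∀ r : Lattice d, ∫ v, torusChar r (-v) * moyal ħ G G v =
      ((Real.exp (-(Real.pi / 2 * (sqNorm (dualMatrix B) (ofLattice r) +
        (Real.pi * ħ) ^ 2 * sqNorm B (ofLattice r)))) : ℝ) : ℂ) := by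
  have hπ : Real.pi ≠ 0 := Real.pi_ne_zero
  have hdet : |B.det| ≠ 0 := abs_ne_zero.2 hB
  set E := dualMatrix B with hE
  have hEdet : E.det ≠ 0 := det_dualMatrix_ne_zero hB
  have hE2 : ∀ τ, sqNorm (dualMatrix E) τ = sqNorm B τ := fun τ => by
    rw [hE, dualMatrix_dualMatrix hB, sqNorm_neg_matrix]
  have hEabs : |E.det|⁻¹ = |B.det| := by rw [hE, abs_det_dualMatrix, inv_inv]
  set h : ℝ := Real.pi * ħ with hh
  have hh0 : 0 < h := by positivity
  set g : Phase d → ℂ := fun ρ => ((Real.exp (-(Real.pi * sqNorm B ρ)) : ℝ) : ℂ) with hg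
  set k : Phase d → ℂ := fun w => ((Real.exp (-(Real.pi * sqNorm E (h⁻¹ • w))) : ℝ) : ℂ) with hk
  have hgi : Integrable g := integrable_gaussian hB
  have hki : Integrable k := (integrable_gaussian hEdet).comp_smul (inv_ne_zero hh0.ne')
  have hgc : Continuous g := by simp only [hg]; fun_prop
  have hkc : Continuous k := by
    simp only [hk]
    have := continuous_sqNorm E
    fun_prop
  set κ : ℝ := (h ^ (2 * d))⁻¹ * C ^ 2 * |B.det|⁻¹ with hκ
  have hK : ∀ v, moyal ħ G G v = (κ : ℂ) * ∫ w, unitPhase (sympl v w / h) * (k w * g (v + w)) := by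
    intro v
    rw [moyal_gaussian_eq hB hħ hG]
    congr 2
    funext w
    simp only [hk, hg]
    push_cast
    rfl
  -- A shear preserves the product measure and turns `k ⊗ g` into this integrand, so every
  -- unimodular multiple of it needed for Fubini is integrable.
  have hbase : Integrable (fun z : Phase d × Phase d => k z.1 * g (z.2 + z.1))
      (volume.prod volume) := by
    have h1 := (measurePreserving_prod_add (volume : Measure (Phase d))
      (volume : Measure (Phase d))).integrable_comp_of_integrable (hki.mul_prod hgi)
    refine h1.congr (.of_forall fun z => ?_)
    simp only [Function.comp, add_comm z.1 z.2]
  have hint : ∀ f : Phase d × Phase d → ℝ, Continuous f → Integrable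
      (fun z : Phase d × Phase d => unitPhase (f z) * (k z.1 * g (z.2 + z.1)))
      (volume.prod volume) := by
    intro f hf
    refine hbase.norm.mono' ?_ (.of_forall fun z => by simp)
    have : Continuous fun z : Phase d × Phase d => unitPhase (f z) * (k z.1 * g (z.2 + z.1)) := by
      fun_prop
    exact this.aestronglyMeasurable
  refine ⟨?_, fun r => ?_⟩
  · have h1 := (hint (fun z => sympl z.2 z.1 / h)
      ((continuous_sympl continuous_snd continuous_fst).div_const _)).integral_prod_right
    refine (h1.const_mul (κ : ℂ)).congr (.of_forall fun v => ?_)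
    exact (hK v).symm
  · set R := ofLattice r with hR
    have h1 : ∫ v, torusChar r (-v) * moyal ħ G G v = (κ : ℂ) * ∫ v, ∫ w,
        unitPhase (-sympl R v + sympl v w / h) * (k w * g (v + w)) := by
      rw [← integral_const_mul]
      refine integral_congr_ae (.of_forall fun v => ?_)
      simp only
      rw [hK, torusChar_eq_unitPhase, sympl_neg_right, ← hR, mul_left_comm, ← integral_const_mul]
      congr 2
      funext w
      rw [unitPhase_add]
      ring
    have h2 := integral_integral_swap (f := fun w v : Phase d =>
      unitPhase (-sympl R v + sympl v w / h) * (k w * g (v + w)))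
      (hint (fun z => -sympl R z.2 + sympl z.2 z.1 / h)
        ((continuous_sympl continuous_const continuous_snd).neg.add
          ((continuous_sympl continuous_snd continuous_fst).div_const _)))
    -- With `v` integrated first, the phases combine into one symplectic character in `v + w`,
    -- leaving a Fourier transform of `g`.
    have h3 : ∀ w, ∫ v, unitPhase (-sympl R v + sympl v w / h) * (k w * g (v + w)) =
        ((|B.det|⁻¹ : ℝ) : ℂ) * (unitPhase (sympl R w) * (k w *
          ((Real.exp (-(Real.pi * sqNorm E (R + h⁻¹ • w))) : ℝ) : ℂ))) := by
      intro w
      have e1 := integral_gaussian_sympl_one hB (R + h⁻¹ • w)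
      have e2 : ∫ v, unitPhase (-sympl R v + sympl v w / h) * (k w * g (v + w)) =
          ∫ u, (unitPhase (sympl R w) * k w) * (g u * unitPhase (sympl u (R + h⁻¹ • w))) := by
        conv_rhs => rw [← integral_add_right_eq_self _ w]
        refine integral_congr_ae (.of_forall fun v => ?_)
        simp only
        have : unitPhase (-sympl R v + sympl v w / h) = unitPhase (sympl R w) *
            unitPhase (sympl (v + w) (R + h⁻¹ • w)) := by
          rw [← unitPhase_add, sympl_add_right, sympl_smul_right, sympl_add_left, sympl_add_left,
            sympl_self, sympl_swap R v, sympl_swap R w]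
          congr 1
          ring
        rw [this]
        ring
      rw [e2, integral_const_mul, e1]
      push_cast
      ring
    set Ψ : Phase d → ℂ := fun u => unitPhase (h * sympl R u) *
      ((Real.exp (-(Real.pi * sqNorm E u)) * Real.exp (-(Real.pi * sqNorm E (R + u))) : ℝ) : ℂ)
      with hΨ
    have h4 : ∫ w, unitPhase (sympl R w) * (k w *
          ((Real.exp (-(Real.pi * sqNorm E (R + h⁻¹ • w))) : ℝ) : ℂ)) =
        ((h ^ (2 * d) : ℝ) : ℂ) * ∫ u, Ψ u := by
      have e1 := Measure.integral_comp_smul_of_nonneg (volume : Measure (Phase d)) Ψ h⁻¹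
        (hR := (inv_pos.2 hh0).le)
      have hdim : Module.finrank ℝ (Phase d) = 2 * d := by
        simp [two_mul]
      rw [hdim, inv_pow, inv_inv, Complex.real_smul] at e1
      rw [← e1]
      refine integral_congr_ae (.of_forall fun w => ?_)
      simp only [hΨ, hk, sympl_smul_right]
      rw [mul_inv_cancel_left₀ hh0.ne']
      push_cast
      ring
    -- Shifting to the midpoint `u - R/2` completes the square; the phase survives unchanged since
    -- `σ(R, R) = 0`.
    have h5 : ∫ u, Ψ u = ((Real.exp (-(Real.pi / 2 * sqNorm E R)) : ℝ) : ℂ) *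
        ∫ u, ((Real.exp (-(Real.pi * 2 * sqNorm E u)) : ℝ) : ℂ) *
          unitPhase (sympl u (-(h • R))) := by
      rw [← integral_const_mul, ← integral_sub_right_eq_self _ ((1 / 2 : ℝ) • R)]
      refine integral_congr_ae (.of_forall fun u => ?_)
      simp only [hΨ]
      have e1 : h * sympl R (u - (1 / 2 : ℝ) • R) = sympl u (-(h • R)) := by
        rw [sympl_sub_right, sympl_smul_right, sympl_self, sympl_neg_right, sympl_smul_right,
          sympl_swap R u]
        ring
      rw [e1, ← Real.exp_add, ← neg_add, ← mul_add, sqNorm_parallelogram]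
      have e2 : Real.exp (-(Real.pi * (2 * sqNorm E u + sqNorm E R / 2))) =
          Real.exp (-(Real.pi / 2 * sqNorm E R)) * Real.exp (-(Real.pi * 2 * sqNorm E u)) := by
        rw [← Real.exp_add]
        congr 1
        ring
      rw [e2]
      push_cast
      ring
    have h6 := integral_gaussian_sympl hEdet two_pos (-(h • R))
    rw [sqNorm_neg, sqNorm_smul, hE2, hEabs] at h6
    rw [h1, ← h2]
    simp only [h3]
    rw [integral_const_mul, h4, h5, h6, ← Complex.ofReal_mul, ← Complex.ofReal_mul,
      ← Complex.ofReal_mul, ← Complex.ofReal_mul]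
    congr 1
    have e3 : Real.exp (-(Real.pi / 2 * (sqNorm E R + h ^ 2 * sqNorm B R))) =
        Real.exp (-(Real.pi / 2 * sqNorm E R)) *
          Real.exp (-(Real.pi / 2 * (h ^ 2 * sqNorm B R))) := by
      rw [← Real.exp_add]
      congr 1
      ring
    -- The powers of `h` and the determinants cancel; the normalization `C² = 2^d |det B|` leaves
    -- the constant `1`, hence total mass one at `r = 0`.
    rw [e3, hκ, hC]
    have hpow : h ^ (2 * d) ≠ 0 := pow_ne_zero _ hh0.ne'
    field_simp

end

/-! ### Growth of matrix powers and diamond products -/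

section Growth

variable {m : Type*} [Fintype m] [DecidableEq m]

/-- Gelfand's formula as a bound on the entries of the powers of a complex matrix. -/
lemma exists_norm_pow_apply_le {X : Matrix m m ℂ} {ρ ρ' : ℝ} (hρ : ∀ z ∈ spectrum ℂ X, ‖z‖ ≤ ρ)
    (h0 : 0 ≤ ρ) (hlt : ρ < ρ') :
    ∃ C : ℝ, 0 ≤ C ∧ ∀ (n : ℕ) (i j : m), ‖(X ^ n) i j‖ ≤ C * ρ' ^ n := by
  let _ : NormedRing (Matrix m m ℂ) := Matrix.linftyOpNormedRing
  let _ : NormedAlgebra ℂ (Matrix m m ℂ) := Matrix.linftyOpNormedAlgebra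
  have : CompleteSpace (Matrix m m ℂ) := FiniteDimensional.complete ℂ _
  have hρ' : 0 < ρ' := h0.trans_lt hlt
  have hentry : ∀ (Y : Matrix m m ℂ) (i j : m), ‖Y i j‖ ≤ ‖Y‖ := by
    intro Y i j
    have h : ‖Y i j‖₊ ≤ ‖Y‖₊ := by
      rw [Matrix.linfty_opNNNorm_def]
      exact (Finset.single_le_sum (f := fun j => ‖Y i j‖₊) (fun _ _ => zero_le)
        (Finset.mem_univ j)).trans
        (Finset.le_sup (f := fun i => ∑ j, ‖Y i j‖₊) (Finset.mem_univ i))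
    exact_mod_cast h
  have hrad : spectralRadius ℂ X < ENNReal.ofReal ρ' := by
    refine lt_of_le_of_lt (b := ENNReal.ofReal ρ) ?_ ((ENNReal.ofReal_lt_ofReal_iff hρ').2 hlt)
    refine iSup₂_le fun z hz => ?_
    rw [show ((‖z‖₊ : NNReal) : ENNReal) = ENNReal.ofReal ‖z‖ from (ofReal_norm z).symm]
    exact ENNReal.ofReal_le_ofReal (hρ z hz)
  have hev := (spectrum.pow_nnnorm_pow_one_div_tendsto_nhds_spectralRadius X).eventually_lt_const
    hrad
  obtain ⟨n₀, hn₀⟩ := Filter.eventually_atTop.1 hev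
  have hbig : ∀ n, n₀ + 1 ≤ n → ‖X ^ n‖ ≤ ρ' ^ n := by
    intro n hn
    have h := hn₀ n (by omega)
    have hn' : (n : ℝ) ≠ 0 := by
      have : n ≠ 0 := by omega
      exact_mod_cast this
    have h2 := ENNReal.rpow_le_rpow h.le (Nat.cast_nonneg n)
    rw [← ENNReal.rpow_mul, one_div, inv_mul_cancel₀ hn', ENNReal.rpow_one,
      ENNReal.rpow_natCast, ← ENNReal.ofReal_pow hρ'.le] at h2
    have h3 : ENNReal.ofReal ‖X ^ n‖ ≤ ENNReal.ofReal (ρ' ^ n) := by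
      rw [ofReal_norm]
      exact h2
    exact (ENNReal.ofReal_le_ofReal_iff (by positivity)).1 h3
  -- Gelfand's formula gives the bound with constant `1` for large powers; the sum covers the
  -- finitely many remaining ones.
  refine ⟨1 + ∑ k ∈ Finset.range (n₀ + 1), ‖X ^ k‖ / ρ' ^ k, by positivity, fun n i j => ?_⟩
  refine (hentry _ i j).trans ?_
  have hpos : 0 < ρ' ^ n := by positivity
  by_cases hn : n₀ + 1 ≤ n
  · refine (hbig n hn).trans (le_mul_of_one_le_left hpos.le ?_)
    exact le_add_of_nonneg_right (by positivity)
  · rw [← div_le_iff₀ hpos]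
    have := Finset.single_le_sum (f := fun k => ‖X ^ k‖ / ρ' ^ k) (fun _ _ => by positivity)
      (Finset.mem_range.2 (not_le.1 hn))
    linarith

lemma map_ofReal_pow (X : Matrix m m ℝ) (n : ℕ) :
    (X ^ n).map ((↑) : ℝ → ℂ) = (X.map ((↑) : ℝ → ℂ)) ^ n :=
  map_pow (Complex.ofRealHom.mapMatrix) X n

lemma exists_abs_pow_apply_le {X : Matrix m m ℝ} {l δ : ℝ}
    (hl : ∀ z ∈ cspec X, ‖z‖ ≤ Real.exp l) (hδ : 0 < δ) :
    ∃ C : ℝ, 0 ≤ C ∧ ∀ (n : ℕ) (i j : m), |(X ^ n) i j| ≤ C * Real.exp ((l + δ) * n) := by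
  obtain ⟨C, hC, h⟩ := exists_norm_pow_apply_le hl (Real.exp_pos _).le
    (Real.exp_lt_exp.2 (lt_add_of_pos_right l hδ))
  refine ⟨C, hC, fun n i j => ?_⟩
  have := h n i j
  rw [← map_ofReal_pow, Matrix.map_apply, Complex.norm_real, Real.norm_eq_abs,
    ← Real.exp_nat_mul, mul_comm (n : ℝ)] at this
  exact this

lemma norm_of_mem_cspec_inv {X : Matrix m m ℝ} (hX : IsUnit X.det) {z : ℂ}
    (hz : z ∈ cspec X⁻¹) : ∃ w ∈ cspec X, ‖z‖ = ‖w‖⁻¹ := by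
  have h1 : X.map ((↑) : ℝ → ℂ) * (X⁻¹).map ((↑) : ℝ → ℂ) = 1 := by
    have := congrArg (Complex.ofRealHom.mapMatrix) (Matrix.mul_nonsing_inv X hX)
    rwa [map_mul, map_one] at this
  have h2 := mul_eq_one_comm.1 h1
  let u : (Matrix m m ℂ)ˣ := ⟨X.map (↑), (X⁻¹).map (↑), h1, h2⟩
  have hz0 : z ≠ 0 := by
    rintro rfl
    exact spectrum.zero_notMem ℂ (u⁻¹).isUnit hz
  refine ⟨z⁻¹, ?_, by rw [norm_inv, inv_inv]⟩
  have := (spectrum.inv_mem_iff (r := Units.mk0 z hz0) (a := u⁻¹)).1 hz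
  rwa [inv_inv, Units.val_inv_eq_inv_val] at this

end Growth

/-! ### Algebra and entry bounds of `⋄`-products -/

section Diamond

variable {k : ℕ} {n : Fin k → ℕ}

lemma diamond_mul (M M' : ∀ i, Matrix (Fin (n i) ⊕ Fin (n i)) (Fin (n i) ⊕ Fin (n i)) ℝ) :
    diamond M * diamond M' = diamond fun i => M i * M' i := by
  have h : ∀ i, M i * M' i = fromBlocks
      ((M i).toBlocks₁₁ * (M' i).toBlocks₁₁ + (M i).toBlocks₁₂ * (M' i).toBlocks₂₁)
      ((M i).toBlocks₁₁ * (M' i).toBlocks₁₂ + (M i).toBlocks₁₂ * (M' i).toBlocks₂₂)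
      ((M i).toBlocks₂₁ * (M' i).toBlocks₁₁ + (M i).toBlocks₂₂ * (M' i).toBlocks₂₁)
      ((M i).toBlocks₂₁ * (M' i).toBlocks₁₂ + (M i).toBlocks₂₂ * (M' i).toBlocks₂₂) := by
    intro i
    rw [← fromBlocks_multiply, fromBlocks_toBlocks, fromBlocks_toBlocks]
  simp only [diamond, h, fromBlocks_multiply, toBlocks_fromBlocks₁₁, toBlocks_fromBlocks₁₂,
    toBlocks_fromBlocks₂₁, toBlocks_fromBlocks₂₂]
  simp only [← blockDiagonal'_mul, ← blockDiagonal'_add]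
  rfl

lemma diamond_one : diamond (fun i => (1 : Matrix (Fin (n i) ⊕ Fin (n i)) _ ℝ)) = 1 := by
  simp only [diamond, ← fromBlocks_one, toBlocks_fromBlocks₁₁, toBlocks_fromBlocks₁₂,
    toBlocks_fromBlocks₂₁, toBlocks_fromBlocks₂₂]
  congr 1
  · exact blockDiagonal'_one
  · exact blockDiagonal'_zero
  · exact blockDiagonal'_zero
  · exact blockDiagonal'_one

lemma abs_blockDiagonal'_le {M : ∀ i, Matrix (Fin (n i)) (Fin (n i)) ℝ} {b : Fin k → ℝ}
    (hb : ∀ i, 0 ≤ b i) (h : ∀ i x y, |M i x y| ≤ b i) (x y : Σ i, Fin (n i)) :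
    |blockDiagonal' M x y| ≤ b x.1 := by
  rw [blockDiagonal'_apply]
  split_ifs
  · exact h _ _ _
  · simpa using hb _

lemma abs_diamond_le {M : ∀ i, Matrix (Fin (n i) ⊕ Fin (n i)) (Fin (n i) ⊕ Fin (n i)) ℝ}
    {b : Fin k → ℝ} (hb : ∀ i, 0 ≤ b i) (h : ∀ i x y, |M i x y| ≤ b i)
    (x y : (Σ i, Fin (n i)) ⊕ (Σ i, Fin (n i))) :
    |diamond M x y| ≤ b (Sum.elim Sigma.fst Sigma.fst x) := by
  rcases x with x | x <;> rcases y with y | y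
  · exact abs_blockDiagonal'_le hb (fun i x y => h i (Sum.inl x) (Sum.inl y)) x y
  · exact abs_blockDiagonal'_le hb (fun i x y => h i (Sum.inl x) (Sum.inr y)) x y
  · exact abs_blockDiagonal'_le hb (fun i x y => h i (Sum.inr x) (Sum.inl y)) x y
  · exact abs_blockDiagonal'_le hb (fun i x y => h i (Sum.inr x) (Sum.inr y)) x y

end Diamond

/-! ### Growth in coordinates adapted to a symplectic reduction -/

section

variable {d : ℕ}

/-- `D` is a quotient of `X` through the split surjection `E`: an inverse of `z - X`, sandwiched
between `E` and `F`, is a right inverse of the square matrix `z - D`. -/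
lemma spectrum_subset_of_intertwine {m k : Type*} [Fintype m] [DecidableEq m] [Fintype k]
    [DecidableEq k] {X : Matrix m m ℂ} {D : Matrix k k ℂ} {E : Matrix k m ℂ} {F : Matrix m k ℂ}
    (hEF : E * F = 1) (hE : E * X = D * E) : spectrum ℂ D ⊆ spectrum ℂ X := by
  intro z hz hu
  refine hz ?_
  obtain ⟨u, hu⟩ := hu
  have h1 : E * (u : Matrix m m ℂ) = (algebraMap ℂ (Matrix k k ℂ) z - D) * E := by
    rw [hu, Matrix.mul_sub, Matrix.sub_mul, hE, Algebra.algebraMap_eq_smul_one,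
      Algebra.algebraMap_eq_smul_one]
    simp
  have h2 : (algebraMap ℂ (Matrix k k ℂ) z - D) * (E * (↑u⁻¹ : Matrix m m ℂ) * F) = 1 := by
    rw [← Matrix.mul_assoc, ← Matrix.mul_assoc, ← h1, Matrix.mul_assoc E, Units.mul_inv,
      Matrix.mul_one, hEF]
  exact IsUnit.of_mul_eq_one _ h2

lemma cspec_nonempty {k : Type*} [Fintype k] [DecidableEq k] [Nonempty k] (D : Matrix k k ℝ) :
    (cspec D).Nonempty :=
  spectrum.nonempty_of_isAlgClosed_of_finiteDimensional ℂ _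

lemma abs_fromBlocks_pow_le {k : ℕ} {D D' : Matrix (Fin k) (Fin k) ℝ} {C C' l : ℝ}
    (hC : 0 ≤ C) (hC' : 0 ≤ C')
    (h : ∀ (n : ℕ) (i j), |(D ^ n) i j| ≤ C * Real.exp (l * n))
    (h' : ∀ (n : ℕ) (i j), |(D' ^ n) i j| ≤ C' * Real.exp (l * n)) (n : ℕ) (i j) :
    |((fromBlocks D 0 0 D') ^ n) i j| ≤ (C + C') * Real.exp (l * n) := by
  have hp : (fromBlocks D 0 0 D') ^ n = fromBlocks (D ^ n) 0 0 (D' ^ n) := by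
    induction n with
    | zero => simp
    | succ n ih => rw [pow_succ, ih, fromBlocks_multiply]; simp [pow_succ]
  have he := Real.exp_pos (l * n)
  rw [hp]
  rcases i with i | i <;> rcases j with j | j
  · exact (h n i j).trans (mul_le_mul_of_nonneg_right (by linarith) he.le)
  · simpa using by positivity
  · simpa using by positivity
  · exact (h' n i j).trans (mul_le_mul_of_nonneg_right (by linarith) he.le)

namespace SymplecticReduction

variable {A : Matrix (Fin d ⊕ Fin d) (Fin d ⊕ Fin d) ℝ} (S : SymplecticReduction A)

/-- The Lyapunov exponents of all blocks, with the value `0` for the neutral one. -/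
def exponent : Fin (S.r + 1) → ℝ := Fin.cons 0 S.lyap

/-- The block to which a coordinate of the phase space belongs. -/
def blockOf : Fin d ⊕ Fin d → Fin (S.r + 1) :=
  Sum.elim (fun j => (S.index j).1) (fun j => (S.index j).1)

/-- The reindexing of the phase space coordinates by blocks. -/
def phaseIndex : Fin d ⊕ Fin d ≃ (Σ i, Fin (S.dim i)) ⊕ (Σ i, Fin (S.dim i)) :=
  Equiv.sumCongr S.index S.index

lemma Q_mul_inv : (S.Q : Matrix (Fin d ⊕ Fin d) (Fin d ⊕ Fin d) ℝ) *
    ((S.Q⁻¹ : symplecticGroup (Fin d) ℝ) : Matrix (Fin d ⊕ Fin d) (Fin d ⊕ Fin d) ℝ) = 1 := by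
  rw [← Submonoid.coe_mul, mul_inv_cancel, Submonoid.coe_one]

lemma inv_mul_Q :
    ((S.Q⁻¹ : symplecticGroup (Fin d) ℝ) : Matrix (Fin d ⊕ Fin d) (Fin d ⊕ Fin d) ℝ) *
      (S.Q : Matrix (Fin d ⊕ Fin d) (Fin d ⊕ Fin d) ℝ) = 1 := by
  rw [← Submonoid.coe_mul, inv_mul_cancel, Submonoid.coe_one]

lemma isUnit_det_block (i : Fin (S.r + 1)) : IsUnit (S.block i).det := by
  refine Fin.cases ?_ (fun i => ?_) i
  · exact SymplecticGroup.symplectic_det S.neutral_symplectic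
  · obtain ⟨D, hD, hb, -⟩ := S.hyperbolic i
    rw [hb, det_fromBlocks_zero₂₁]
    exact hD.mul ((isUnit_nonsing_inv_det_iff).2 (by rwa [det_transpose]))

/-- Gelfand's formula on each block. A hyperbolic block contains both `D` and the inverse of its
transpose; the eigenvalues of `D⁻¹` have modulus `e^{-λ} ≤ e^{λ}`, so one rate serves both halves
and both directions of time. -/
lemma exists_abs_block_pow_le {δ : ℝ} (hδ : 0 < δ) (i : Fin (S.r + 1)) :
    ∃ C : ℝ, 0 ≤ C ∧ ∀ (n : ℕ) (x y), |(S.block i ^ n) x y| ≤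
      C * Real.exp ((S.exponent i + δ) * n) ∧
      |((S.block i)⁻¹ ^ n) x y| ≤ C * Real.exp ((S.exponent i + δ) * n) := by
  have hcomb : ∀ {m : Type} (X Y : Matrix m m ℝ) [Fintype m] [DecidableEq m] (l : ℝ),
      (∃ C : ℝ, 0 ≤ C ∧ ∀ (n : ℕ) (x y), |(X ^ n) x y| ≤ C * Real.exp (l * n)) →
      (∃ C : ℝ, 0 ≤ C ∧ ∀ (n : ℕ) (x y), |(Y ^ n) x y| ≤ C * Real.exp (l * n)) →
      ∃ C : ℝ, 0 ≤ C ∧ ∀ (n : ℕ) (x y), |(X ^ n) x y| ≤ C * Real.exp (l * n) ∧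
        |(Y ^ n) x y| ≤ C * Real.exp (l * n) := by
    rintro m X Y _ _ l ⟨C, hC, h⟩ ⟨C', hC', h'⟩
    refine ⟨C + C', by positivity, fun n x y => ⟨(h n x y).trans ?_, (h' n x y).trans ?_⟩⟩ <;>
      exact mul_le_mul_of_nonneg_right (by linarith) (Real.exp_pos _).le
  refine hcomb _ _ _ ?_ ?_
  · revert i
    refine Fin.cases ?_ (fun i => ?_)
    · refine exists_abs_pow_apply_le (fun z hz => ?_) hδ
      rw [S.neutral_spectrum z hz]
      simp [exponent]
    · obtain ⟨D, hD, hb, hs⟩ := S.hyperbolic i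
      obtain ⟨C, hC, h⟩ := exists_abs_pow_apply_le (X := D) (fun z hz => (hs z hz).le) hδ
      obtain ⟨C', hC', h'⟩ := exists_abs_pow_apply_le (X := D⁻¹) (l := S.lyap i) (fun z hz => by
        obtain ⟨w, hw, hzw⟩ := norm_of_mem_cspec_inv hD hz
        rw [hzw, hs w hw, ← Real.exp_neg]
        exact Real.exp_le_exp.2 (by linarith [S.lyap_pos i])) hδ
      refine ⟨C + C', by positivity, ?_⟩
      rw [hb]
      refine abs_fromBlocks_pow_le hC hC' h (fun n x y => ?_)
      rw [← transpose_nonsing_inv, ← transpose_pow]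
      exact h' n y x
  · revert i
    refine Fin.cases ?_ (fun i => ?_)
    · refine exists_abs_pow_apply_le (fun z hz => ?_) hδ
      obtain ⟨w, hw, hzw⟩ := norm_of_mem_cspec_inv (S.isUnit_det_block 0) hz
      rw [hzw, S.neutral_spectrum w hw]
      simp [exponent]
    · obtain ⟨D, hD, hb, hs⟩ := S.hyperbolic i
      obtain ⟨C, hC, h⟩ := exists_abs_pow_apply_le (X := D) (fun z hz => (hs z hz).le) hδ
      obtain ⟨C', hC', h'⟩ := exists_abs_pow_apply_le (X := D⁻¹) (l := S.lyap i) (fun z hz => by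
        obtain ⟨w, hw, hzw⟩ := norm_of_mem_cspec_inv hD hz
        rw [hzw, hs w hw, ← Real.exp_neg]
        exact Real.exp_le_exp.2 (by linarith [S.lyap_pos i])) hδ
      have hinv : (S.block i.succ)⁻¹ = fromBlocks D⁻¹ 0 0 Dᵀ := by
        refine inv_eq_right_inv ?_
        rw [hb, fromBlocks_multiply]
        have hDt : IsUnit (Dᵀ).det := by rwa [det_transpose]
        simp [mul_nonsing_inv D hD, nonsing_inv_mul Dᵀ hDt]
      refine ⟨C' + C, by positivity, ?_⟩
      rw [hinv]
      refine abs_fromBlocks_pow_le hC' hC h' (fun n x y => ?_)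
      rw [← transpose_pow]
      exact h n y x

/-- Conjugates of `⋄`-products: growth of the coordinates adapted to the blocks. -/
lemma exists_abs_inv_mul_pow_le
    {b : ∀ i, Matrix (Fin (S.dim i) ⊕ Fin (S.dim i)) (Fin (S.dim i) ⊕ Fin (S.dim i)) ℝ}
    {X : Matrix (Fin d ⊕ Fin d) (Fin d ⊕ Fin d) ℝ} {C : Fin (S.r + 1) → ℝ} {l : Fin (S.r + 1) → ℝ}
    (hC : ∀ i, 0 ≤ C i)
    (hb : ∀ i (n : ℕ) (x y), |(b i ^ n) x y| ≤ C i * Real.exp (l i * n))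
    (hX : ((S.Q⁻¹ : symplecticGroup (Fin d) ℝ) : Matrix (Fin d ⊕ Fin d) (Fin d ⊕ Fin d) ℝ) * X =
      (diamond b).submatrix S.phaseIndex S.phaseIndex *
        ((S.Q⁻¹ : symplecticGroup (Fin d) ℝ) : Matrix (Fin d ⊕ Fin d) (Fin d ⊕ Fin d) ℝ)) :
    ∃ K : ℝ, 0 ≤ K ∧ ∀ (n : ℕ) (x y),
      |(((S.Q⁻¹ : symplecticGroup (Fin d) ℝ) : Matrix (Fin d ⊕ Fin d) (Fin d ⊕ Fin d) ℝ) * X ^ n)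
        x y| ≤ K * Real.exp (l (S.blockOf x) * n) := by
  set P := ((S.Q⁻¹ : symplecticGroup (Fin d) ℝ) : Matrix (Fin d ⊕ Fin d) (Fin d ⊕ Fin d) ℝ)
  -- The intertwining relation passes to powers, and a `⋄`-product is raised to a power block by
  -- block. Each row of the result thus grows at the rate of its own block, whatever the fixed
  -- factor `P`.
  have hpow : ∀ n : ℕ, P * X ^ n =
      (diamond fun i => b i ^ n).submatrix S.phaseIndex S.phaseIndex * P := by
    intro n
    induction n with
    | zero => simp only [pow_zero, diamond_one, submatrix_one_equiv, Matrix.mul_one, Matrix.one_mul]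
    | succ n ih =>
      rw [pow_succ, ← Matrix.mul_assoc, ih, Matrix.mul_assoc, hX, ← Matrix.mul_assoc,
        submatrix_mul_equiv, diamond_mul]
      simp only [pow_succ]
  refine ⟨∑ x, ∑ y, ∑ z, C (S.blockOf x) * |P z y|, by
    exact Finset.sum_nonneg fun x _ => Finset.sum_nonneg fun y _ => Finset.sum_nonneg fun z _ =>
      mul_nonneg (hC _) (abs_nonneg _), fun n x y => ?_⟩
  rw [hpow, mul_apply]
  have hE := Real.exp_pos (l (S.blockOf x) * n)
  calc |∑ z, (diamond fun i => b i ^ n).submatrix S.phaseIndex S.phaseIndex x z * P z y|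
      ≤ ∑ z, (C (S.blockOf x) * |P z y|) * Real.exp (l (S.blockOf x) * n) := by
        refine (Finset.abs_sum_le_sum_abs _ _).trans (Finset.sum_le_sum fun z _ => ?_)
        rw [abs_mul, mul_right_comm]
        refine mul_le_mul_of_nonneg_right ?_ (abs_nonneg _)
        have h := abs_diamond_le (M := fun i => b i ^ n)
          (b := fun i => C i * Real.exp (l i * n))
          (fun i => mul_nonneg (hC i) (Real.exp_pos _).le) (fun i x y => hb i n x y)
          (S.phaseIndex x) (S.phaseIndex z)
        have hx : Sum.elim Sigma.fst Sigma.fst (S.phaseIndex x) = S.blockOf x := by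
          rcases x with x | x <;> rfl
        rwa [hx] at h
    _ = (∑ z, C (S.blockOf x) * |P z y|) * Real.exp (l (S.blockOf x) * n) := by
        rw [Finset.sum_mul]
    _ ≤ _ := by
        refine mul_le_mul_of_nonneg_right ?_ hE.le
        have h0 : ∀ x y z, 0 ≤ C (S.blockOf x) * |P z y| := fun x y z =>
          mul_nonneg (hC _) (abs_nonneg _)
        refine (Finset.single_le_sum (f := fun y => ∑ z, C (S.blockOf x) * |P z y|)
          (fun y _ => Finset.sum_nonneg fun z _ => h0 x y z) (Finset.mem_univ y)).trans ?_
        exact Finset.single_le_sum (f := fun x => ∑ y, ∑ z, C (S.blockOf x) * |P z y|)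
          (fun x _ => Finset.sum_nonneg fun y _ => Finset.sum_nonneg fun z _ => h0 x y z)
          (Finset.mem_univ x)

lemma inv_mul_eq : ((S.Q⁻¹ : symplecticGroup (Fin d) ℝ) : Matrix _ _ ℝ) * A =
    (diamond S.block).submatrix S.phaseIndex S.phaseIndex *
      ((S.Q⁻¹ : symplecticGroup (Fin d) ℝ) : Matrix _ _ ℝ) := by
  refine (congrArg (((S.Q⁻¹ : symplecticGroup (Fin d) ℝ) : Matrix _ _ ℝ) * ·) S.conj_eq).trans ?_
  rw [← Matrix.mul_assoc, ← Matrix.mul_assoc, S.inv_mul_Q, Matrix.one_mul]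
  rfl

lemma inv_mul_inv_eq {A' : Matrix (Fin d ⊕ Fin d) (Fin d ⊕ Fin d) ℝ} (hA' : A * A' = 1) :
    ((S.Q⁻¹ : symplecticGroup (Fin d) ℝ) : Matrix _ _ ℝ) * A' =
    (diamond fun i => (S.block i)⁻¹).submatrix S.phaseIndex S.phaseIndex *
      ((S.Q⁻¹ : symplecticGroup (Fin d) ℝ) : Matrix _ _ ℝ) := by
  have h1 : (diamond fun i => (S.block i)⁻¹).submatrix S.phaseIndex S.phaseIndex *
      (diamond S.block).submatrix S.phaseIndex S.phaseIndex = 1 := by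
    rw [submatrix_mul_equiv, diamond_mul]
    simp only [nonsing_inv_mul _ (S.isUnit_det_block _), diamond_one, submatrix_one_equiv]
  calc _ = (diamond fun i => (S.block i)⁻¹).submatrix S.phaseIndex S.phaseIndex *
      ((diamond S.block).submatrix S.phaseIndex S.phaseIndex *
      ((S.Q⁻¹ : symplecticGroup (Fin d) ℝ) : Matrix _ _ ℝ)) * A' := by
        rw [← Matrix.mul_assoc, h1, Matrix.one_mul]
    _ = _ := by
        rw [← S.inv_mul_eq, Matrix.mul_assoc, Matrix.mul_assoc, hA', Matrix.mul_one]

/-- The rows of `Q⁻¹` belonging to `D` intertwine `A` with `D`, so the spectrum of `D` is contained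
in that of `A`. -/
lemma lyap_le_lyapMax (i : Fin S.r) : S.lyap i ≤ lyapMax A := by
  obtain ⟨D, hD, hb, hs⟩ := S.hyperbolic i
  have : Nonempty (Fin (S.dim i.succ)) := ⟨⟨0, S.dim_pos i⟩⟩
  obtain ⟨z, hz⟩ := cspec_nonempty D
  set P := ((S.Q⁻¹ : symplecticGroup (Fin d) ℝ) : Matrix (Fin d ⊕ Fin d) (Fin d ⊕ Fin d) ℝ) with hP
  let e : Fin (S.dim i.succ) → Fin d ⊕ Fin d := fun x => Sum.inl (S.index.symm ⟨i.succ, x⟩)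
  have he : Function.Injective e := fun x y hxy => by simpa [e] using hxy
  have hEF : P.submatrix e id * (S.Q : Matrix (Fin d ⊕ Fin d) (Fin d ⊕ Fin d) ℝ).submatrix id e = 1 := by
    rw [← submatrix_mul _ _ e id e Function.bijective_id, S.inv_mul_Q, submatrix_one e he]
  have hE : P.submatrix e id * A = D * P.submatrix e id := by
    have h1 : P.submatrix e id * A = (P * A).submatrix e id := by
      ext x y; simp [mul_apply]
    rw [h1, S.inv_mul_eq]
    ext x y
    simp only [submatrix_apply, mul_apply, id, Fintype.sum_sum_type]
    have h2 : ∀ j, diamond S.block (S.phaseIndex (e x)) (S.phaseIndex (Sum.inr j)) = 0 := by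
      intro j
      change blockDiagonal' (fun i => (S.block i).toBlocks₁₂)
        (S.index (S.index.symm ⟨i.succ, x⟩)) (S.index j) = 0
      rw [Equiv.apply_symm_apply, blockDiagonal'_apply]
      split_ifs with h
      · generalize S.index j = w at h
        obtain ⟨w1, w2⟩ := w
        dsimp only at h
        subst h
        simp [hb]
      · rfl
    simp only [h2, zero_mul, Finset.sum_const_zero, add_zero]
    rw [← S.index.symm.sum_comp, Fintype.sum_sigma, Finset.sum_eq_single i.succ]
    · refine Finset.sum_congr rfl fun w _ => ?_
      congr 1
      change blockDiagonal' (fun i => (S.block i).toBlocks₁₁)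
        (S.index (S.index.symm ⟨i.succ, x⟩)) (S.index (S.index.symm ⟨i.succ, w⟩)) = D x w
      rw [Equiv.apply_symm_apply, Equiv.apply_symm_apply, blockDiagonal'_apply_eq, hb]
      simp
    · intro k _ hk
      refine Finset.sum_eq_zero fun w _ => ?_
      refine mul_eq_zero_of_left ?_ _
      change blockDiagonal' (fun i => (S.block i).toBlocks₁₁)
        (S.index (S.index.symm ⟨i.succ, x⟩)) (S.index (S.index.symm ⟨k, w⟩)) = 0
      rw [Equiv.apply_symm_apply, Equiv.apply_symm_apply, blockDiagonal'_apply_ne _ _ _ hk.symm]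
    · simp
  have hsub : cspec D ⊆ cspec A := by
    refine spectrum_subset_of_intertwine (E := (P.submatrix e id).map ((↑) : ℝ → ℂ))
      (F := ((S.Q : Matrix (Fin d ⊕ Fin d) (Fin d ⊕ Fin d) ℝ).submatrix id e).map
        ((↑) : ℝ → ℂ)) ?_ ?_
    · have := congrArg (fun Y => Y.map Complex.ofRealHom) hEF
      simp only [Matrix.map_mul] at this
      refine this.trans ?_
      exact Matrix.map_one _ Complex.ofReal_zero Complex.ofReal_one
    · have := congrArg (fun Y => Y.map Complex.ofRealHom) hE
      simp only [Matrix.map_mul] at this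
      exact this
  -- Finiteness of the spectrum makes the set bounded above, so that the real supremum dominates its
  -- elements.
  have hfin : (cspec A).Finite := by
    have : cspec A = spectrum ℂ (Matrix.toLin' (A.map ((↑) : ℝ → ℂ))) :=
      (Matrix.spectrum_toLin' _).symm
    rw [this]
    exact Module.End.finite_spectrum _
  refine le_csSup ((hfin.image _).bddAbove) ⟨z, hsub hz, ?_⟩
  simp only [hs z hz, Real.log_exp]

end SymplecticReduction

end

/-! ### Squeezing up to the Ehrenfest time -/

section

variable {d : ℕ}

lemma toReal_mul (A B : symplecticGroup (Fin d) ℤ) : toReal (A * B) = toReal A * toReal B := by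
  simp only [toReal, Submonoid.coe_mul]
  exact Matrix.map_mul (f := Int.castRingHom ℝ)

lemma toReal_one : toReal (1 : symplecticGroup (Fin d) ℤ) = 1 := by
  simp [toReal]

lemma toReal_pow (A : symplecticGroup (Fin d) ℤ) (n : ℕ) : toReal (A ^ n) = toReal A ^ n := by
  induction n with
  | zero => simp [toReal_one]
  | succ n ih => rw [pow_succ, pow_succ, toReal_mul, ih]

lemma exists_sum_sq_mulVec_le {m n : Type*} [Fintype m] [Fintype n] (P : Matrix m n ℝ) :
    ∃ K : ℝ, 0 ≤ K ∧ ∀ v : n → ℝ, ∑ i, ((P *ᵥ v) i) ^ 2 ≤ K * ∑ j, (v j) ^ 2 := by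
  refine ⟨∑ i, ∑ j, (P i j) ^ 2, by positivity, fun v => ?_⟩
  rw [Finset.sum_mul]
  exact Finset.sum_le_sum fun i _ => Finset.sum_mul_sq_le_sq_mul_sq _ _ _

lemma abs_mulVec_le {m n : Type*} [Fintype m] [Fintype n] {P : Matrix m n ℝ} {b : ℝ} (i : m)
    (h : ∀ j, |P i j| ≤ b) (v : n → ℝ) : |(P *ᵥ v) i| ≤ Fintype.card n * b * ‖v‖ := by
  have hb : ∀ j, |P i j * v j| ≤ b * ‖v‖ := fun j => by
    rw [abs_mul]
    exact mul_le_mul (h j) (norm_le_pi_norm v j) (abs_nonneg _) ((abs_nonneg _).trans (h j))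
  refine (Finset.abs_sum_le_sum_abs _ _).trans ((Finset.sum_le_sum fun j _ => hb j).trans ?_)
  simp [mul_assoc]

namespace SymplecticReduction

/-! ### The adapted scaling and its symplectic dual -/

section Scale

variable {A : Matrix (Fin d ⊕ Fin d) (Fin d ⊕ Fin d) ℝ} (S : SymplecticReduction A) (ε₀ : ℝ)

/-- The diagonal matrix of the powers `ħ^{s γᵢ}`. -/
def scaleDiag (ħ s : ℝ) : Matrix (Fin d ⊕ Fin d) (Fin d ⊕ Fin d) ℝ :=
  diagonal fun x => ħ ^ (s * scaleExp S ε₀ (S.blockOf x))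

lemma scaleMatrix_eq (ħ : ℝ) : scaleMatrix S ε₀ ħ =
    (S.Q : Matrix (Fin d ⊕ Fin d) (Fin d ⊕ Fin d) ℝ) * S.scaleDiag ε₀ ħ (-1) *
      ((S.Q⁻¹ : symplecticGroup (Fin d) ℝ) : Matrix (Fin d ⊕ Fin d) (Fin d ⊕ Fin d) ℝ) := by
  rw [scaleMatrix, scaleDiag]
  congr 3
  ext x
  rcases x with x | x <;> simp [blockOf]

/-- `J` exchanges conjugate coordinates, and conjugate coordinates carry the same scale. -/
lemma scaleDiag_mul_J (ħ s : ℝ) :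
    S.scaleDiag ε₀ ħ s * Matrix.J (Fin d) ℝ = Matrix.J (Fin d) ℝ * S.scaleDiag ε₀ ħ s := by
  ext x y
  rw [scaleDiag, diagonal_mul, mul_diagonal]
  rcases x with x | x <;> rcases y with y | y <;>
    simp only [J, fromBlocks_apply₁₁, fromBlocks_apply₁₂, fromBlocks_apply₂₁, fromBlocks_apply₂₂,
      Matrix.zero_apply, Matrix.neg_apply, Matrix.one_apply, mul_zero, zero_mul] <;>
    split_ifs with h <;> simp [blockOf, h]

lemma scaleDiag_mul_scaleDiag {ħ : ℝ} (hħ : 0 < ħ) :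
    S.scaleDiag ε₀ ħ (-1) * S.scaleDiag ε₀ ħ 1 = 1 := by
  rw [scaleDiag, scaleDiag, diagonal_mul_diagonal, ← diagonal_one]
  congr 1
  ext x
  rw [← Real.rpow_add hħ]
  simp

lemma scaleMatrix_inv {ħ : ℝ} (hħ : 0 < ħ) : (scaleMatrix S ε₀ ħ)⁻¹ =
    (S.Q : Matrix (Fin d ⊕ Fin d) (Fin d ⊕ Fin d) ℝ) * S.scaleDiag ε₀ ħ 1 *
      ((S.Q⁻¹ : symplecticGroup (Fin d) ℝ) : Matrix (Fin d ⊕ Fin d) (Fin d ⊕ Fin d) ℝ) := by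
  refine inv_eq_right_inv ?_
  rw [scaleMatrix_eq]
  simp only [Matrix.mul_assoc]
  rw [← Matrix.mul_assoc ((S.Q⁻¹ : symplecticGroup (Fin d) ℝ) :
      Matrix (Fin d ⊕ Fin d) (Fin d ⊕ Fin d) ℝ), S.inv_mul_Q, Matrix.one_mul,
    ← Matrix.mul_assoc (S.scaleDiag ε₀ ħ (-1)), S.scaleDiag_mul_scaleDiag ε₀ hħ, Matrix.one_mul,
    S.Q_mul_inv]

lemma det_scaleMatrix_ne_zero {ħ : ℝ} (hħ : 0 < ħ) : (scaleMatrix S ε₀ ħ).det ≠ 0 := by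
  rw [scaleMatrix_eq, det_mul, det_mul]
  have h1 := congrArg det S.Q_mul_inv
  have h2 := congrArg det (S.scaleDiag_mul_scaleDiag ε₀ hħ)
  rw [det_mul, det_one] at h1 h2
  refine mul_ne_zero (mul_ne_zero ?_ ?_) ?_
  · exact left_ne_zero_of_mul_eq_one h1
  · exact left_ne_zero_of_mul_eq_one h2
  · exact right_ne_zero_of_mul_eq_one h1

/-- As `Q` is symplectic and the scaling commutes with `J`, the dual form uses the same coordinates
`Q⁻¹` as the original one, with powers `ħ^{γ}` in place of `ħ^{-γ}`. -/
lemma dualMatrix_scaleMatrix {ħ : ℝ} (hħ : 0 < ħ) : dualMatrix (scaleMatrix S ε₀ ħ) =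
    ((S.Q⁻¹ : symplecticGroup (Fin d) ℝ) : Matrix (Fin d ⊕ Fin d) (Fin d ⊕ Fin d) ℝ)ᵀ *
      Matrix.J (Fin d) ℝ * S.scaleDiag ε₀ ħ 1 *
      ((S.Q⁻¹ : symplecticGroup (Fin d) ℝ) : Matrix (Fin d ⊕ Fin d) (Fin d ⊕ Fin d) ℝ) := by
  have hJ : (S.Q : Matrix (Fin d ⊕ Fin d) (Fin d ⊕ Fin d) ℝ)ᵀ * Matrix.J (Fin d) ℝ *
      (S.Q : Matrix (Fin d ⊕ Fin d) (Fin d ⊕ Fin d) ℝ) = Matrix.J (Fin d) ℝ :=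
    SymplecticGroup.mem_iff'.1 S.Q.2
  have hJ' : (S.Q : Matrix (Fin d ⊕ Fin d) (Fin d ⊕ Fin d) ℝ)ᵀ * Matrix.J (Fin d) ℝ =
      Matrix.J (Fin d) ℝ *
      ((S.Q⁻¹ : symplecticGroup (Fin d) ℝ) : Matrix (Fin d ⊕ Fin d) (Fin d ⊕ Fin d) ℝ) := by
    conv_rhs => rw [← hJ]
    rw [Matrix.mul_assoc _ _ ((S.Q⁻¹ : symplecticGroup (Fin d) ℝ) :
      Matrix (Fin d ⊕ Fin d) (Fin d ⊕ Fin d) ℝ), S.Q_mul_inv, Matrix.mul_one]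
  have hD : (S.scaleDiag ε₀ ħ 1)ᵀ = S.scaleDiag ε₀ ħ 1 := by rw [scaleDiag, diagonal_transpose]
  rw [dualMatrix, S.scaleMatrix_inv ε₀ hħ, transpose_mul, transpose_mul, hD]
  simp only [Matrix.mul_assoc]
  rw [hJ', ← Matrix.mul_assoc (S.scaleDiag ε₀ ħ 1), S.scaleDiag_mul_J]
  simp only [Matrix.mul_assoc]

/-- The bound `γ ≤ 1/2` means `ħ^{1-γ} ≤ ħ^{γ}` for `ħ ≤ 1`, so the term with `ħ B` is dominated by
the dual term. -/
lemma scaleExp_le_half (hε₀' : ε₀ ≤ lyapMax A) (hmax : 0 < lyapMax A) (i : Fin (S.r + 1)) :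
    scaleExp S ε₀ i ≤ 1 / 2 := by
  rw [scaleExp, div_le_div_iff₀ (by positivity) two_pos]
  refine Fin.cases ?_ (fun i => ?_) i
  · rw [Fin.cons_zero]; linarith
  · rw [Fin.cons_succ]; linarith [S.lyap_le_lyapMax i]

/-- The two quadratic forms in the Fourier transform of the kernel, in terms of the coordinates
adapted to the blocks. -/
lemma exists_sqNorm_scale_le (hε₀' : ε₀ ≤ lyapMax A) (hmax : 0 < lyapMax A) :
    ∃ K : ℝ, 0 ≤ K ∧ ∀ ħ : ℝ, 0 < ħ → ħ ≤ 1 → ∀ ρ : Phase d,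
    sqNorm (dualMatrix (scaleMatrix S ε₀ ħ)) ρ +
      (Real.pi * ħ) ^ 2 * sqNorm (scaleMatrix S ε₀ ħ) ρ ≤
    K * ∑ x, (ħ ^ scaleExp S ε₀ (S.blockOf x) *
      (((S.Q⁻¹ : symplecticGroup (Fin d) ℝ) : Matrix (Fin d ⊕ Fin d) (Fin d ⊕ Fin d) ℝ) *ᵥ ρ) x)
        ^ 2 := by
  obtain ⟨K₁, hK₁, h₁⟩ := exists_sum_sq_mulVec_le
    (((S.Q⁻¹ : symplecticGroup (Fin d) ℝ) : Matrix (Fin d ⊕ Fin d) (Fin d ⊕ Fin d) ℝ)ᵀ *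
      Matrix.J (Fin d) ℝ)
  obtain ⟨K₂, hK₂, h₂⟩ := exists_sum_sq_mulVec_le
    (S.Q : Matrix (Fin d ⊕ Fin d) (Fin d ⊕ Fin d) ℝ)
  refine ⟨K₁ + Real.pi ^ 2 * K₂, by positivity, fun ħ hħ hħ1 ρ => ?_⟩
  set v := ((S.Q⁻¹ : symplecticGroup (Fin d) ℝ) : Matrix (Fin d ⊕ Fin d) (Fin d ⊕ Fin d) ℝ) *ᵥ ρ
    with hv
  have e₁ := h₁ (S.scaleDiag ε₀ ħ 1 *ᵥ v)
  have e₂ := h₂ (S.scaleDiag ε₀ ħ (-1) *ᵥ v)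
  rw [hv, mulVec_mulVec, mulVec_mulVec, ← dualMatrix_scaleMatrix S ε₀ hħ] at e₁
  rw [hv, mulVec_mulVec, mulVec_mulVec, ← scaleMatrix_eq S ε₀] at e₂
  have hd : ∀ s x, (S.scaleDiag ε₀ ħ s *ᵥ v) x = ħ ^ (s * scaleExp S ε₀ (S.blockOf x)) * v x :=
    fun s x => by rw [scaleDiag, mulVec_diagonal]
  rw [← hv] at e₁ e₂
  simp only [hd, one_mul] at e₁ e₂
  -- The second quadratic form is absorbed coordinatewise, using `1 - γ ≥ γ`.
  have e₃ : ħ ^ 2 * ∑ x, (ħ ^ (-1 * scaleExp S ε₀ (S.blockOf x)) * v x) ^ 2 ≤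
      ∑ x, (ħ ^ scaleExp S ε₀ (S.blockOf x) * v x) ^ 2 := by
    rw [Finset.mul_sum]
    refine Finset.sum_le_sum fun x _ => ?_
    rw [← mul_pow, ← mul_assoc]
    refine sq_le_sq.2 ?_
    rw [abs_mul, abs_mul (ħ ^ scaleExp S ε₀ (S.blockOf x))]
    refine mul_le_mul_of_nonneg_right ?_ (abs_nonneg _)
    rw [abs_of_pos (by positivity), abs_of_pos (by positivity)]
    have h1 : ħ * ħ ^ (-1 * scaleExp S ε₀ (S.blockOf x)) =
        ħ ^ (1 + -1 * scaleExp S ε₀ (S.blockOf x)) := by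
      rw [Real.rpow_add hħ, Real.rpow_one]
    rw [h1]
    refine Real.rpow_le_rpow_of_exponent_ge hħ hħ1 ?_
    linarith [S.scaleExp_le_half ε₀ hε₀' hmax (S.blockOf x)]
  have e₄ : sqNorm (scaleMatrix S ε₀ ħ) ρ ≤
      K₂ * ∑ x, (ħ ^ (-1 * scaleExp S ε₀ (S.blockOf x)) * v x) ^ 2 := e₂
  have e₅ := mul_le_mul_of_nonneg_left e₄ (sq_nonneg (Real.pi * ħ))
  have e₆ := mul_le_mul_of_nonneg_left e₃ (mul_nonneg (sq_nonneg Real.pi) hK₂)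
  have e₇ : sqNorm (dualMatrix (scaleMatrix S ε₀ ħ)) ρ ≤
    K₁ * ∑ x, (ħ ^ scaleExp S ε₀ (S.blockOf x) * v x) ^ 2 := e₁
  calc _ ≤ K₁ * ∑ x, (ħ ^ scaleExp S ε₀ (S.blockOf x) * v x) ^ 2 + (Real.pi * ħ) ^ 2 *
        (K₂ * ∑ x, (ħ ^ (-1 * scaleExp S ε₀ (S.blockOf x)) * v x) ^ 2) := add_le_add e₇ e₅
    _ ≤ _ := by
      rw [add_mul]
      refine add_le_add le_rfl (le_trans (le_of_eq ?_) e₆)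
      ring

end Scale

variable {A : symplecticGroup (Fin d) ℤ} (S : SymplecticReduction (toReal A))

/-- The forward and backward block bounds merge into one estimate in `|t|`; keeping the rate of each
row separate is what allows comparison with that row's power of `ħ`. -/
lemma exists_abs_inv_mul_zpow_le {δ : ℝ} (hδ : 0 < δ) :
    ∃ K : ℝ, 0 ≤ K ∧ ∀ (t : ℤ) (x y),
      |(((S.Q⁻¹ : symplecticGroup (Fin d) ℝ) : Matrix (Fin d ⊕ Fin d) (Fin d ⊕ Fin d) ℝ) *
        toReal (A ^ t)) x y| ≤ K * Real.exp ((S.exponent (S.blockOf x) + δ) * |(t : ℝ)|) := by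
  choose C hC h using fun i => S.exists_abs_block_pow_le hδ i
  obtain ⟨K₁, hK₁, h₁⟩ := S.exists_abs_inv_mul_pow_le hC (fun i n x y => (h i n x y).1)
    S.inv_mul_eq
  obtain ⟨K₂, hK₂, h₂⟩ := S.exists_abs_inv_mul_pow_le hC (fun i n x y => (h i n x y).2)
    (S.inv_mul_inv_eq (A' := toReal A⁻¹) (by rw [← toReal_mul, mul_inv_cancel, toReal_one]))
  refine ⟨K₁ + K₂, by positivity, fun t x y => ?_⟩
  rcases Int.eq_nat_or_neg t with ⟨n, rfl | rfl⟩
  · rw [zpow_natCast, toReal_pow]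
    simp only [Int.cast_natCast, Nat.abs_cast]
    exact (h₁ n x y).trans (mul_le_mul_of_nonneg_right (by linarith) (Real.exp_pos _).le)
  · rw [_root_.zpow_neg, zpow_natCast, ← inv_pow, toReal_pow]
    simp only [Int.cast_neg, Int.cast_natCast, abs_neg, Nat.abs_cast]
    exact (h₂ n x y).trans (mul_le_mul_of_nonneg_right (by linarith) (Real.exp_pos _).le)

variable {ε₀ ε : ℝ}

lemma exists_pos_le_cons (hε₀ : 0 < ε₀) :
    ∃ ν : ℝ, 0 < ν ∧ ∀ i, ν ≤ (Fin.cons ε₀ S.lyap : Fin (S.r + 1) → ℝ) i := by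
  obtain ⟨i, hi⟩ := Finite.exists_min (Fin.cons ε₀ S.lyap : Fin (S.r + 1) → ℝ)
  refine ⟨_, ?_, hi⟩
  refine Fin.cases ?_ (fun i => ?_) i
  · exact hε₀
  · exact S.lyap_pos i

/-- On the neutral block the scale exponent uses `ε₀` instead of the true exponent `0`; this margin
absorbs subexponential growth there. -/
lemma exponent_le_cons (hε₀ : 0 < ε₀) (i : Fin (S.r + 1)) :
    S.exponent i ≤ (Fin.cons ε₀ S.lyap : Fin (S.r + 1) → ℝ) i := by
  refine Fin.cases ?_ (fun i => ?_) i
  · exact hε₀.le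
  · exact le_rfl

/-- Up to the Ehrenfest time, the kernel stays wide in the Fourier variable. -/
theorem exists_sqNorm_zpow_le (hmax : 0 < lyapMax (toReal A)) (hε₀ : 0 < ε₀)
    (hε₀' : ε₀ ≤ lyapMax (toReal A)) (hε : 0 < ε) :
    ∃ K η : ℝ, 0 ≤ K ∧ 0 < η ∧ ∀ N : ℕ, 1 ≤ N → ∀ t : ℤ, |t| ≤ ehrenfestTime (toReal A) ε N →
      ∀ ρ : Phase d,
      sqNorm (dualMatrix (scaleMatrix S ε₀ (planck N))) (toReal (A ^ t) *ᵥ ρ) +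
        (Real.pi * planck N) ^ 2 * sqNorm (scaleMatrix S ε₀ (planck N)) (toReal (A ^ t) *ᵥ ρ) ≤
      K * Real.exp (-η * Real.log N) * ‖ρ‖ ^ 2 := by
  set Λ := lyapMax (toReal A) with hΛ
  obtain ⟨ν, hν, hνle⟩ := S.exists_pos_le_cons hε₀
  set ε' := min ε 1 with hε'
  have hε'0 : 0 < ε' := lt_min hε one_pos
  have hε'1 : ε' ≤ 1 := min_le_right _ _
  -- The Ehrenfest time leaves a gain of at least `ε' ν` in every block. Half of it pays for the
  -- loss `δ` in Gelfand's formula.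
  set δ := ε' * ν / 2 with hδ
  have hδ0 : 0 < δ := by positivity
  obtain ⟨K₁, hK₁, h₁⟩ := S.exists_sqNorm_scale_le ε₀ hε₀' hmax
  obtain ⟨K₂, hK₂, h₂⟩ := S.exists_abs_inv_mul_zpow_le hδ0
  set c : ℝ := (Fintype.card (Fin d ⊕ Fin d) : ℝ) with hc
  -- The rate is the remaining gain `ε' ν / (4Λ)`, doubled by squaring. The factors `c` count
  -- coordinates: one from summing squares, and one, squared, from the row estimates.
  refine ⟨K₁ * (c * (c * K₂) ^ 2), ε' * ν / (2 * Λ), by positivity, by positivity,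
    fun N hN t ht ρ => ?_⟩
  have hN1 : (1 : ℝ) ≤ N := by exact_mod_cast hN
  have hL : 0 ≤ Real.log N := Real.log_nonneg hN1
  have hp := planck_pos hN
  have hpN : planck N ≤ (N : ℝ)⁻¹ := by
    rw [planck]
    refine inv_anti₀ (by linarith) ?_
    nlinarith [Real.pi_gt_three]
  have hp1 : planck N ≤ 1 := hpN.trans (inv_le_one_of_one_le₀ hN1)
  have htime : |(t : ℝ)| ≤ (1 - ε') / (2 * Λ) * Real.log N := by
    have h1 : ((|t| : ℤ) : ℝ) ≤ (1 - ε) / (2 * Λ) * Real.log N :=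
      (Int.cast_le.2 ht).trans (Int.floor_le _)
    rw [Int.cast_abs] at h1
    refine h1.trans (mul_le_mul_of_nonneg_right ?_ hL)
    refine div_le_div_of_nonneg_right ?_ (by positivity)
    linarith [min_le_left ε 1]
  refine (h₁ _ hp hp1 _).trans ?_
  rw [mul_assoc, mul_assoc]
  refine mul_le_mul_of_nonneg_left ?_ hK₁
  have hterm : ∀ x, ((planck N) ^ scaleExp S ε₀ (S.blockOf x) *
      (((S.Q⁻¹ : symplecticGroup (Fin d) ℝ) : Matrix (Fin d ⊕ Fin d) (Fin d ⊕ Fin d) ℝ) *ᵥ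
        (toReal (A ^ t) *ᵥ ρ)) x) ^ 2 ≤
      (c * K₂) ^ 2 * (Real.exp (-(ε' * ν / (2 * Λ)) * Real.log N) * ‖ρ‖ ^ 2) := by
    intro x
    set g := (Fin.cons ε₀ S.lyap : Fin (S.r + 1) → ℝ) (S.blockOf x) with hg
    have hgν : ν ≤ g := hνle _
    have hgexp : S.exponent (S.blockOf x) ≤ g := S.exponent_le_cons hε₀ _
    have hγ : scaleExp S ε₀ (S.blockOf x) = g / (2 * Λ) := rfl
    have hb : |(((S.Q⁻¹ : symplecticGroup (Fin d) ℝ) :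
        Matrix (Fin d ⊕ Fin d) (Fin d ⊕ Fin d) ℝ) *ᵥ (toReal (A ^ t) *ᵥ ρ)) x| ≤
        c * (K₂ * Real.exp ((S.exponent (S.blockOf x) + δ) * |(t : ℝ)|)) * ‖ρ‖ := by
      rw [mulVec_mulVec]
      exact abs_mulVec_le x (h₂ t x) ρ
    have hs : planck N ^ scaleExp S ε₀ (S.blockOf x) ≤
        Real.exp (-(g / (2 * Λ)) * Real.log N) := by
      have hg0 : 0 ≤ g / (2 * Λ) := div_nonneg (hν.le.trans hgν) (by positivity)
      rw [hγ]
      refine (Real.rpow_le_rpow hp.le hpN hg0).trans (le_of_eq ?_)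
      rw [Real.inv_rpow (by positivity), ← Real.rpow_neg (by positivity),
        Real.rpow_def_of_pos (by positivity), mul_comm]
    -- The central balance: contraction by `N^{-g/(2Λ)}` against expansion at rate at most `g + δ`
    -- up to time `(1 - ε') log N / (2Λ)`.
    have hexp : Real.exp (-(g / (2 * Λ)) * Real.log N) *
        Real.exp ((S.exponent (S.blockOf x) + δ) * |(t : ℝ)|) ≤
        Real.exp (-(ε' * ν / (4 * Λ)) * Real.log N) := by
      rw [← Real.exp_add]
      refine Real.exp_le_exp.2 ?_
      have k1 : (S.exponent (S.blockOf x) + δ) * |(t : ℝ)| ≤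
          (g + δ) * ((1 - ε') / (2 * Λ) * Real.log N) :=
        mul_le_mul (by linarith) htime (abs_nonneg _) (by linarith)
      have k2 : -(g / (2 * Λ)) * Real.log N + (g + δ) * ((1 - ε') / (2 * Λ) * Real.log N) =
          (δ - ε' * g - ε' * δ) * (Real.log N / (2 * Λ)) := by
        field_simp
        ring
      have k3 : (δ - ε' * g - ε' * δ) * (Real.log N / (2 * Λ)) ≤
          (-(ε' * ν / 2)) * (Real.log N / (2 * Λ)) := by
        refine mul_le_mul_of_nonneg_right ?_ (by positivity)
        have := mul_le_mul_of_nonneg_left hgν hε'0.le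
        have := mul_pos hε'0 hδ0
        linarith
      have k4 : (-(ε' * ν / 2)) * (Real.log N / (2 * Λ)) =
          -(ε' * ν / (4 * Λ)) * Real.log N := by
        field_simp
        ring
      linarith
    have hsq : |planck N ^ scaleExp S ε₀ (S.blockOf x) *
        (((S.Q⁻¹ : symplecticGroup (Fin d) ℝ) : Matrix (Fin d ⊕ Fin d) (Fin d ⊕ Fin d) ℝ) *ᵥ
        (toReal (A ^ t) *ᵥ ρ)) x| ≤
        c * K₂ * (Real.exp (-(ε' * ν / (4 * Λ)) * Real.log N) * ‖ρ‖) := by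
      rw [abs_mul, abs_of_pos (by positivity)]
      calc _ ≤ Real.exp (-(g / (2 * Λ)) * Real.log N) *
            (c * (K₂ * Real.exp ((S.exponent (S.blockOf x) + δ) * |(t : ℝ)|)) * ‖ρ‖) :=
            mul_le_mul hs hb (abs_nonneg _) (Real.exp_pos _).le
        _ = c * K₂ * ((Real.exp (-(g / (2 * Λ)) * Real.log N) *
            Real.exp ((S.exponent (S.blockOf x) + δ) * |(t : ℝ)|)) * ‖ρ‖) := by ring
        _ ≤ _ := by
            refine mul_le_mul_of_nonneg_left ?_ (by positivity)
            exact mul_le_mul_of_nonneg_right hexp (norm_nonneg _)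
    rw [← sq_abs]
    refine (pow_le_pow_left₀ (abs_nonneg _) hsq 2).trans (le_of_eq ?_)
    rw [mul_pow, mul_pow _ ‖ρ‖, ← Real.exp_nat_mul]
    congr 3
    push_cast
    ring_nf
  refine (Finset.sum_le_sum fun x _ => hterm x).trans (le_of_eq ?_)
  rw [Finset.sum_const, nsmul_eq_mul, Finset.card_univ, ← hc]
  ring

end SymplecticReduction

end

/-! ### Invariance of the phase space measures -/

section

variable {d : ℕ}

lemma sympl_toReal_mulVec (A : symplecticGroup (Fin d) ℤ) (ρ τ : Phase d) :
    sympl (toReal A *ᵥ ρ) (toReal A *ᵥ τ) = sympl ρ τ := by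
  have h : (toReal A)ᵀ * Matrix.J (Fin d) ℝ * toReal A = Matrix.J (Fin d) ℝ := by
    have := congrArg (fun X => X.map (Int.castRingHom ℝ)) (SymplecticGroup.mem_iff'.1 A.2)
    simp only [Matrix.map_mul, Matrix.map_J] at this
    exact this
  rw [sympl, sympl, mulVec_mulVec, dotProduct_mulVec, vecMul_mulVec, ← dotProduct_mulVec,
    ← Matrix.mul_assoc, h]

/-- The action of the integer symplectic group on the lattice. -/
def latticeEquiv (A : symplecticGroup (Fin d) ℤ) : Lattice d ≃ Lattice d where
  toFun r := (A : Matrix (Fin d ⊕ Fin d) (Fin d ⊕ Fin d) ℤ) *ᵥ r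
  invFun r := ((A⁻¹ : symplecticGroup (Fin d) ℤ) : Matrix (Fin d ⊕ Fin d) (Fin d ⊕ Fin d) ℤ) *ᵥ r
  left_inv r := by
    beta_reduce
    rw [mulVec_mulVec, ← Submonoid.coe_mul, inv_mul_cancel, Submonoid.coe_one, one_mulVec]
  right_inv r := by
    beta_reduce
    rw [mulVec_mulVec, ← Submonoid.coe_mul, mul_inv_cancel, Submonoid.coe_one, one_mulVec]

lemma ofLattice_latticeEquiv (A : symplecticGroup (Fin d) ℤ) (r : Lattice d) :
    ofLattice (latticeEquiv A r) = toReal A *ᵥ ofLattice r :=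
  (toReal_mulVec_ofLattice A r).symm

lemma latticeEquiv_mul (A B : symplecticGroup (Fin d) ℤ) (r : Lattice d) :
    latticeEquiv (A * B) r = latticeEquiv A (latticeEquiv B r) := by
  change (A * B : symplecticGroup (Fin d) ℤ).1 *ᵥ r = A.1 *ᵥ (B.1 *ᵥ r)
  rw [mulVec_mulVec]
  rfl

/-- Invariance of the symplectic form: composing an observable with `A` only permutes its Fourier
coefficients. -/
lemma torusChar_latticeEquiv (A : symplecticGroup (Fin d) ℤ) (r : Lattice d) (ρ : Phase d) :
    torusChar (latticeEquiv A r) (toReal A *ᵥ ρ) = torusChar r ρ := by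
  rw [torusChar_eq, torusChar_eq, ofLattice_latticeEquiv, sympl_toReal_mulVec]

lemma eq_of_latticeEquiv_zpow {A : symplecticGroup (Fin d) ℤ} {e : Lattice d → ℂ}
    (h : ∀ r, e (latticeEquiv A r) = e r) (t : ℤ) (r : Lattice d) :
    e (latticeEquiv (A ^ t) r) = e r := by
  induction t generalizing r with
  | zero => simp [latticeEquiv]
  | succ n ih => rw [_root_.zpow_add_one, latticeEquiv_mul, ih, h]
  | pred n ih =>
    rw [_root_.zpow_sub_one, latticeEquiv_mul, ih, ← h, ← latticeEquiv_mul, mul_inv_cancel]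
    simp [latticeEquiv]

/-! ### The Fourier multiplier of the positive quantization -/

section Kernel

variable {A : Matrix (Fin d ⊕ Fin d) (Fin d ⊕ Fin d) ℝ} (S : SymplecticReduction A) (ε₀ : ℝ)

/-- The exponent of the Fourier transform of `G_ħ ♯ G_ħ`. -/
def kernelExponent (ħ : ℝ) (ρ : Phase d) : ℝ :=
  Real.pi / 2 * (sqNorm (dualMatrix (scaleMatrix S ε₀ ħ)) ρ +
    (Real.pi * ħ) ^ 2 * sqNorm (scaleMatrix S ε₀ ħ) ρ)

lemma kernelExponent_nonneg (ħ : ℝ) (ρ : Phase d) : 0 ≤ kernelExponent S ε₀ ħ ρ := by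
  have h1 := sqNorm_nonneg (dualMatrix (scaleMatrix S ε₀ ħ)) ρ
  have h2 := sqNorm_nonneg (scaleMatrix S ε₀ ħ) ρ
  unfold kernelExponent
  positivity

lemma integrable_kernel_and_integral {ħ : ℝ} (hħ : 0 < ħ) :
    Integrable (moyal ħ (adaptedGaussian S ε₀ ħ) (adaptedGaussian S ε₀ ħ)) ∧
    ∀ r, ∫ v, torusChar r (-v) * moyal ħ (adaptedGaussian S ε₀ ħ) (adaptedGaussian S ε₀ ħ) v =
      ((Real.exp (-kernelExponent S ε₀ ħ (ofLattice r)) : ℝ) : ℂ) := by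
  refine integrable_moyal_gaussian_and_integral (S.det_scaleMatrix_ne_zero ε₀ hħ) hħ
    (C := (2 : ℝ) ^ ((d : ℝ) / 2) * |(scaleMatrix S ε₀ ħ).det| ^ (1 / 2 : ℝ)) ?_ fun ρ => ?_
  · rw [mul_pow, ← Real.rpow_natCast, ← Real.rpow_natCast, ← Real.rpow_mul (by norm_num),
      ← Real.rpow_mul (abs_nonneg _)]
    norm_num
  · rw [adaptedGaussian, sqNorm, neg_mul]

/-- The Fourier expansion of the phase space measure of a state. -/
theorem hasSum_stateMeasure {N : ℕ} [NeZero N] {κ : Phase d}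
    {c : InnerProductSpace.Core ℂ (torusStates N κ)} (hc : IsTorusHilbertStructure c)
    (ψ : torusStates N κ) {b : Phase d → ℂ} {β : Lattice d → ℂ} (hβ : Summable fun s => ‖β s‖)
    (hb : ∀ ρ, HasSum (fun s => β s * torusChar s ρ) (b ρ)) :
    HasSum (fun s => β s * ((Real.exp (-kernelExponent S ε₀ (planck N) (ofLattice s)) : ℝ) : ℂ) *
      c.inner ψ (torusTransl N κ s ψ)) (stateMeasure S ε₀ c ψ b) := by
  obtain ⟨hK, hint⟩ := integrable_kernel_and_integral S ε₀ (planck_pos (NeZero.one_le (n := N)))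
  have hcoeff := torusCoeff_convolution hβ hb hK
  simp only [hint] at hcoeff
  have h := hasSum_inner_opWeyl (N := N) hc ψ
    (b := b ⋆[ContinuousLinearMap.mul ℂ ℂ, volume]
      moyal (planck N) (adaptedGaussian S ε₀ (planck N)) (adaptedGaussian S ε₀ (planck N))) (by
    refine Summable.of_nonneg_of_le (fun _ => norm_nonneg _) (fun s => ?_) hβ
    rw [hcoeff, norm_mul, Complex.norm_real, Real.norm_eq_abs, Real.abs_exp]
    refine mul_le_of_le_one_right (norm_nonneg _) (Real.exp_le_one_iff.2 ?_)
    linarith [kernelExponent_nonneg S ε₀ (planck N) (ofLattice s)])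
  simp only [hcoeff] at h
  exact h

end Kernel

/-- Both exponentials are close to `1`, within `x` and `y`. This crude bound is enough because both
exponents are small up to the Ehrenfest time. -/
lemma abs_exp_neg_sub_exp_neg_le {x y : ℝ} (hx : 0 ≤ x) (hy : 0 ≤ y) :
    |Real.exp (-x) - Real.exp (-y)| ≤ x + y := by
  have h1 := Real.add_one_le_exp (-x)
  have h2 := Real.add_one_le_exp (-y)
  have h3 : Real.exp (-x) ≤ 1 := Real.exp_le_one_iff.2 (by linarith)
  have h4 : Real.exp (-y) ≤ 1 := Real.exp_le_one_iff.2 (by linarith)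
  rw [abs_le]
  constructor <;> linarith

end

end CatMap

end

/-! ### Comparison of the two Fourier expansions -/

theorem proposition4p3 {d : ℕ} (A : Matrix.symplecticGroup (Fin d) ℤ)
    (hA : (1 : ℂ) ∉ cspec (toReal A)) (hmax : 0 < lyapMax (toReal A))
    (S : SymplecticReduction (toReal A))
    (ε₀ : ℝ) (hε₀ : 0 < ε₀) (hε₀' : ε₀ ≤ lyapMax (toReal A))
    (ε : ℝ) (hε : 0 < ε) (a : Phase d → ℂ) (ha : IsTorusObservable a) :
    ∃ R : ℕ → ℝ, Filter.Tendsto R Filter.atTop (nhds 0) ∧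
      ∀ (N : ℕ) (_ : 1 ≤ N)
        (M : 𝓢'(Conf d, ℂ) →L[ℂ] 𝓢'(Conf d, ℂ)) (_ : IsPropagator (planck N) (toReal A) M)
        (κ : Phase d) (_ : ∀ i, κ i ∈ Set.Ico 0 (2 * Real.pi))
        (_ : (torusStates N κ).map M.toLinearMap = torusStates N κ)
        (c : InnerProductSpace.Core ℂ (torusStates N κ)) (_ : IsTorusHilbertStructure c)
        (ψ : torusStates N κ) (_ : c.inner ψ ψ = 1)
        (_ : ∃ z : ℂ, M (ψ : 𝓢'(Conf d, ℂ)) = z • (ψ : 𝓢'(Conf d, ℂ)))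
        (t : ℤ) (_ : |t| ≤ ehrenfestTime (toReal A) ε N),
        ‖stateMeasure S ε₀ c ψ (fun ρ => a (toReal (A ^ t) *ᵥ ρ)) - stateMeasure S ε₀ c ψ a‖
          ≤ R N := by
  obtain ⟨K, η, hK, hη, hbound⟩ := S.exists_sqNorm_zpow_le hmax hε₀ hε₀' hε
  obtain ⟨α, hα, hsum⟩ := ha.exists_fourier_series
  have hα0 : Summable fun s => ‖α s‖ := by simpa using hα 0
  have hα2 : Summable fun s => ‖α s‖ * ‖ofLattice s‖ ^ 2 := by
    refine Summable.of_nonneg_of_le (fun _ => by positivity) (fun s => ?_) (hα 2)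
    rw [mul_comm]
    have := norm_nonneg (ofLattice s)
    gcongr
    linarith
  refine ⟨fun N => (∑' s, ‖α s‖ * ‖ofLattice s‖ ^ 2) *
    (Real.pi * K * Real.exp (-η * Real.log N)), ?_, ?_⟩
  · have h1 : Filter.Tendsto (fun N : ℕ => Real.exp (-η * Real.log N)) Filter.atTop (nhds 0) :=
      Real.tendsto_exp_atBot.comp ((Real.tendsto_log_atTop.comp
        tendsto_natCast_atTop_atTop).const_mul_atTop_of_neg (neg_neg_of_pos hη))
    simpa using (h1.const_mul (Real.pi * K)).const_mul (∑' s, ‖α s‖ * ‖ofLattice s‖ ^ 2)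
  intro N hN M hM κ _ hmap c hc ψ hψ ⟨z, hz⟩ t ht
  have : NeZero N := ⟨by omega⟩
  set e : Lattice d → ℂ := fun r => c.inner ψ (torusTransl N κ r ψ) with he
  have hinv : ∀ (t : ℤ) (r), e (latticeEquiv (A ^ t) r) = e r := fun t =>
    eq_of_latticeEquiv_zpow (inner_torusTransl_mulVec A hM.intertwines hmap hc hψ hz) t
  have hcoeff : ∀ ρ, HasSum (fun s => α (latticeEquiv (A ^ t) s) * torusChar s ρ)
      (a (toReal (A ^ t) *ᵥ ρ)) := fun ρ => by
    have h := (latticeEquiv (A ^ t)).hasSum_iff.2 (hsum (toReal (A ^ t) *ᵥ ρ))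
    simpa only [Function.comp_def, torusChar_latticeEquiv] using h
  have h1 := hasSum_stateMeasure S ε₀ hc ψ ((latticeEquiv (A ^ t)).summable_iff.2 hα0) hcoeff
  have h2 := hasSum_stateMeasure S ε₀ hc ψ hα0 hsum
  have hcancel : ∀ s, latticeEquiv (A ^ t) (latticeEquiv (A ^ (-t)) s) = s := fun s => by
    rw [← latticeEquiv_mul, ← _root_.zpow_add, add_neg_cancel, _root_.zpow_zero]
    simp [latticeEquiv]
  -- Substituting `A^{-t} s` for `s` in the first series gives both series the coefficient `α s`, so
  -- only the multipliers differ once the invariance of `e` is used.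
  have h3 := ((latticeEquiv (A ^ (-t))).hasSum_iff.2 h1).sub h2
  have hnorm : ∀ s, ‖α s * ((Real.exp (-kernelExponent S ε₀ (planck N)
        (ofLattice (latticeEquiv (A ^ (-t)) s))) : ℝ) : ℂ) * e s -
      α s * ((Real.exp (-kernelExponent S ε₀ (planck N) (ofLattice s)) : ℝ) : ℂ) * e s‖ ≤
      ‖α s‖ * ‖ofLattice s‖ ^ 2 * (Real.pi * K * Real.exp (-η * Real.log N)) := by
    intro s
    have hexp : ∀ u : ℤ, |u| ≤ ehrenfestTime (toReal A) ε N →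
        kernelExponent S ε₀ (planck N) (ofLattice (latticeEquiv (A ^ u) s)) ≤
          Real.pi / 2 * (K * Real.exp (-η * Real.log N) * ‖ofLattice s‖ ^ 2) := fun u hu => by
      rw [ofLattice_latticeEquiv]
      exact mul_le_mul_of_nonneg_left (hbound N hN u hu _) (by positivity)
    have hx := hexp (-t) (by rwa [abs_neg])
    -- The undisturbed multiplier is the case of time `0`, which is admissible because `0 ≤ |t|`
    -- lies below the Ehrenfest time.
    have hy := hexp 0 (by simpa using (abs_nonneg t).trans ht)
    have hs0 : latticeEquiv (A ^ (0 : ℤ)) s = s := by simp [latticeEquiv]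
    rw [hs0] at hy
    have hdiff := abs_exp_neg_sub_exp_neg_le
      (kernelExponent_nonneg S ε₀ (planck N) (ofLattice (latticeEquiv (A ^ (-t)) s)))
      (kernelExponent_nonneg S ε₀ (planck N) (ofLattice s))
    rw [← sub_mul, ← mul_sub, norm_mul, norm_mul, ← Complex.ofReal_sub, Complex.norm_real,
      Real.norm_eq_abs]
    calc _ ≤ ‖α s‖ * (Real.pi * K * Real.exp (-η * Real.log N) * ‖ofLattice s‖ ^ 2) * 1 := by
          refine mul_le_mul (mul_le_mul_of_nonneg_left (hdiff.trans ?_) (norm_nonneg _))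
            (norm_inner_torusTransl_le hc hψ s) (norm_nonneg _) (by positivity)
          linarith
      _ = _ := by ring
  have h4 : HasSum (fun s => α s * ((Real.exp (-kernelExponent S ε₀ (planck N)
        (ofLattice (latticeEquiv (A ^ (-t)) s))) : ℝ) : ℂ) * e s -
      α s * ((Real.exp (-kernelExponent S ε₀ (planck N) (ofLattice s)) : ℝ) : ℂ) * e s)
      (stateMeasure S ε₀ c ψ (fun ρ => a (toReal (A ^ t) *ᵥ ρ)) - stateMeasure S ε₀ c ψ a) := by
    refine h3.congr_fun fun s => ?_
    simp only [Function.comp_apply, hcancel]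
    rw [show c.inner ψ (torusTransl N κ (latticeEquiv (A ^ (-t)) s) ψ) = e s from hinv (-t) s]
  rw [← h4.tsum_eq]
  exact tsum_of_norm_bounded (hα2.hasSum.mul_right _) hnorm
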